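/- **Setting.** Let $X\subset\mathbb R^n$ be compact, $\mu$ a probability measure on $X$ without atoms (points have measure $0$), and $\mathcal B$ the Lebesgue $\sigma$-algebra of $(X,\mu)$ (the $\mu$-completion of the Borel sets). Let $Z_1,\dots,Z_N\subseteq X$ be closed with $\mu(Z_j)>0$, $\mu(Z_i\cap Z_j)=0$ for $i\ne j$, $\mu(\bigcup_j Z_j)=1$, and let $T:X\to X$ satisfy * (c1) for each $j$, $T|_{\operatorname{int}Z_j}$ extends uniquely to a continuous injective map $Z_j\to\overline{T(\operatorname{int}Z_j)}$ (interior in $\mathbb R^n$); * (c2) $TA,\,T^{-1}A\in\mathcal B$ for $A\in\mathcal B$, and $\mu(A)=0$ implies $\mu(T^{-1}A)=0$; * (c3) the cylinders $Z_{j_0\cdots j_k}=\bigcap_{i\le k}T^{-i}Z_{j_i}$ of positive measure, $k\ge0$, generate $\mathcal B$ modulo $\mu$-null sets; * (c4) there are constants $s_j\ge1$ with $\mu(TA)=s_j\,\mu(A)$ for all $A\in\mathcal B$, $A\subseteq Z_j$; * (c5) if $A\in\mathcal B$ and $T^{-1}A=A$, then $\mu(A)\in\{0,1\}$; * (c6)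 $\mu\big(\bigcup_{k\ge0}T^k(\bigcup_j\partial Z_j)\big)=0$ (boundary in $\mathbb R^n$). **Hofbauer tower.** Let $\{D_u:u\in\alpha\}$, $\alpha\subseteq\mathbb N$, enumerate without repetition the classes modulo $\mu$-null sets of the sets $T^kZ_{j_0\cdots j_k}$ with $\mu(Z_{j_0\cdots j_k})>0$, $k\ge 0$, the first $N$ being $Z_1,\dots,Z_N$; each $D_u$ is represented by a Borel subset of $Z_{j_k}$. Write $D_u\to D_v$ if $D_v=Z_j\cap TD_u$ modulo $\mu$ for some $j$. Let $\hat X=\bigsqcup_uD_u$, $\pi(x,u)=x$, $\hat X_0=\bigsqcup_{u\le N}D_u$, and let $\bar\mu$ be the measure on $\hat X$ equal to $\mu$ on each level. The tower map is $\hat T(x,u)=(Tx,v)$, where $D_v=Z_j\cap TD_u$ if $Tx\in Z_j$ (defined $\bar\mu$-a.e.). Put $\hat\mu_m(A)=\frac1m\sum_{k<m}\bar\mu(\hat T^{-k}A\cap\hat X_0)$. Say that $\mu$ *lifts to* a probability measure $\hat\mu$ on $\hat X$ if $\hat\mu_m\to\hat\mu$ vaguely, that is, when tested against continuous functions of $(x,u)\in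 X\times\alpha$ that vanish outside finitely many levels. **Rug system.** Given such $\hat\mu$, put $\rho(D_u)=\hat\mu(D_u)/\bar\mu(D_u)$, $Y=\bigsqcup_uD_u\times[0,\rho(D_u)]$ with its Borel $\sigma$-algebra $\mathcal C$, $\nu=(\bar\mu\times\text{Lebesgue})|_Y$, $\hat\pi(\hat x,y)=\hat x$, and, for $\hat x\in D_u\subseteq Z_j$ (as a level of $\hat X$) with $\hat T\hat x\in D_v$, $$F(\hat x,y)=\Big(\hat T\hat x,\ \frac y{s_j}+\sum_{k}\ \sum_{t<u:\ Z_k\supseteq D_t\to D_v}\frac{\rho(D_t)}{s_k}\Big).$$ **Natural extension.** A probability-preserving system $(Y,\mathcal C,\nu,F)$ is a natural extension of a probability-preserving system $(X,\mathcal B,m,T)$ with factor map $\phi$ if there are $X^*\in\mathcal B$, $Y^*\in\mathcal C$ with $m(X^*)=\nu(Y^*)=1$, $TX^*\subseteq X^*$, $FY^*\subseteq Y^*$, such that: (ne1) $F:Y^*\to Y^*$ is a bijection, measurable with measurable inverse; (ne2) $\phi:Y^*\to X^*$ is surjective and bi-measurable (preimages of sets in $\mathcal B$ are in the $\nu$-completion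 of $\mathcal C$, and images of sets in $\mathcal C$ are in $\mathcal B$); (ne3) $m=\nu\circ\phi^{-1}$; (ne4) $\phi\circ F=T\circ\phi$ on $Y^*$; (ne5) $\bigvee_{k\ge0}F^k(\phi^{-1}\mathcal B)=\mathcal C$ modulo $\nu$-null sets. **Theorem.** Let $(X,\mathcal B,\mu,T)$ be as above, satisfying (c1)–(c6), and assume that $\mu$ lifts to a probability measure $\hat\mu$ on $\hat X$. Then $(Y,\mathcal C,\nu,F)$ is a natural extension of $(X,\mathcal B,\hat\mu\circ\pi^{-1},T)$ with factor map $\phi=\pi\circ\hat\pi$. If moreover $\mu$ is $T$-invariant, then $\hat\mu\circ\pi^{-1}=\mu$, the measure $\hat\mu$ is $\hat T$-invariant, and it is the unique lift of $\mu$: it is the only $\hat T$-invariant probability measure on $\hat X$ that projects to $\mu$, and the only probability measure to which $\mu$ lifts. -/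

import Mathlib

open MeasureTheory Set Filter Topology

noncomputable section

namespace HofbauerTower

/-! ### The class of transformations -/

section System

variable {n N : ℕ} {X : Set (EuclideanSpace ℝ (Fin n))}

/-- The interior, taken in `ℝⁿ`, of a subset of `X`. -/
def intr (A : Set X) : Set X := Subtype.val ⁻¹' interior (Subtype.val '' A)

/-- The usual boundary in `ℝⁿ` of a subset of `X`. -/
def bdry (A : Set X) : Set X := Subtype.val ⁻¹' frontier (Subtype.val '' A)

/-- The Lebesgue `σ`-algebra `ℬ` of `(X, μ)`: the completion of the Borel `σ`-algebra with
respect to `μ`. Its members are the sets `A` with `NullMeasurableSet A μ`. -/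
abbrev lebesgueAlgebra (μ : Measure X) : MeasurableSpace X where
  MeasurableSet' A := NullMeasurableSet A μ
  measurableSet_empty := MeasurableSet.empty.nullMeasurableSet
  measurableSet_compl _ hA := hA.compl
  measurableSet_iUnion _ hA := NullMeasurableSet.iUnion hA

theorem measurableSet_lebesgueAlgebra (μ : Measure X) (A : Set X) :
    MeasurableSet[lebesgueAlgebra μ] A ↔ NullMeasurableSet A μ := Iff.rfl

/-- A finite partition modulo `μ` into closed sets of positive measure. -/
structure IsPartition (μ : Measure X) (Z : Fin N → Set X) : Prop where
  closed : ∀ j, IsClosed (Z j)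
  pos : ∀ j, 0 < μ (Z j)
  overlap : ∀ i j, i ≠ j → μ (Z i ∩ Z j) = 0
  cover : μ (⋃ j, Z j) = 1

/-- The set `Z_{w 0 … w k} = Z_{w 0} ∩ T⁻¹ Z_{w 1} ∩ ⋯ ∩ T⁻ᵏ Z_{w k}`. Only the letters
`w 0, …, w k` of the word `w` matter. -/
def cyl (T : X → X) (Z : Fin N → Set X) (k : ℕ) (w : ℕ → Fin N) : Set X :=
  {x | ∀ i ≤ k, T^[i] x ∈ Z (w i)}

/-- On every piece, `T` restricted to the interior extends uniquely to a continuous injective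
map from the piece to the closure of the image of its interior. -/
def C1 (T : X → X) (Z : Fin N → Set X) : Prop :=
  ∀ j, ∃! g : Z j → closure (T '' intr (Z j)),
    Continuous g ∧ Function.Injective g ∧ ∀ x : Z j, (x : X) ∈ intr (Z j) → (g x : X) = T x

/-- Images and preimages of members of `ℬ` are in `ℬ`; preimages of null sets are null. -/
def C2 (μ : Measure X) (T : X → X) : Prop :=
  ∀ A : Set X, NullMeasurableSet A μ →
    NullMeasurableSet (T '' A) μ ∧ NullMeasurableSet (T ⁻¹' A) μ ∧
      (μ A = 0 → μ (T ⁻¹' A) = 0)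

/-- The cylinder sets generate `ℬ`, modulo `μ`-null sets. -/
def C3 (μ : Measure X) (T : X → X) (Z : Fin N → Set X) : Prop :=
  ∀ A : Set X, NullMeasurableSet A μ →
    ∃ A' : Set X, MeasurableSet[MeasurableSpace.generateFrom
      {S | ∃ k w, S = cyl T Z k w ∧ 0 < μ S}] A' ∧ A =ᵐ[μ] A'

/-- `T` has the constant Jacobian `s j ≥ 1` on `Z j`. -/
def C4 (μ : Measure X) (T : X → X) (Z : Fin N → Set X) (s : Fin N → ℝ) : Prop :=
  ∀ j, 1 ≤ s j ∧
    ∀ A : Set X, NullMeasurableSet A μ → A ⊆ Z j → μ (T '' A) = ENNReal.ofReal (s j) * μ A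

/-- `μ`, not necessarily invariant, is ergodic. -/
def C5 (μ : Measure X) (T : X → X) : Prop :=
  ∀ A : Set X, NullMeasurableSet A μ → T ⁻¹' A = A → μ A = 0 ∨ μ A = 1

/-- The forward orbit of the boundaries of the pieces is null. -/
def C6 (μ : Measure X) (T : X → X) (Z : Fin N → Set X) : Prop :=
  μ (⋃ k : ℕ, T^[k] '' ⋃ j, bdry (Z j)) = 0

/-- `μ` is `T`-invariant. -/
def IsInvariant (μ : Measure X) (T : X → X) : Prop :=
  ∀ A : Set X, NullMeasurableSet A μ → μ (T ⁻¹' A) = μ A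

/-! ### The Hofbauer tower -/

/-- `(D u)`, `u ∈ α ⊆ ℕ`, enumerates without repetition the classes, modulo `μ`-null sets, of
the sets `Tᵏ Z_{w 0 … w k}`, where `Z_{w 0 … w k}` runs through the cylinders of positive
measure, and begins with the pieces `Z j`. As `Tᵏ Z_{w 0 … w k} ⊆ Z_{w k}`, the representative
`D u` is taken inside `Z_{w k}`. It may be any Borel set in its class, such as a closed one. -/
structure IsLevels (μ : Measure X) (T : X → X) (Z : Fin N → Set X) (α : Set ℕ)
    (D : ℕ → Set X) : Prop where
  base : ∀ j : Fin N, (j : ℕ) ∈ α ∧ D j = Z j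
  measurable : ∀ u ∈ α, MeasurableSet (D u)
  image : ∀ u ∈ α, ∃ k w, 0 < μ (cyl T Z k w) ∧ D u ⊆ Z (w k) ∧
    D u =ᵐ[μ] (T^[k] '' cyl T Z k w : Set X)
  exhaust : ∀ k w, 0 < μ (cyl T Z k w) → ∃ u ∈ α, D u =ᵐ[μ] (T^[k] '' cyl T Z k w : Set X)
  distinct : ∀ u ∈ α, ∀ v ∈ α, D u =ᵐ[μ] D v → u = v

/-- The tower `X̂ = ⨆ D u`; the point `x` of the level `D u` is `(u, x)`. -/
def tower (α : Set ℕ) (D : ℕ → Set X) : Set (ℕ × X) := {p | p.1 ∈ α ∧ p.2 ∈ D p.1}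

/-- The base `X̂₀` of the tower: the union of the first `N` levels. -/
def towerBase (N : ℕ) (α : Set ℕ) (D : ℕ → Set X) : Set (ℕ × X) :=
  {p ∈ tower α D | p.1 < N}

/-- The relation `D v = Z i ∩ T (D u)` between levels (as classes modulo null sets). -/
def ArrowVia (μ : Measure X) (T : X → X) (Z : Fin N → Set X) (α : Set ℕ) (D : ℕ → Set X)
    (i : Fin N) (u v : ℕ) : Prop :=
  u ∈ α ∧ v ∈ α ∧ D v =ᵐ[μ] (Z i ∩ T '' D u : Set X)

/-- The arrow relation `D u → D v` of the canonical Markov graph. -/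
def Arrow (μ : Measure X) (T : X → X) (Z : Fin N → Set X) (α : Set ℕ) (D : ℕ → Set X)
    (u v : ℕ) : Prop :=
  ∃ i, ArrowVia μ T Z α D i u v

/-- The tower map `T̂ (x, D u) = (T x, Z i ∩ T (D u))` if `T x ∈ Z i`. Almost everywhere there is
exactly one such level; on the exceptional null set the value is immaterial. -/
def towerMap (μ : Measure X) (T : X → X) (Z : Fin N → Set X) (α : Set ℕ) (D : ℕ → Set X)
    (p : ℕ × X) : ℕ × X :=
  (sInf {v | ∃ i, T p.2 ∈ Z i ∧ ArrowVia μ T Z α D i p.1 v}, T p.2)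

/-- The measure `μ̄` on the tower, equal to `μ` on each level. -/
def muBar (μ : Measure X) (α : Set ℕ) (D : ℕ → Set X) : Measure (ℕ × X) :=
  Measure.sum fun u : α => (μ.restrict (D u)).map fun x => ((u : ℕ), x)

/-- The Cesàro means `μ̂ₘ(A) = (1/m) ∑_{k<m} μ̄(T̂⁻ᵏ A ∩ X̂₀)`. -/
def cesaro (μ : Measure X) (T : X → X) (Z : Fin N → Set X) (α : Set ℕ) (D : ℕ → Set X)
    (m : ℕ) : Measure (ℕ × X) :=
  (m : ENNReal)⁻¹ • ∑ k ∈ Finset.range m,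
    ((muBar μ α D).restrict (towerBase N α D)).map (towerMap μ T Z α D)^[k]

/-- `μ` lifts to the probability measure `μ̂` on the tower: the Cesàro means converge to `μ̂` in
the vague topology. (`X` is compact, so that continuous functions with compact support are
arbitrary continuous functions on finitely many levels.) -/
structure LiftsTo (μ : Measure X) (T : X → X) (Z : Fin N → Set X) (α : Set ℕ)
    (D : ℕ → Set X) (μhat : Measure (ℕ × X)) : Prop where
  prob : IsProbabilityMeasure μhat
  carried : μhat (tower α D)ᶜ = 0
  vague : ∀ f : ℕ × X → ℝ, Continuous f → HasCompactSupport f →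
    Tendsto (fun m => ∫ p, f p ∂(cesaro μ T Z α D m)) atTop (𝓝 (∫ p, f p ∂μhat))

/-- `κ` is a probability measure on the tower which is invariant under the tower map and
projects to `μ`. -/
structure IsInvariantLift (μ : Measure X) (T : X → X) (Z : Fin N → Set X) (α : Set ℕ)
    (D : ℕ → Set X) (κ : Measure (ℕ × X)) : Prop where
  prob : IsProbabilityMeasure κ
  carried : κ (tower α D)ᶜ = 0
  invariant : ∀ A, MeasurableSet A → κ (towerMap μ T Z α D ⁻¹' A) = κ A
  proj : κ.map Prod.snd = μ

/-! ### The rugs -/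

/-- The constant value `ρ(D u) = μ̂(D u) / μ̄(D u)` of the density of `μ̂` on the level `D u`. -/
def rho (μ : Measure X) (α : Set ℕ) (D : ℕ → Set X) (μhat : Measure (ℕ × X)) (u : ℕ) : ℝ :=
  (μhat ({u} ×ˢ D u)).toReal / (muBar μ α D ({u} ×ˢ D u)).toReal

/-- The space `Y`, the disjoint union of the rugs `D u × [0, ρ(D u)]`. -/
def rugs (μ : Measure X) (α : Set ℕ) (D : ℕ → Set X) (μhat : Measure (ℕ × X)) :
    Set ((ℕ × X) × ℝ) :=
  {z | z.1 ∈ tower α D ∧ z.2 ∈ Icc 0 (rho μ α D μhat z.1.1)}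

/-- The measure `ν`: the product of `μ̄` and Lebesgue measure on the rugs. -/
def rugMeasure (μ : Measure X) (α : Set ℕ) (D : ℕ → Set X) (μhat : Measure (ℕ × X)) :
    Measure ((ℕ × X) × ℝ) :=
  ((muBar μ α D).prod volume).restrict (rugs μ α D μhat)

open Classical in
/-- The Jacobian `s j` on the level `D u`, where `j` is the one index with `D u ⊆ Z j`. -/
def levelSlope (Z : Fin N → Set X) (s : Fin N → ℝ) (D : ℕ → Set X) (u : ℕ) : ℝ :=
  ∑ j, if D u ⊆ Z j then s j else 0

open Classical in
/-- The map `F`: it acts as the tower map horizontally; vertically it squeezes the part of the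
rug over `D u` that goes to the rug over `D v` by the Jacobian, and stacks it on the parts coming
from the rugs over `D t` with `t < u` and `D t → D v`. -/
def rugMap (μ : Measure X) (T : X → X) (Z : Fin N → Set X) (s : Fin N → ℝ) (α : Set ℕ)
    (D : ℕ → Set X) (μhat : Measure (ℕ × X)) (z : (ℕ × X) × ℝ) : (ℕ × X) × ℝ :=
  (towerMap μ T Z α D z.1,
    z.2 / levelSlope Z s D z.1.1 +
      ∑ t ∈ (Finset.range z.1.1).filter
          (fun t => Arrow μ T Z α D t (towerMap μ T Z α D z.1).1),
        rho μ α D μhat t / levelSlope Z s D t)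

end System

/-! ### Natural extensions -/

/-- `(Y, 𝒞, ν, F)` is a natural extension of `(X, ℬ, m, T)` with factor map `φ`. Here `𝒞` is the
`σ`-algebra of the measurable subsets of `Y`, which is a subset of `Ω` that carries `ν`, and the
maps `F` and `φ` matter on `Y` only. -/
def IsNaturalExtension {Ω X : Type*} [MeasurableSpace Ω] [MeasurableSpace X]
    (Y : Set Ω) (ν : Measure Ω) (F : Ω → Ω)
    (m : Measure X) (ℬ : MeasurableSpace X) (T : X → X) (φ : Ω → X) : Prop :=
  -- both systems preserve a probability measure
  IsProbabilityMeasure ν ∧ IsProbabilityMeasure m ∧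
  (AEMeasurable F ν ∧ ν.map F = ν) ∧
  (∀ A, MeasurableSet[ℬ] A → m (T ⁻¹' A) = m A) ∧
  ∃ (Xs : Set X) (Ys : Set Ω),
    MeasurableSet[ℬ] Xs ∧ MeasurableSet Ys ∧ Ys ⊆ Y ∧ m Xs = 1 ∧ ν Ys = 1 ∧
    MapsTo T Xs Xs ∧ MapsTo F Ys Ys ∧
    -- `F` is invertible almost everywhere
    (BijOn F Ys Ys ∧ (∀ C, MeasurableSet C → MeasurableSet (Ys ∩ F ⁻¹' C)) ∧
      (∀ C, MeasurableSet C → C ⊆ Ys → MeasurableSet (F '' C))) ∧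
    -- `φ : Ys → Xs` is surjective and bi-measurable
    (φ '' Ys = Xs ∧ (∀ A, MeasurableSet[ℬ] A → NullMeasurableSet (Ys ∩ φ ⁻¹' A) ν) ∧
      (∀ C, MeasurableSet C → C ⊆ Ys → MeasurableSet[ℬ] (φ '' C))) ∧
    -- `φ` preserves the measure structure
    (∀ A, MeasurableSet[ℬ] A → m A = ν (Ys ∩ φ ⁻¹' A)) ∧
    -- `φ` preserves the dynamics
    (∀ z ∈ Ys, φ (F z) = T (φ z)) ∧
    -- the `σ`-algebras `Fᵏ (φ⁻¹ ℬ)`, `k ≥ 0`, generate `𝒞` modulo `ν`-null sets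
    ((∀ (k : ℕ) (A : Set X), MeasurableSet[ℬ] A →
        NullMeasurableSet (F^[k] '' (Ys ∩ φ ⁻¹' A)) ν) ∧
      ∀ C : Set Ω, MeasurableSet C →
        ∃ C' : Set Ω, MeasurableSet[MeasurableSpace.generateFrom
          {S | ∃ (k : ℕ) (A : Set X), MeasurableSet[ℬ] A ∧ S = F^[k] '' (Ys ∩ φ ⁻¹' A)}] C' ∧
          C =ᵐ[ν] C')

end HofbauerTower

end

open MeasureTheory Set Filter Topology

noncomputable section

namespace HofbauerTower

/-! ### Preliminaries on measures -/

section Prelim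

open scoped ENNReal symmDiff

/-! The proof rests on the constancy of the Jacobian on each piece. After discarding a null set, `T`
is replaced by a Borel map that is injective on the pieces and leaves a conull set invariant
(`IsCleanTower`, verified in `IsSystem.isCleanTower`). The tower map then sends a measure with
density constant on levels to another such measure. The densities evolve by a countable matrix, `(L
r)(v) = ∑_{t → v} r(t) / s(t)`, where `s(t)` is the Jacobian on the level `t` (`map_levelMeasure`).
Hence the Cesàro means have constant densities on levels, these densities converge to `ρ`, and `μ̂`
has density `ρ`. A Fatou argument gives `L ρ ≤ ρ`. Equality follows since the tower map preserves
total mass and `μ̂` has mass one (`isRugWeight`).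

The equation `L ρ = ρ` says that the strips of height `ρ(t) / s(t)` over the arrows `t → v` exactly
fill the rug over `D v`. The map of the rugs expands horizontally by `s(t)` and contracts vertically
by the same factor, so it preserves volume (`map_rugStep`). Disjointness of the strips makes it
injective almost everywhere (`injOn_rugStep`), and a measure-preserving map with this property is
bijective on a conull set.

For generation, the level and the height of a point must be recovered from the base points of its
past. The level after `k` steps is `T^k` of the part of the starting level inside the `k`-cell of
the itinerary. A density theorem shows that for large `k` the starting level nearly fills this cell
for most points. Since `T^k` has constant Jacobian there, the level after `k` steps is close in
measure to `T^k` of the whole cell, which depends on the base point alone. As distinct levels are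
distinct modulo null sets, the event "the level after `k` steps is `v`" is approximated by events in
the base point (`eventually_measure_level_symmDiff_le`). The height is then determined because `F^k`
contracts fibres by the product of the Jacobians. This product tends to infinity almost everywhere:
otherwise whole levels would follow a single itinerary, which is impossible for a measure without
atoms (`ae_tendsto_prod_slope`).

The same approximation shows that an invariant measure on the tower, dominated on each level by a
multiple of `μ`, is determined by its projection (`eq_of_map_snd_eq`). If `μ` is invariant it is
ergodic, so the projection of `μ̂`, which is invariant and absolutely continuous, equals `μ`;
uniqueness of the invariant lift follows. Uniqueness of the vague limit follows from convergence of
the densities. -/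

theorem exists_box_subset_of_isOpen {W : Set (ℕ → ℕ)} (hW : IsOpen W) (b : ℕ → ℕ)
    (h : {x : ℕ → ℕ | ∀ i, x i ≤ b i} ⊆ W) : ∃ k, {x : ℕ → ℕ | ∀ i < k, x i ≤ b i} ⊆ W := by
  by_contra! hc
  have hc' : ∀ k, ∃ x : ℕ → ℕ, (∀ i < k, x i ≤ b i) ∧ x ∉ W := fun k => by
    obtain ⟨x, hx, hxW⟩ := Set.not_subset.1 (hc k)
    exact ⟨x, hx, hxW⟩
  choose x hx hxW using hc'
  have hP : IsCompact {x : ℕ → ℕ | ∀ i, x i ≤ b i} := by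
    have : {x : ℕ → ℕ | ∀ i, x i ≤ b i} = Set.univ.pi fun i => Set.Iic (b i) := by
      ext; simp [Pi.le_def]
    rw [this]
    exact isCompact_univ_pi fun i => (Set.finite_Iic _).isCompact
  -- The points `x k` need not lie in the compact box, so they are truncated by `b`. Truncation
  -- leaves coordinate `i` unchanged once `k > i`, so the limit is the same.
  obtain ⟨a, ha, φ, hφ, hlim⟩ := hP.tendsto_subseq (x := fun k i => min (x k i) (b i))
    (fun k i => min_le_right _ _)
  have hlim' : Tendsto (fun n => x (φ n)) atTop (𝓝 a) := by
    rw [tendsto_pi_nhds] at hlim ⊢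
    intro i
    refine (hlim i).congr' ?_
    filter_upwards [eventually_gt_atTop i] with n hn
    exact min_eq_left (hx _ _ (hn.trans_le hφ.le_apply))
  obtain ⟨n, hn⟩ := (hlim'.eventually (hW.mem_nhds (h ha))).exists
  exact hxW _ hn

/-- Analytic sets are measured from within by compact sets. -/
theorem exists_isCompact_subset_of_lt_measure_range {X : Type*} [TopologicalSpace X]
    [MeasurableSpace X] {μ : Measure X} [μ.OuterRegular] {f : (ℕ → ℕ) → X}
    (hf : Continuous f) {r : ℝ≥0∞} (hr : r < μ (range f)) :
    ∃ K ⊆ range f, IsCompact K ∧ r ≤ μ K := by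
  have step : ∀ (S : Set (ℕ → ℕ)) (i : ℕ), r < μ (f '' S) →
      ∃ n, r < μ (f '' (S ∩ {x | x i ≤ n})) := by
    intro S i hS
    have hmono : Monotone fun n => f '' (S ∩ {x | x i ≤ n}) := fun m n hmn =>
      image_mono (inter_subset_inter_right _ fun x (hx : x i ≤ m) => hx.trans hmn)
    have hU : f '' S = ⋃ n, f '' (S ∩ {x | x i ≤ n}) := by
      rw [← image_iUnion, ← inter_iUnion]
      congr 1
      ext x
      simp only [mem_inter_iff, mem_iUnion, mem_ofPred_eq, iff_self_and]
      exact fun _ => ⟨x i, le_rfl⟩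
    rw [hU, hmono.measure_iUnion] at hS
    exact lt_iSup_iff.1 hS
  choose! g hg using step
  -- The coordinates are bounded one at a time. Continuity from below allows each bound to be chosen
  -- with the image still of measure greater than `r`.
  let S : ℕ → Set (ℕ → ℕ) := fun k =>
    Nat.rec univ (fun i S => S ∩ {x | x i ≤ g S i}) k
  have hS : ∀ k, r < μ (f '' S k) := by
    intro k
    induction k with
    | zero => simpa [S] using hr
    | succ k ih => exact hg _ _ ih
  let b : ℕ → ℕ := fun i => g (S i) i
  have hSb : ∀ k, S k = {x | ∀ i < k, x i ≤ b i} := by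
    intro k
    induction k with
    | zero => simp [S]
    | succ k ih =>
      change S k ∩ {x | x k ≤ b k} = _
      rw [ih]
      ext x
      simp only [mem_inter_iff, mem_ofPred_eq, Nat.lt_succ_iff_lt_or_eq]
      constructor
      · rintro ⟨h1, h2⟩ i (hi | rfl)
        exacts [h1 i hi, h2]
      · exact fun h => ⟨fun i hi => h i (Or.inl hi), h k (Or.inr rfl)⟩
  have hP : IsCompact {x : ℕ → ℕ | ∀ i, x i ≤ b i} := by
    have : {x : ℕ → ℕ | ∀ i, x i ≤ b i} = Set.univ.pi fun i => Set.Iic (b i) := by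
      ext; simp [Pi.le_def]
    rw [this]
    exact isCompact_univ_pi fun i => (Set.finite_Iic _).isCompact
  refine ⟨f '' {x | ∀ i, x i ≤ b i}, image_subset_range _ _, hP.image hf, ?_⟩
  -- Images need not commute with the decreasing intersection of the sets `S k`. Open neighbourhoods
  -- replace continuity from above: each one of the image of the compact box already contains the
  -- image of some `S k`.
  rw [Set.measure_eq_iInf_isOpen]
  refine le_iInf₂ fun V hV => le_iInf fun hVo => ?_
  obtain ⟨k, hk⟩ := exists_box_subset_of_isOpen (hVo.preimage hf) b (image_subset_iff.1 hV)
  refine (hS k).le.trans (measure_mono ?_)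
  rw [hSb, image_subset_iff]
  exact hk

/-- Analytic sets are universally measurable. -/
theorem nullMeasurableSet_of_analyticSet {X : Type*} [TopologicalSpace X] [PolishSpace X]
    [MeasurableSpace X] [BorelSpace X] {μ : Measure X} [IsFiniteMeasure μ] {A : Set X}
    (hA : AnalyticSet A) : NullMeasurableSet A μ := by
  rw [AnalyticSet] at hA
  obtain rfl | ⟨f, hf, rfl⟩ := hA
  · exact MeasurableSet.empty.nullMeasurableSet
  by_cases h0 : μ (range f) = 0
  · exact NullMeasurableSet.of_null h0
  let _ := TopologicalSpace.upgradeIsCompletelyMetrizable X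
  obtain ⟨r, -, hr, hrlim⟩ := exists_seq_strictMono_tendsto' (pos_iff_ne_zero.2 h0)
  choose K hKs hKc hK using fun n =>
    exists_isCompact_subset_of_lt_measure_range (μ := μ) hf (hr n).2
  have hBm : MeasurableSet (⋃ n, K n) := MeasurableSet.iUnion fun n => (hKc n).measurableSet
  have hle : μ (range f) ≤ μ (⋃ n, K n) :=
    le_of_tendsto' hrlim fun n => (hK n).trans (measure_mono (subset_iUnion _ _))
  have := ae_eq_of_ae_subset_of_measure_ge (iUnion_subset hKs).eventuallyLE hle
    hBm.nullMeasurableSet (measure_ne_top μ _)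
  exact hBm.nullMeasurableSet.congr this

/-- A measure-preserving map which is injective almost everywhere is bijective on a conull set. -/
theorem exists_bijOn_of_injOn {Ω : Type*} [MeasurableSpace Ω] [StandardBorelSpace Ω]
    {ν : Measure Ω} [IsFiniteMeasure ν] {F : Ω → Ω} (hF : MeasurePreserving F ν ν)
    {Y : Set Ω} (hY : MeasurableSet Y) (hY0 : ν Yᶜ = 0) (hinj : InjOn F Y) :
    ∃ Ys ⊆ Y, MeasurableSet Ys ∧ ν Ysᶜ = 0 ∧ BijOn F Ys Ys := by
  -- These are the points whose whole forward orbit stays in `Y`. Every iterate is injective on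
  -- `Y2`, so its images are Borel, and the set sought is their intersection.
  set Y2 : Set Ω := ⋂ k : ℕ, F^[k] ⁻¹' Y with hY2
  have hY2m : MeasurableSet Y2 := MeasurableSet.iInter fun k => (hF.measurable.iterate k) hY
  have hY2s : Y2 ⊆ Y := iInter_subset (fun k : ℕ => F^[k] ⁻¹' Y) 0
  have hY20 : ν Y2ᶜ = 0 := by
    rw [hY2, compl_iInter, measure_iUnion_null_iff]
    intro k
    rw [← preimage_compl, (hF.iterate k).measure_preimage hY.compl.nullMeasurableSet, hY0]
  have hmaps : MapsTo F Y2 Y2 := by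
    intro z hz
    rw [hY2, mem_iInter] at hz ⊢
    exact fun k => hz (k + 1)
  have hmapsk : ∀ k, MapsTo F^[k] Y2 Y2 := fun k => hmaps.iterate k
  have hinjk : ∀ k, InjOn F^[k] Y2 := by
    intro k
    exact (hinj.mono hY2s).iterate hmaps k
  have him : ∀ k, MeasurableSet (F^[k] '' Y2) := fun k =>
    hY2m.image_of_measurable_injOn (hF.measurable.iterate k) (hinjk k)
  have hanti : ∀ k, F^[k + 1] '' Y2 ⊆ F^[k] '' Y2 := by
    rintro k _ ⟨z, hz, rfl⟩
    exact ⟨F z, hmaps hz, rfl⟩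
  refine ⟨⋂ k, F^[k] '' Y2, ?_, MeasurableSet.iInter him, ?_, ?_, ?_, ?_⟩
  · refine (iInter_subset _ 0).trans ?_
    simpa using hY2s
  · rw [compl_iInter, measure_iUnion_null_iff]
    intro k
    rw [← (hF.iterate k).measure_preimage (him k).compl.nullMeasurableSet]
    refine measure_mono_null ?_ hY20
    intro z hz hz2
    exact hz ⟨z, hz2, rfl⟩
  · intro z hz
    rw [mem_iInter] at hz ⊢
    intro k
    cases k with
    | zero =>
      obtain ⟨w, hw, rfl⟩ := hz 0
      exact ⟨F w, hmaps hw, rfl⟩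
    | succ k =>
      obtain ⟨w, hw, rfl⟩ := hz k
      exact ⟨w, hw, by rw [Function.iterate_succ_apply']⟩
  · refine (hinj.mono hY2s).mono ((iInter_subset _ 0).trans ?_)
    simp
  · intro z hz
    rw [mem_iInter] at hz
    obtain ⟨w, hw, rfl⟩ := hz 1
    refine ⟨w, ?_, rfl⟩
    rw [mem_iInter]
    intro k
    obtain ⟨w', hw', h⟩ := hz (k + 1)
    rw [Function.iterate_succ_apply'] at h
    -- By injectivity the preimages of the point found at different depths coincide, so the single
    -- point `w` lies in every image.
    have : F^[k] w' = w := hinj.mono hY2s (hmapsk k hw') hw h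
    exact ⟨w', hw', this⟩

/-- A set that is approximated in measure by members of a `σ`-algebra is a member modulo null
sets. -/
theorem eventuallyMeasurableSet_of_approx {Ω : Type*} [MeasurableSpace Ω] {ν : Measure Ω}
    {𝒢 : MeasurableSpace Ω} {E : Set Ω}
    (h : ∀ ε : ℝ≥0∞, 0 < ε → ∃ C, EventuallyMeasurableSet 𝒢 (ae ν) C ∧ ν (E ∆ C) ≤ ε) :
    EventuallyMeasurableSet 𝒢 (ae ν) E := by
  obtain ⟨ε, hε, hsum⟩ := ENNReal.exists_pos_sum_of_countable' (one_ne_zero) ℕ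
  choose C hC hEC using fun n => h (ε n) (hε n)
  -- Borel–Cantelli: the errors are summable, so almost every point lies in only finitely many `E ∆
  -- C n`, and `E` equals `limsup C n` modulo a null set.
  have hBC : ν (limsup (fun n => E ∆ C n) atTop) = 0 := by
    refine measure_limsup_atTop_eq_zero (ne_top_of_le_ne_top ENNReal.one_ne_top ?_)
    exact (ENNReal.tsum_le_tsum hEC).trans hsum.le
  have hlim : @MeasurableSet Ω (eventuallyMeasurableSpace 𝒢 (ae ν)) (limsup C atTop) :=
    @MeasurableSet.measurableSet_limsup Ω (eventuallyMeasurableSpace 𝒢 (ae ν)) C hC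
  obtain ⟨t, ht, hts⟩ := hlim
  refine ⟨t, ht, EventuallyEq.trans ?_ hts⟩
  have hae : ∀ᵐ z ∂ν, z ∉ limsup (fun n => E ∆ C n) atTop := measure_eq_zero_iff_ae_notMem.1 hBC
  filter_upwards [hae] with z hz
  rw [Filter.mem_limsup_iff_frequently_mem, not_frequently] at hz
  apply propext
  change z ∈ E ↔ z ∈ limsup C atTop
  rw [Filter.mem_limsup_iff_frequently_mem]
  have hz' : ∀ᶠ n in atTop, (z ∈ E ↔ z ∈ C n) := by
    filter_upwards [hz] with n hn
    rw [Set.mem_symmDiff] at hn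
    tauto
  rw [← frequently_congr hz']
  simp

/-- An atomless measure which only takes the values `0` and `μ univ` vanishes. -/
theorem eq_zero_of_forall_measure_zero_or_compl {X : Type*} [MeasurableSpace X]
    [StandardBorelSpace X] {μ : Measure X} (hna : ∀ x, μ {x} = 0)
    (h : ∀ A, MeasurableSet A → μ A = 0 ∨ μ Aᶜ = 0) : μ = 0 := by
  by_contra hμ
  have : (ae μ).NeBot := ae_neBot.2 hμ
  have : Nonempty X := this.nonempty
  -- Every measurable set or its complement is conull, and countably many sets separate points. So
  -- some single point is conull.
  obtain ⟨a, ha⟩ := exists_singleton_mem_of_forall_separating (l := ae μ) MeasurableSet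
    (fun U hU => (h U hU).symm.imp
      (fun h0 => mem_ae_iff.2 h0) (fun h0 => mem_ae_iff.2 (by rwa [compl_compl])))
  have h1 : μ univ = 0 := by
    rw [← union_compl_self {a}]
    exact measure_union_null (hna a) ha
  exact hμ (Measure.measure_univ_eq_zero.1 h1)

end Prelim

/-! ### Borel models of the tower -/

section Clean

open scoped ENNReal symmDiff

/-- The first `k + 1` letters of the itinerary of a point. -/
def itinerary {X : Type*} {N : ℕ} (T : X → X) (J : X → Fin N) (k : ℕ) (x : X) :
    Fin (k + 1) → Fin N :=
  fun i => J (T^[i] x)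

/-- A Borel model of the system: `T` is a Borel map which, on the invariant conull set `G`, is
injective with Jacobian `s i` on each of the sets `{J = i}`. The level `D u` lies over
`{J = j u}`, and `nxt u i` is the level `{J = i} ∩ T (D u)`. -/
structure IsCleanTower {X : Type*} [MeasurableSpace X] {N : ℕ} (μ : Measure X)
    (T : X → X) (G : Set X) (J : X → Fin N) (s : Fin N → ℝ) (α : Set ℕ) (D : ℕ → Set X)
    (j : ℕ → Fin N) (nxt : ℕ → Fin N → ℕ) : Prop where
  quasi : Measure.QuasiMeasurePreserving T μ μ
  meas_good : MeasurableSet G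
  good_full : μ Gᶜ = 0
  good_maps : MapsTo T G G
  meas_letter : Measurable J
  inj : ∀ i, InjOn T (G ∩ J ⁻¹' {i})
  one_le : ∀ i, 1 ≤ s i
  scale : ∀ i A, MeasurableSet A → A ⊆ G ∩ J ⁻¹' {i} → μ (T '' A) = ENNReal.ofReal (s i) * μ A
  meas_level : ∀ u ∈ α, MeasurableSet (D u)
  level_pos : ∀ u ∈ α, μ (D u) ≠ 0
  letter : ∀ u ∈ α, ∀ x ∈ D u, x ∈ G → J x = j u
  next : ∀ u ∈ α, ∀ i, μ (D u ∩ T ⁻¹' (J ⁻¹' {i})) ≠ 0 →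
    nxt u i ∈ α ∧ D (nxt u i) =ᵐ[μ] (J ⁻¹' {i} ∩ T '' (G ∩ D u) : Set X)
  distinct : ∀ u ∈ α, ∀ v ∈ α, D u =ᵐ[μ] D v → u = v
  generating : ∀ A, MeasurableSet A → ∀ ε : ℝ≥0∞, 0 < ε →
    ∃ k Q, μ (A ∆ (itinerary T J k ⁻¹' Q)) ≤ ε

/-- The Borel version of the tower map. -/
def stepMap {X : Type*} {N : ℕ} (T : X → X) (J : X → Fin N) (nxt : ℕ → Fin N → ℕ)
    (p : ℕ × X) : ℕ × X :=
  (nxt p.1 (J (T p.2)), T p.2)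

/-- There is an arrow from the level `t` to the level `v`. -/
def Step {X : Type*} [MeasurableSpace X] {N : ℕ} (μ : Measure X) (T : X → X) (J : X → Fin N)
    (α : Set ℕ) (D : ℕ → Set X) (nxt : ℕ → Fin N → ℕ) (t v : ℕ) : Prop :=
  t ∈ α ∧ ∃ i, μ (D t ∩ T ⁻¹' (J ⁻¹' {i})) ≠ 0 ∧ nxt t i = v

/-- The measure on the tower with density `r u` on the level `D u`. -/
def levelMeasure {X : Type*} [MeasurableSpace X] (μ : Measure X) (D : ℕ → Set X)
    (r : ℕ → ℝ≥0∞) : Measure (ℕ × X) :=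
  Measure.sum fun u : ℕ => r u • (μ.restrict (D u)).map fun x => (u, x)

theorem lintegral_levelMeasure {X : Type*} [MeasurableSpace X] {μ : Measure X} {D : ℕ → Set X}
    {r : ℕ → ℝ≥0∞} {f : ℕ × X → ℝ≥0∞} (hf : Measurable f) :
    ∫⁻ p, f p ∂levelMeasure μ D r = ∑' u, r u * ∫⁻ x in D u, f (u, x) ∂μ := by
  rw [levelMeasure, lintegral_sum_measure]
  refine tsum_congr fun u => ?_
  rw [lintegral_smul_measure, lintegral_map hf measurable_prodMk_left, smul_eq_mul]

theorem levelMeasure_apply {X : Type*} [MeasurableSpace X] {μ : Measure X} {D : ℕ → Set X}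
    {r : ℕ → ℝ≥0∞} {A : Set (ℕ × X)} (hA : MeasurableSet A) :
    levelMeasure μ D r A = ∑' u, r u * μ (Prod.mk u ⁻¹' A ∩ D u) := by
  rw [levelMeasure, Measure.sum_apply _ hA]
  refine tsum_congr fun u => ?_
  rw [Measure.smul_apply, Measure.map_apply measurable_prodMk_left hA,
    Measure.restrict_apply (measurable_prodMk_left hA), smul_eq_mul]

theorem levelMeasure_level {X : Type*} [MeasurableSpace X] {μ : Measure X} {D : ℕ → Set X}
    {r : ℕ → ℝ≥0∞} {A : Set X} (hA : MeasurableSet A) (u : ℕ) :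
    levelMeasure μ D r ({u} ×ˢ A) = r u * μ (A ∩ D u) := by
  rw [levelMeasure_apply ((measurableSet_singleton u).prod hA), tsum_eq_single u]
  · congr 3
    ext x
    simp
  · intro v hv
    have : Prod.mk v ⁻¹' ({u} ×ˢ A) = (∅ : Set X) := by
      ext x
      simp [hv]
    simp [this]

open Classical in
/-- The action of the tower map on densities which are constant on levels. -/
def transfer {X : Type*} [MeasurableSpace X] {N : ℕ} (μ : Measure X) (T : X → X) (J : X → Fin N)
    (s : Fin N → ℝ) (α : Set ℕ) (D : ℕ → Set X) (j : ℕ → Fin N) (nxt : ℕ → Fin N → ℕ)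
    (r : ℕ → ℝ≥0∞) (v : ℕ) : ℝ≥0∞ :=
  ∑' t, if Step μ T J α D nxt t v then r t * (ENNReal.ofReal (s (j t)))⁻¹ else 0

namespace IsCleanTower

variable {X : Type*} [MeasurableSpace X] {N : ℕ} {μ : Measure X}
  {T : X → X} {G : Set X} {J : X → Fin N} {s : Fin N → ℝ} {α : Set ℕ} {D : ℕ → Set X}
  {j : ℕ → Fin N} {nxt : ℕ → Fin N → ℕ}

theorem measurable (h : IsCleanTower μ T G J s α D j nxt) : Measurable T := h.quasi.measurable

theorem measurable_stepMap (h : IsCleanTower μ T G J s α D j nxt) :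
    Measurable (stepMap T J nxt) := by
  have h1 : Measurable fun p : ℕ × X => (p.1, J (T p.2)) :=
    measurable_fst.prodMk (h.meas_letter.comp (h.measurable.comp measurable_snd))
  exact ((measurable_of_countable fun q : ℕ × Fin N => nxt q.1 q.2).comp h1).prodMk
    (h.measurable.comp measurable_snd)

theorem measurable_itinerary (h : IsCleanTower μ T G J s α D j nxt) (k : ℕ) :
    Measurable (itinerary T J k) :=
  measurable_pi_lambda _ fun i => h.meas_letter.comp (h.measurable.iterate i)

theorem measurableSet_itinerary (h : IsCleanTower μ T G J s α D j nxt) (k : ℕ)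
    (Q : Set (Fin (k + 1) → Fin N)) : MeasurableSet (itinerary T J k ⁻¹' Q) :=
  h.measurable_itinerary k Q.toFinite.measurableSet

theorem slope_ne_zero (h : IsCleanTower μ T G J s α D j nxt) (i : Fin N) :
    ENNReal.ofReal (s i) ≠ 0 := by
  have := h.one_le i
  simp only [ne_eq, ENNReal.ofReal_eq_zero, not_le]
  linarith

theorem ae_good (h : IsCleanTower μ T G J s α D j nxt) : ∀ᵐ x ∂μ, x ∈ G :=
  mem_ae_iff.2 h.good_full

theorem image_null (h : IsCleanTower μ T G J s α D j nxt) {i : Fin N} {A : Set X}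
    (hA : A ⊆ G ∩ J ⁻¹' {i}) (h0 : μ A = 0) : μ (T '' A) = 0 := by
  have hm : MeasurableSet (toMeasurable μ A ∩ (G ∩ J ⁻¹' {i})) :=
    (measurableSet_toMeasurable _ _).inter
      (h.meas_good.inter (h.meas_letter (measurableSet_singleton i)))
  refine measure_mono_null (image_mono (subset_inter (subset_toMeasurable μ A) hA)) ?_
  rw [h.scale i _ hm inter_subset_right]
  rw [measure_mono_null inter_subset_left (by rwa [measure_toMeasurable]), mul_zero]

theorem good_inter_level_subset (h : IsCleanTower μ T G J s α D j nxt) {u : ℕ} (hu : u ∈ α) :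
    G ∩ D u ⊆ G ∩ J ⁻¹' {j u} := fun x hx => ⟨hx.1, h.letter u hu x hx.2 hx.1⟩

theorem good_inter_level_ae (h : IsCleanTower μ T G J s α D j nxt) (A : Set X) :
    (G ∩ A : Set X) =ᵐ[μ] A := by
  filter_upwards [h.ae_good] with x hx
  apply propext
  exact ⟨fun hx' => hx'.2, fun hx' => ⟨hx, hx'⟩⟩

/-- Change of variables on one branch: the Jacobian is the constant `s (j u)` and the branch covers
the next level, so the image measure is a multiple of `μ` there. This is why constant densities stay
constant. -/
theorem map_restrict_branch (h : IsCleanTower μ T G J s α D j nxt) {u : ℕ} (hu : u ∈ α)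
    {i : Fin N} (hi : μ (D u ∩ T ⁻¹' (J ⁻¹' {i})) ≠ 0) :
    (μ.restrict (D u ∩ T ⁻¹' (J ⁻¹' {i}))).map T =
      (ENNReal.ofReal (s (j u)))⁻¹ • μ.restrict (D (nxt u i)) := by
  have hJi : MeasurableSet (J ⁻¹' {i}) := h.meas_letter (measurableSet_singleton i)
  ext A hA
  rw [Measure.map_apply h.measurable hA, Measure.restrict_apply (h.measurable hA),
    Measure.smul_apply, Measure.restrict_apply hA, smul_eq_mul]
  have hBm : MeasurableSet (G ∩ (T ⁻¹' A ∩ (D u ∩ T ⁻¹' (J ⁻¹' {i})))) :=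
    h.meas_good.inter ((h.measurable hA).inter ((h.meas_level u hu).inter (h.measurable hJi)))
  have hBs : G ∩ (T ⁻¹' A ∩ (D u ∩ T ⁻¹' (J ⁻¹' {i}))) ⊆ G ∩ J ⁻¹' {j u} := fun x hx =>
    h.good_inter_level_subset hu ⟨hx.1, hx.2.2.1⟩
  have himg : T '' (G ∩ (T ⁻¹' A ∩ (D u ∩ T ⁻¹' (J ⁻¹' {i})))) =
      A ∩ (J ⁻¹' {i} ∩ T '' (G ∩ D u)) := by
    ext y
    constructor
    · rintro ⟨x, ⟨hxG, hxA, hxD, hxi⟩, rfl⟩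
      exact ⟨hxA, hxi, x, ⟨hxG, hxD⟩, rfl⟩
    · rintro ⟨hyA, hyi, x, ⟨hxG, hxD⟩, rfl⟩
      exact ⟨x, ⟨hxG, hyA, hxD, hyi⟩, rfl⟩
  have hsc := h.scale _ _ hBm hBs
  rw [himg, measure_congr (h.good_inter_level_ae _)] at hsc
  rw [measure_congr (EventuallyEq.rfl.inter (h.next u hu i hi).2 :
    (A ∩ D (nxt u i) : Set X) =ᵐ[μ] (A ∩ (J ⁻¹' {i} ∩ T '' (G ∩ D u)) : Set X)), hsc, ← mul_assoc,
    ENNReal.inv_mul_cancel (h.slope_ne_zero _) ENNReal.ofReal_ne_top, one_mul]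

/-- Levels reached through different letters are disjoint modulo `μ`, while every level has positive
measure. -/
theorem nxt_injective (h : IsCleanTower μ T G J s α D j nxt) {u : ℕ} (hu : u ∈ α) {i i' : Fin N}
    (hi : μ (D u ∩ T ⁻¹' (J ⁻¹' {i})) ≠ 0) (hi' : μ (D u ∩ T ⁻¹' (J ⁻¹' {i'})) ≠ 0)
    (he : nxt u i = nxt u i') : i = i' := by
  by_contra hne
  have h1 := (h.next u hu i hi).2
  have h2 := (h.next u hu i' hi').2
  rw [← he] at h2
  apply h.level_pos _ (h.next u hu i hi).1
  have : (D (nxt u i) : Set X) =ᵐ[μ] (∅ : Set X) := by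
    filter_upwards [h1, h2] with x hx1 hx2
    apply propext
    constructor
    · intro hx
      have e1 : x ∈ J ⁻¹' {i} ∩ T '' (G ∩ D u) := (Eq.to_iff hx1).1 hx
      have e2 : x ∈ J ⁻¹' {i'} ∩ T '' (G ∩ D u) := (Eq.to_iff hx2).1 hx
      exact hne (e1.1.symm.trans e2.1)
    · exact fun hx => hx.elim
  rw [measure_congr this, measure_empty]

-- By `nxt_injective`, branches of positive measure correspond one to one to outgoing arrows. A sum
-- over letters thus becomes a sum over target levels.
open Classical in
theorem sum_branch (h : IsCleanTower μ T G J s α D j nxt) {u : ℕ} (hu : u ∈ α)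
    (g : ℕ → ℝ≥0∞) :
    ∑ i, (if μ (D u ∩ T ⁻¹' (J ⁻¹' {i})) ≠ 0 then g (nxt u i) else 0) =
      ∑' v, if Step μ T J α D nxt u v then g v else 0 := by
  have h1 : ∀ i, (if μ (D u ∩ T ⁻¹' (J ⁻¹' {i})) ≠ 0 then g (nxt u i) else 0) =
      ∑' v, if v = nxt u i then
        (if μ (D u ∩ T ⁻¹' (J ⁻¹' {i})) ≠ 0 then g v else 0) else 0 := by
    intro i
    rw [tsum_ite_eq]
  simp_rw [h1]
  rw [← Summable.tsum_finsetSum fun i _ => ENNReal.summable]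
  refine tsum_congr fun v => ?_
  by_cases hv : Step μ T J α D nxt u v
  · rw [if_pos hv]
    obtain ⟨-, i, hi, rfl⟩ := hv
    rw [Finset.sum_eq_single i, if_pos rfl, if_pos hi]
    · intro i' _ hne
      split_ifs with e1 e2
      · exact absurd (h.nxt_injective hu hi e2 e1).symm hne
      · rfl
      · rfl
    · simp
  · rw [if_neg hv]
    refine Finset.sum_eq_zero fun i _ => ?_
    split_ifs with e1 e2
    · exact absurd ⟨hu, i, e2, e1.symm⟩ hv
    · rfl
    · rfl

open Classical in
theorem setLIntegral_stepMap (h : IsCleanTower μ T G J s α D j nxt) {u : ℕ} (hu : u ∈ α)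
    {f : ℕ × X → ℝ≥0∞} (hf : Measurable f) :
    ∫⁻ x in D u, f (stepMap T J nxt (u, x)) ∂μ =
      ∑' v, if Step μ T J α D nxt u v then
        (ENNReal.ofReal (s (j u)))⁻¹ * ∫⁻ x in D v, f (v, x) ∂μ else 0 := by
  have hJi : ∀ i, MeasurableSet (J ⁻¹' {i}) := fun i =>
    h.meas_letter (measurableSet_singleton i)
  have hD : D u = ⋃ i, D u ∩ T ⁻¹' (J ⁻¹' {i}) := by
    ext x
    simp
  rw [← h.sum_branch hu fun v => (ENNReal.ofReal (s (j u)))⁻¹ * ∫⁻ x in D v, f (v, x) ∂μ]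
  conv_lhs => rw [hD]
  rw [lintegral_iUnion (fun i => (h.meas_level u hu).inter (h.measurable (hJi i))), tsum_fintype]
  · refine Finset.sum_congr rfl fun i _ => ?_
    split_ifs with hi
    · rw [← smul_eq_mul, ← lintegral_smul_measure, ← h.map_restrict_branch hu hi,
        lintegral_map (f := fun x => f (nxt u i, x)) (hf.comp measurable_prodMk_left) h.measurable]
      refine setLIntegral_congr_fun ((h.meas_level u hu).inter (h.measurable (hJi i))) ?_
      rintro x ⟨-, hx⟩
      have hx' : J (T x) = i := hx
      simp only [stepMap, hx']
    · rw [not_not] at hi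
      rw [Measure.restrict_eq_zero.2 hi, lintegral_zero_measure]
  · intro i i' hne
    refine Set.disjoint_left.2 ?_
    rintro x ⟨-, hx⟩ ⟨-, hx'⟩
    exact hne (hx.symm.trans hx')

/-- Summing the branches reduces the dynamics of these measures to the matrix `transfer` on
sequences of densities. -/
theorem map_levelMeasure (h : IsCleanTower μ T G J s α D j nxt) {r : ℕ → ℝ≥0∞}
    (hr : ∀ u, u ∉ α → r u = 0) :
    (levelMeasure μ D r).map (stepMap T J nxt) =
      levelMeasure μ D (transfer μ T J s α D j nxt r) := by
  classical
  refine Measure.ext_of_lintegral _ fun f hf => ?_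
  rw [lintegral_map hf h.measurable_stepMap, lintegral_levelMeasure hf,
    lintegral_levelMeasure (f := fun p => f (stepMap T J nxt p)) (hf.comp h.measurable_stepMap)]
  have h1 : ∀ u, r u * ∫⁻ x in D u, f (stepMap T J nxt (u, x)) ∂μ =
      ∑' v, (if Step μ T J α D nxt u v then r u * (ENNReal.ofReal (s (j u)))⁻¹ else 0) *
        ∫⁻ x in D v, f (v, x) ∂μ := by
    intro u
    by_cases hu : u ∈ α
    · rw [h.setLIntegral_stepMap hu hf, ← ENNReal.tsum_mul_left]
      refine tsum_congr fun v => ?_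
      split_ifs <;> simp [mul_assoc]
    · simp [hr u hu]
  rw [tsum_congr h1, ENNReal.tsum_comm]
  refine tsum_congr fun v => ?_
  rw [ENNReal.tsum_mul_right, transfer]

theorem transfer_eq_zero (h : IsCleanTower μ T G J s α D j nxt) {r : ℕ → ℝ≥0∞} {v : ℕ}
    (hv : v ∉ α) : transfer μ T J s α D j nxt r v = 0 := by
  classical
  rw [transfer, ENNReal.tsum_eq_zero]
  intro t
  rw [if_neg]
  rintro ⟨ht, i, hi, rfl⟩
  exact hv (h.next t ht i hi).1

theorem iterate_transfer_eq_zero (h : IsCleanTower μ T G J s α D j nxt) {r : ℕ → ℝ≥0∞}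
    (hr : ∀ u, u ∉ α → r u = 0) (k : ℕ) {v : ℕ} (hv : v ∉ α) :
    (transfer μ T J s α D j nxt)^[k] r v = 0 := by
  cases k with
  | zero => exact hr v hv
  | succ k => rw [Function.iterate_succ_apply', h.transfer_eq_zero hv]

theorem map_iterate_levelMeasure (h : IsCleanTower μ T G J s α D j nxt) {r : ℕ → ℝ≥0∞}
    (hr : ∀ u, u ∉ α → r u = 0) (k : ℕ) :
    (levelMeasure μ D r).map (stepMap T J nxt)^[k] =
      levelMeasure μ D ((transfer μ T J s α D j nxt)^[k] r) := by
  induction k with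
  | zero => simp
  | succ k ih =>
    rw [Function.iterate_succ', ← Measure.map_map h.measurable_stepMap
      (h.measurable_stepMap.iterate k), ih, h.map_levelMeasure
      (fun u hu => h.iterate_transfer_eq_zero hr k hu), Function.iterate_succ_apply']

end IsCleanTower

end Clean

/-! ### Invariant measures of the tower map -/

section TowerInvariant

open scoped ENNReal symmDiff

theorem measurableSet_of_forall_level {X : Type*} [MeasurableSpace X] {A : Set (ℕ × X)}
    (hA : ∀ u, MeasurableSet (Prod.mk u ⁻¹' A)) : MeasurableSet A := by
  have : A = ⋃ u : ℕ, {u} ×ˢ (Prod.mk u ⁻¹' A) := by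
    ext ⟨u, x⟩
    simp
  rw [this]
  exact MeasurableSet.iUnion fun u => (measurableSet_singleton u).prod (hA u)

theorem measure_eq_zero_of_forall_level {X : Type*} [MeasurableSpace X] {κ : Measure (ℕ × X)}
    {A : Set (ℕ × X)} (hA : ∀ u, κ ({u} ×ˢ (Prod.mk u ⁻¹' A)) = 0) : κ A = 0 := by
  have : A = ⋃ u : ℕ, {u} ×ˢ (Prod.mk u ⁻¹' A) := by
    ext ⟨u, x⟩
    simp
  rw [this, measure_iUnion_null_iff]
  exact hA

theorem measure_ext_of_forall_level {X : Type*} [MeasurableSpace X] {κ κ' : Measure (ℕ × X)}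
    (h : ∀ u A, MeasurableSet A → κ ({u} ×ˢ A) = κ' ({u} ×ˢ A)) : κ = κ' := by
  ext A hA
  have : A = ⋃ u : ℕ, {u} ×ˢ (Prod.mk u ⁻¹' A) := by
    ext ⟨u, x⟩
    simp
  have hd : Pairwise (Function.onFun Disjoint fun u : ℕ => {u} ×ˢ (Prod.mk u ⁻¹' A)) := by
    intro u v huv
    refine Set.disjoint_left.2 ?_
    rintro ⟨w, x⟩ ⟨hw, -⟩ ⟨hw', -⟩
    exact huv (hw.symm.trans hw')
  have hm : ∀ u : ℕ, MeasurableSet ({u} ×ˢ (Prod.mk u ⁻¹' A)) := fun u =>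
    (measurableSet_singleton u).prod (measurable_prodMk_left hA)
  rw [this, measure_iUnion hd hm, measure_iUnion hd hm]
  exact tsum_congr fun u => h u _ (measurable_prodMk_left hA)

/-- The disjoint union of the levels. -/
def levels {X : Type*} (α : Set ℕ) (D : ℕ → Set X) : Set (ℕ × X) :=
  {p | p.1 ∈ α ∧ p.2 ∈ D p.1}

/-- An invariant measure of the tower map which has a bounded density on every level. -/
structure IsTowerInvariant {X : Type*} [MeasurableSpace X] {N : ℕ} (μ : Measure X)
    (T : X → X) (J : X → Fin N) (α : Set ℕ) (D : ℕ → Set X)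
    (nxt : ℕ → Fin N → ℕ) (κ : Measure (ℕ × X)) : Prop where
  preserving : MeasurePreserving (stepMap T J nxt) κ κ
  dominated : ∀ u, ∃ C : ℝ≥0∞, C ≠ ∞ ∧ ∀ A, κ ({u} ×ˢ A) ≤ C * μ A
  carried : κ (levels α D)ᶜ = 0

/-- The points of the tower at which the tower map follows an arrow. -/
def goodTower {X : Type*} [MeasurableSpace X] {N : ℕ} (μ : Measure X) (T : X → X) (G : Set X)
    (J : X → Fin N) (α : Set ℕ) (D : ℕ → Set X) : Set (ℕ × X) :=
  {p | p.1 ∈ α ∧ p.2 ∈ G ∧ p.2 ∈ D p.1 ∧ μ (D p.1 ∩ T ⁻¹' (J ⁻¹' {J (T p.2)})) ≠ 0}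

theorem iterate_stepMap_snd {X : Type*} {N : ℕ} (T : X → X) (J : X → Fin N)
    (nxt : ℕ → Fin N → ℕ) (k : ℕ) (p : ℕ × X) :
    ((stepMap T J nxt)^[k] p).2 = T^[k] p.2 := by
  induction k with
  | zero => rfl
  | succ k ih => rw [Function.iterate_succ_apply', Function.iterate_succ_apply', ← ih]; rfl

/-- The points with the same itinerary as `x` up to time `k`. -/
def itineraryCell {X : Type*} {N : ℕ} (T : X → X) (J : X → Fin N) (k : ℕ)
    (x : X) : Set X :=
  itinerary T J k ⁻¹' {itinerary T J k x}

theorem mem_itineraryCell {X : Type*} {N : ℕ} {T : X → X} {J : X → Fin N} {k : ℕ} {x y : X} :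
    y ∈ itineraryCell T J k x ↔ ∀ i ≤ k, J (T^[i] y) = J (T^[i] x) := by
  simp only [itineraryCell, mem_preimage, mem_singleton_iff, funext_iff, itinerary, Fin.forall_iff,
    Nat.lt_succ_iff]

theorem itineraryCell_succ {X : Type*} {N : ℕ} {T : X → X} {J : X → Fin N} {k : ℕ} {x : X} :
    itineraryCell T J (k + 1) x =
      itineraryCell T J k x ∩ T^[k + 1] ⁻¹' (J ⁻¹' {J (T^[k + 1] x)}) := by
  ext y
  rw [mem_inter_iff, mem_itineraryCell, mem_itineraryCell]
  constructor
  · exact fun hy => ⟨fun i hi => hy i (by omega), hy _ le_rfl⟩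
  · rintro ⟨h1, h2⟩ i hi
    rcases Nat.lt_or_eq_of_le hi with hi | rfl
    · exact h1 i (by omega)
    · exact h2

namespace IsCleanTower

variable {X : Type*} [MeasurableSpace X] {N : ℕ} {μ : Measure X}
  {T : X → X} {G : Set X} {J : X → Fin N} {s : Fin N → ℝ} {α : Set ℕ} {D : ℕ → Set X}
  {j : ℕ → Fin N} {nxt : ℕ → Fin N → ℕ}

theorem measurableSet_goodTower (h : IsCleanTower μ T G J s α D j nxt) :
    MeasurableSet (goodTower μ T G J α D) := by
  refine measurableSet_of_forall_level fun u => ?_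
  by_cases hu : u ∈ α
  · have : Prod.mk u ⁻¹' goodTower μ T G J α D = G ∩ (D u ∩
        (fun x => J (T x)) ⁻¹' {i | μ (D u ∩ T ⁻¹' (J ⁻¹' {i})) ≠ 0}) := by
      ext x
      simp only [goodTower, mem_preimage, mem_ofPred_eq, hu, true_and, mem_inter_iff]
    rw [this]
    exact h.meas_good.inter ((h.meas_level u hu).inter
      ((h.meas_letter.comp h.measurable) (Set.toFinite _).measurableSet))
  · have : Prod.mk u ⁻¹' goodTower μ T G J α D = ∅ := by
      ext x
      simp [goodTower, hu]
    rw [this]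
    exact MeasurableSet.empty

theorem measure_level_diff_goodTower (h : IsCleanTower μ T G J s α D j nxt) {u : ℕ} (hu : u ∈ α) :
    μ (D u \ (Prod.mk u ⁻¹' goodTower μ T G J α D)) = 0 := by
  have h0 : μ (⋃ i : {i : Fin N // μ (D u ∩ T ⁻¹' (J ⁻¹' {i})) = 0},
      D u ∩ T ⁻¹' (J ⁻¹' {(i : Fin N)})) = 0 :=
    measure_iUnion_null fun i => i.2
  refine measure_mono_null ?_ (measure_union_null h.good_full h0)
  rintro x ⟨hxD, hx⟩
  by_cases hxG : x ∈ G
  · right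
    have : μ (D u ∩ T ⁻¹' (J ⁻¹' {J (T x)})) = 0 := by
      by_contra hne
      exact hx ⟨hu, hxG, hxD, hne⟩
    exact mem_iUnion.2 ⟨⟨_, this⟩, hxD, rfl⟩
  · exact Or.inl hxG

theorem measure_compl_goodTower (h : IsCleanTower μ T G J s α D j nxt) {κ : Measure (ℕ × X)}
    (hκ : IsTowerInvariant μ T J α D nxt κ) : κ (goodTower μ T G J α D)ᶜ = 0 := by
  have h1 : κ (levels α D \ goodTower μ T G J α D) = 0 := by
    refine measure_eq_zero_of_forall_level fun u => ?_
    by_cases hu : u ∈ α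
    · obtain ⟨C, -, hC⟩ := hκ.dominated u
      refine le_antisymm ((hC _).trans ?_) zero_le
      have : Prod.mk u ⁻¹' (levels α D \ goodTower μ T G J α D) =
          D u \ (Prod.mk u ⁻¹' goodTower μ T G J α D) := by
        ext x
        simp [levels, hu]
      rw [this, h.measure_level_diff_goodTower hu, mul_zero]
    · have : Prod.mk u ⁻¹' (levels α D \ goodTower μ T G J α D) = ∅ := by
        ext x
        simp [levels, hu]
      rw [this, prod_empty, measure_empty]
  refine measure_mono_null ?_ (measure_union_null hκ.carried h1)
  intro p hp
  by_cases hpt : p ∈ levels α D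
  · exact Or.inr ⟨hpt, hp⟩
  · exact Or.inl hpt

theorem ae_forall_iterate {Ω : Type*} [MeasurableSpace Ω] {κ : Measure Ω} {F : Ω → Ω}
    (hF : Measure.QuasiMeasurePreserving F κ κ) {P : Ω → Prop} (hP : ∀ᵐ p ∂κ, P p) :
    ∀ᵐ p ∂κ, ∀ k, P (F^[k] p) :=
  ae_all_iff.2 fun k => (hF.iterate k).ae hP

theorem ae_orbit_good (h : IsCleanTower μ T G J s α D j nxt) {κ : Measure (ℕ × X)}
    (hκ : IsTowerInvariant μ T J α D nxt κ) :
    ∀ᵐ p ∂κ, ∀ k, (stepMap T J nxt)^[k] p ∈ goodTower μ T G J α D :=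
  ae_forall_iterate hκ.preserving.quasiMeasurePreserving
    (mem_ae_iff.2 (h.measure_compl_goodTower hκ))

theorem injOn_iterate (h : IsCleanTower μ T G J s α D j nxt) (k : ℕ) (w : ℕ → Fin N) :
    InjOn T^[k] {x | x ∈ G ∧ ∀ i < k, J (T^[i] x) = w i} := by
  induction k with
  | zero => exact fun x _ y _ hxy => hxy
  | succ k ih =>
    rintro x ⟨hxG, hx⟩ y ⟨hyG, hy⟩ hxy
    rw [Function.iterate_succ_apply', Function.iterate_succ_apply'] at hxy
    exact ih ⟨hxG, fun i hi => hx i (hi.trans k.lt_succ_self)⟩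
      ⟨hyG, fun i hi => hy i (hi.trans k.lt_succ_self)⟩
      (h.inj (w k) ⟨h.good_maps.iterate k hxG, hx k k.lt_succ_self⟩
        ⟨h.good_maps.iterate k hyG, hy k k.lt_succ_self⟩ hxy)

theorem measurableSet_image_iterate [StandardBorelSpace X]
    (h : IsCleanTower μ T G J s α D j nxt) (k : ℕ) (w : ℕ → Fin N) {A : Set X}
    (hA : MeasurableSet A) (hAw : A ⊆ {x | x ∈ G ∧ ∀ i < k, J (T^[i] x) = w i}) :
    MeasurableSet (T^[k] '' A) :=
  hA.image_of_measurable_injOn (h.measurable.iterate k) ((h.injOn_iterate k w).mono hAw)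

/-- There is no distortion: on a set with common letters the Jacobian of `T^k` is one constant, so
`T^k` preserves relative measures. -/
theorem measure_image_iterate [StandardBorelSpace X]
    (h : IsCleanTower μ T G J s α D j nxt) (k : ℕ) (w : ℕ → Fin N) {A : Set X}
    (hA : MeasurableSet A) (hAw : A ⊆ {x | x ∈ G ∧ ∀ i < k, J (T^[i] x) = w i}) :
    μ (T^[k] '' A) = (∏ i ∈ Finset.range k, ENNReal.ofReal (s (w i))) * μ A := by
  induction k with
  | zero => simp
  | succ k ih =>
    have hAw' : A ⊆ {x | x ∈ G ∧ ∀ i < k, J (T^[i] x) = w i} := fun x hx =>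
      ⟨(hAw hx).1, fun i hi => (hAw hx).2 i (hi.trans k.lt_succ_self)⟩
    rw [Function.iterate_succ', image_comp,
      h.scale (w k) _ (h.measurableSet_image_iterate k w hA hAw'), ih hAw',
      Finset.prod_range_succ, ← mul_assoc, mul_comm (ENNReal.ofReal _)]
    rintro _ ⟨x, hx, rfl⟩
    exact ⟨h.good_maps.iterate k (hAw hx).1, (hAw hx).2 k k.lt_succ_self⟩

theorem image_ae_le (h : IsCleanTower μ T G J s α D j nxt) {i : Fin N} {A B : Set X}
    (hA : A ⊆ G ∩ J ⁻¹' {i}) (hAB : A ≤ᵐ[μ] B) : (T '' A : Set X) ≤ᵐ[μ] (T '' B : Set X) := by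
  rw [ae_le_set] at hAB ⊢
  refine measure_mono_null ?_ (h.image_null (sdiff_subset.trans hA) hAB)
  rintro _ ⟨⟨x, hx, rfl⟩, hy⟩
  exact ⟨x, ⟨hx, fun hxB => hy ⟨x, hxB, rfl⟩⟩, rfl⟩

theorem image_ae_eq (h : IsCleanTower μ T G J s α D j nxt) {i : Fin N} {A B : Set X}
    (hA : A ⊆ G ∩ J ⁻¹' {i}) (hB : B ⊆ G ∩ J ⁻¹' {i}) (hAB : A =ᵐ[μ] B) :
    (T '' A : Set X) =ᵐ[μ] (T '' B : Set X) :=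
  (h.image_ae_le hA hAB.le).antisymm (h.image_ae_le hB hAB.symm.le)

/-- The level reached after `k` steps is the `k`-th image of a piece of the first level. -/
theorem level_iterate_ae_eq (h : IsCleanTower μ T G J s α D j nxt) {p : ℕ × X}
    (hp : ∀ k, (stepMap T J nxt)^[k] p ∈ goodTower μ T G J α D) (k : ℕ) :
    D ((stepMap T J nxt)^[k] p).1 =ᵐ[μ]
      (T^[k] '' (G ∩ (D p.1 ∩ itineraryCell T J k p.2)) : Set X) := by
  induction k with
  | zero =>
    have h0 := hp 0
    -- A level lies over a single letter, so cutting it with the cell of order `0` removes no good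
    -- point.
    have : G ∩ (D p.1 ∩ itineraryCell T J 0 p.2) = G ∩ D p.1 := by
      ext y
      simp only [mem_inter_iff, mem_itineraryCell, Nat.le_zero, forall_eq, Function.iterate_zero,
        id_eq, and_congr_right_iff, and_iff_left_iff_imp]
      intro hyG hyD
      exact (h.letter _ h0.1 _ hyD hyG).trans (h.letter _ h0.1 _ h0.2.2.1 h0.2.1).symm
    rw [this]
    simpa using (h.good_inter_level_ae (D p.1)).symm
  | succ k ih =>
    have hk := hp k
    set q := (stepMap T J nxt)^[k] p with hq
    have hq2 : q.2 = T^[k] p.2 := iterate_stepMap_snd T J nxt k p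
    have hnext := (h.next _ hk.1 _ hk.2.2.2).2
    rw [Function.iterate_succ_apply', ← hq]
    change D (nxt q.1 (J (T q.2))) =ᵐ[μ] _
    refine hnext.trans ?_
    have hset : T^[k + 1] '' (G ∩ (D p.1 ∩ itineraryCell T J (k + 1) p.2)) =
        J ⁻¹' {J (T q.2)} ∩ T '' (T^[k] '' (G ∩ (D p.1 ∩ itineraryCell T J k p.2))) := by
      rw [hq2, ← Function.iterate_succ_apply' T k, itineraryCell_succ, ← image_comp,
        ← Function.iterate_succ' T k]
      ext y
      constructor
      · rintro ⟨x, ⟨hxG, hxD, hxc, hx⟩, rfl⟩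
        exact ⟨hx, x, ⟨hxG, hxD, hxc⟩, rfl⟩
      · rintro ⟨hy, x, ⟨hxG, hxD, hxc⟩, rfl⟩
        exact ⟨x, ⟨hxG, hxD, hxc, hy⟩, rfl⟩
    rw [hset]
    refine EventuallyEq.rfl.inter (h.image_ae_eq (h.good_inter_level_subset hk.1) ?_
      ((h.good_inter_level_ae _).trans ih))
    rintro _ ⟨x, ⟨hxG, hxD, hxc⟩, rfl⟩
    refine ⟨h.good_maps.iterate k hxG, ?_⟩
    have := mem_itineraryCell.1 hxc k le_rfl
    rw [mem_preimage, mem_singleton_iff, this, ← hq2]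
    exact h.letter _ hk.1 _ hk.2.2.1 hk.2.1

/-- The symmetric difference is contained, modulo `μ`, in the image of the part of the cell outside
the level. The constant Jacobian turns the proportion `δ` of the cell into `δ` times the measure of
the image of the cell, which is at most one. -/
theorem measure_symmDiff_level_le [StandardBorelSpace X] [IsProbabilityMeasure μ]
    (h : IsCleanTower μ T G J s α D j nxt) {p : ℕ × X}
    (hp : ∀ k, (stepMap T J nxt)^[k] p ∈ goodTower μ T G J α D) (k : ℕ) {δ : ℝ≥0∞}
    (hδ : μ (itineraryCell T J k p.2 \ D p.1) ≤ δ * μ (itineraryCell T J k p.2)) :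
    μ ((T^[k] '' (G ∩ itineraryCell T J k p.2)) ∆ D ((stepMap T J nxt)^[k] p).1) ≤ δ := by
  have hcell : ∀ B : Set X, G ∩ (B ∩ itineraryCell T J k p.2) ⊆
      {x | x ∈ G ∧ ∀ i < k, J (T^[i] x) = (fun i => J (T^[i] p.2)) i} := fun B x hx =>
    ⟨hx.1, fun i hi => mem_itineraryCell.1 hx.2.2 i hi.le⟩
  have hcm : MeasurableSet (itineraryCell T J k p.2) := h.measurableSet_itinerary k _
  have hDm : MeasurableSet (D p.1) := h.meas_level _ (hp 0).1
  have h1 : ((T^[k] '' (G ∩ itineraryCell T J k p.2)) ∆ D ((stepMap T J nxt)^[k] p).1 : Set X)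
      =ᵐ[μ] ((T^[k] '' (G ∩ itineraryCell T J k p.2)) ∆
        (T^[k] '' (G ∩ (D p.1 ∩ itineraryCell T J k p.2))) : Set X) :=
    EventuallyEq.rfl.symmDiff (h.level_iterate_ae_eq hp k)
  have h2 : (T^[k] '' (G ∩ itineraryCell T J k p.2)) ∆
        (T^[k] '' (G ∩ (D p.1 ∩ itineraryCell T J k p.2))) ⊆
      T^[k] '' (G ∩ ((D p.1)ᶜ ∩ itineraryCell T J k p.2)) := by
    rintro y (⟨⟨x, ⟨hxG, hxc⟩, rfl⟩, hy⟩ | ⟨⟨x, ⟨hxG, -, hxc⟩, rfl⟩, hy⟩)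
    · exact ⟨x, ⟨hxG, fun hxD => hy ⟨x, ⟨hxG, hxD, hxc⟩, rfl⟩, hxc⟩, rfl⟩
    · exact absurd ⟨x, ⟨hxG, hxc⟩, rfl⟩ hy
  rw [measure_congr h1]
  refine (measure_mono h2).trans ?_
  have hall : μ (T^[k] '' (G ∩ (univ ∩ itineraryCell T J k p.2))) ≤ 1 := prob_le_one
  rw [h.measure_image_iterate k _ (h.meas_good.inter (MeasurableSet.univ.inter hcm)) (hcell univ),
    univ_inter, measure_congr (h.good_inter_level_ae _)] at hall
  rw [h.measure_image_iterate k _ (h.meas_good.inter (hDm.compl.inter hcm)) (hcell _),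
    measure_congr (h.good_inter_level_ae _), inter_comm, ← sdiff_eq]
  calc _ ≤ (∏ i ∈ Finset.range k, ENNReal.ofReal (s (J (T^[i] p.2)))) *
        (δ * μ (itineraryCell T J k p.2)) := by gcongr
    _ = δ * ((∏ i ∈ Finset.range k, ENNReal.ofReal (s (J (T^[i] p.2)))) *
        μ (itineraryCell T J k p.2)) := by ring
    _ ≤ δ * 1 := by gcongr
    _ = δ := mul_one _

/-- A form of Lebesgue's density theorem for the cells of the itineraries. -/
theorem tendsto_measure_low_density (h : IsCleanTower μ T G J s α D j nxt) {B : Set X}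
    (hB : MeasurableSet B) {δ : ℝ≥0∞} (hδ : δ ≠ 0) (hδ' : δ ≠ ∞) :
    Tendsto (fun k => μ (B ∩ {x | δ * μ (itineraryCell T J k x) <
      μ (itineraryCell T J k x \ B)})) atTop (𝓝 0) := by
  classical
  rw [ENNReal.tendsto_nhds_zero]
  intro ε hε
  have hc0 : (1 + δ⁻¹) ≠ ∞ := by simp [hδ]
  -- `B` is approximated by a union `E` of cells of order `k₀`. A bad point of `B` lies in `B \ E`
  -- or in a bad cell inside `E`, and the latter cells have total measure at most `δ⁻¹ μ(E \ B)`.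
  -- This dictates the factor `(1 + δ⁻¹)⁻¹`.
  obtain ⟨k₀, Q, hQ⟩ := h.generating B hB (ε * (1 + δ⁻¹)⁻¹)
    (ENNReal.mul_pos hε.ne' (ENNReal.inv_ne_zero.2 hc0))
  filter_upwards [eventually_ge_atTop k₀] with k hk
  set E := itinerary T J k₀ ⁻¹' Q with hE
  set R : Finset (Fin (k + 1) → Fin N) := Finset.univ.filter fun c =>
    δ * μ (itinerary T J k ⁻¹' {c}) < μ (itinerary T J k ⁻¹' {c} \ B) ∧
      itinerary T J k ⁻¹' {c} ⊆ E with hR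
  have hsub : B ∩ {x | δ * μ (itineraryCell T J k x) < μ (itineraryCell T J k x \ B)} ⊆
      (B \ E) ∪ ⋃ c ∈ R, itinerary T J k ⁻¹' {c} := by
    rintro x ⟨hxB, hx⟩
    by_cases hxE : x ∈ E
    · right
      refine mem_biUnion (x := itinerary T J k x) ?_ rfl
      rw [hR, Finset.mem_coe, Finset.mem_filter]
      refine ⟨Finset.mem_univ _, hx, fun y hy => ?_⟩
      have : itinerary T J k₀ y = itinerary T J k₀ x := by
        funext i
        exact mem_itineraryCell.1 hy i (by omega)
      rw [hE, mem_preimage, this]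
      exact hxE
    · exact Or.inl ⟨hxB, hxE⟩
  have h1 : μ (⋃ c ∈ R, itinerary T J k ⁻¹' {c}) ≤ δ⁻¹ * μ (E \ B) := by
    calc _ ≤ ∑ c ∈ R, μ (itinerary T J k ⁻¹' {c}) := measure_biUnion_finset_le _ _
      _ ≤ ∑ c ∈ R, δ⁻¹ * μ (itinerary T J k ⁻¹' {c} \ B) := by
        refine Finset.sum_le_sum fun c hc => ?_
        have := (Finset.mem_filter.1 hc).2.1.le
        calc _ = δ⁻¹ * (δ * μ (itinerary T J k ⁻¹' {c})) := by
              rw [← mul_assoc, ENNReal.inv_mul_cancel hδ hδ', one_mul]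
          _ ≤ _ := by gcongr
      _ = δ⁻¹ * μ (⋃ c ∈ R, (itinerary T J k ⁻¹' {c} \ B)) := by
        rw [← Finset.mul_sum, measure_biUnion_finset]
        · intro c _ c' _ hne
          refine Set.disjoint_left.2 ?_
          rintro x ⟨hx, -⟩ ⟨hx', -⟩
          exact hne (hx.symm.trans hx')
        · exact fun c _ => (h.measurableSet_itinerary k _).diff hB
      _ ≤ _ := by
        gcongr
        exact iUnion₂_subset fun c hc => sdiff_subset_sdiff_left (Finset.mem_filter.1 hc).2.2
  calc _ ≤ μ (B \ E) + δ⁻¹ * μ (E \ B) :=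
        (measure_mono hsub).trans ((measure_union_le _ _).trans (by gcongr))
    _ ≤ μ (B ∆ E) + δ⁻¹ * μ (B ∆ E) := by
        gcongr
        · exact subset_union_left
        · exact subset_union_right
    _ = (1 + δ⁻¹) * μ (B ∆ E) := by ring
    _ ≤ (1 + δ⁻¹) * (ε * (1 + δ⁻¹)⁻¹) := by gcongr
    _ = ε * ((1 + δ⁻¹) * (1 + δ⁻¹)⁻¹) := by ring
    _ ≤ ε * 1 := by gcongr; exact ENNReal.mul_inv_le_one _
    _ = ε := mul_one _

end IsCleanTower

end TowerInvariant

/-! ### Uniqueness of invariant lifts and growth of the Jacobian -/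

section Uniqueness

open scoped ENNReal symmDiff

namespace IsCleanTower

variable {X : Type*} [MeasurableSpace X] {N : ℕ} {μ : Measure X}
  {T : X → X} {G : Set X} {J : X → Fin N} {s : Fin N → ℝ} {α : Set ℕ} {D : ℕ → Set X}
  {j : ℕ → Fin N} {nxt : ℕ → Fin N → ℕ}

/-- The level after `k` steps is, for large `k`, close to the image of the whole cell. -/
theorem tendsto_measure_symmDiff_level [StandardBorelSpace X] [IsProbabilityMeasure μ]
    (h : IsCleanTower μ T G J s α D j nxt) {κ : Measure (ℕ × X)} [IsFiniteMeasure κ]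
    (hκ : IsTowerInvariant μ T J α D nxt κ) {δ : ℝ≥0∞} (hδ : δ ≠ 0) (hδ' : δ ≠ ∞) :
    Tendsto (fun k => κ {p | δ < μ ((T^[k] '' (G ∩ itineraryCell T J k p.2)) ∆
      D ((stepMap T J nxt)^[k] p).1)}) atTop (𝓝 0) := by
  rw [ENNReal.tendsto_nhds_zero]
  intro ε hε
  have hε2 : 0 < ε / 2 := ENNReal.half_pos hε.ne'
  -- High levels carry little of the finite measure `κ`. On each of the remaining finitely many
  -- levels `κ` is bounded by a multiple of `μ`, so the density theorem for `μ` applies.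
  let V : ℕ → Set (ℕ × X) := fun n => {p | n ≤ p.1}
  have hV : Tendsto (fun n => κ (V n)) atTop (𝓝 0) := by
    have := tendsto_measure_iInter_atTop (μ := κ) (s := V)
      (fun n => (measurableSet_le measurable_const measurable_fst).nullMeasurableSet)
      (fun m n hmn p hp => le_trans hmn hp) ⟨0, measure_ne_top _ _⟩
    have he : ⋂ n, V n = ∅ := by
      ext p
      simp only [mem_iInter, mem_empty_iff_false, iff_false, not_forall]
      exact ⟨p.1 + 1, by simp [V]⟩
    rwa [he, measure_empty] at this
  obtain ⟨n, hn⟩ := (ENNReal.tendsto_nhds_zero.1 hV (ε / 2) hε2).exists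
  let Bad : ℕ → ℕ → Set X := fun u k => D u ∩ {x | δ * μ (itineraryCell T J k x) <
      μ (itineraryCell T J k x \ D u)}
  have hbad : ∀ u, u ∈ α → Tendsto (fun k => κ ({u} ×ˢ Bad u k)) atTop (𝓝 0) := by
    intro u hu
    obtain ⟨C, hC, hκC⟩ := hκ.dominated u
    have := ENNReal.Tendsto.const_mul
      (h.tendsto_measure_low_density (h.meas_level u hu) hδ hδ') (Or.inr hC)
    rw [mul_zero] at this
    exact tendsto_of_tendsto_of_tendsto_of_le_of_le tendsto_const_nhds this
      (fun _ => zero_le) (fun k => hκC _)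
  classical
  have hsum : Tendsto (fun k => ∑ u ∈ (Finset.range n).filter (· ∈ α), κ ({u} ×ˢ Bad u k))
      atTop (𝓝 0) := by
    rw [← Finset.sum_const_zero (s := (Finset.range n).filter (· ∈ α))]
    exact tendsto_finsetSum _ fun u hu => hbad u (Finset.mem_filter.1 hu).2
  filter_upwards [ENNReal.tendsto_nhds_zero.1 hsum (ε / 2) hε2] with k hk
  have hsub : {p : ℕ × X | δ < μ ((T^[k] '' (G ∩ itineraryCell T J k p.2)) ∆
      D ((stepMap T J nxt)^[k] p).1)} ≤ᵐ[κ]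
      (V n ∪ ⋃ u ∈ (Finset.range n).filter (· ∈ α), {u} ×ˢ Bad u k : Set (ℕ × X)) := by
    filter_upwards [h.ae_orbit_good hκ] with p hp hp1
    by_cases hpn : n ≤ p.1
    · exact Or.inl hpn
    · right
      refine mem_biUnion (x := p.1) ?_ ⟨rfl, (hp 0).2.2.1, ?_⟩
      · simp only [Finset.coe_filter, Finset.mem_range, mem_ofPred_eq]
        exact ⟨by omega, (hp 0).1⟩
      · by_contra hle
        exact absurd hp1 (not_lt.2 (h.measure_symmDiff_level_le hp k (not_lt.1 hle)))
  calc _ ≤ κ (V n) + ∑ u ∈ (Finset.range n).filter (· ∈ α), κ ({u} ×ˢ Bad u k) :=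
        (measure_mono_ae hsub).trans ((measure_union_le _ _).trans
          (by gcongr; exact measure_biUnion_finset_le _ _))
    _ ≤ ε / 2 + ε / 2 := add_le_add hn hk
    _ = ε := ENNReal.add_halves ε

/-- The level after `k` steps is approximately determined by the itinerary of the base point. -/
theorem eventually_measure_level_symmDiff_le [StandardBorelSpace X] [IsProbabilityMeasure μ]
    (h : IsCleanTower μ T G J s α D j nxt) {κ : Measure (ℕ × X)} [IsFiniteMeasure κ]
    (hκ : IsTowerInvariant μ T J α D nxt κ) {v : ℕ} (hv : v ∈ α) {ε : ℝ≥0∞} (hε : 0 < ε) :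
    ∃ δ₀ : ℝ≥0∞, 0 < δ₀ ∧ ∀ δ, 0 < δ → δ ≠ ∞ → δ ≤ δ₀ → ∀ᶠ k in atTop,
      κ ({p | ((stepMap T J nxt)^[k] p).1 = v} ∆
        {p | μ ((T^[k] '' (G ∩ itineraryCell T J k p.2)) ∆ D v) ≤ δ}) ≤ ε := by
  have hε2 : 0 < ε / 2 := ENNReal.half_pos hε.ne'
  -- These are the levels other than `v` that nearly coincide with `D v`. They shrink to nothing
  -- because distinct levels differ modulo `μ`, and by invariance the orbit is in `W n` at time `k`
  -- with the same small measure for all `k`. The factor `2` anticipates the triangle inequality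
  -- through the image of the cell.
  let W : ℕ → Set (ℕ × X) := fun n =>
    {p | p.1 ∈ α ∧ p.1 ≠ v ∧ μ (D p.1 ∆ D v) ≤ 2 * ((n : ℝ≥0∞) + 1)⁻¹}
  have hWm : ∀ n, MeasurableSet (W n) := fun n => measurable_fst
    (.of_discrete : MeasurableSet
      {u : ℕ | u ∈ α ∧ u ≠ v ∧ μ (D u ∆ D v) ≤ 2 * ((n : ℝ≥0∞) + 1)⁻¹})
  have hW : Tendsto (fun n => κ (W n)) atTop (𝓝 0) := by
    have := tendsto_measure_iInter_atTop (μ := κ) (s := W)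
      (fun n => (hWm n).nullMeasurableSet)
      (fun m n hmn p hp => ⟨hp.1, hp.2.1, hp.2.2.trans (by gcongr)⟩) ⟨0, measure_ne_top _ _⟩
    have he : ⋂ n, W n = ∅ := by
      ext p
      simp only [mem_iInter, mem_empty_iff_false, iff_false]
      intro hp
      have hlim : Tendsto (fun n : ℕ => 2 * ((n : ℝ≥0∞) + 1)⁻¹) atTop (𝓝 0) := by
        have h1 : Tendsto (fun n : ℕ => ((n : ℝ≥0∞) + 1)⁻¹) atTop (𝓝 0) := by
          have := ENNReal.tendsto_inv_nat_nhds_zero.comp (tendsto_add_atTop_nat 1)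
          simpa [Function.comp_def] using this
        simpa using ENNReal.Tendsto.const_mul h1 (Or.inr (by simp : (2 : ℝ≥0∞) ≠ ∞))
      have h0 : μ (D p.1 ∆ D v) = 0 :=
        le_antisymm (ge_of_tendsto' hlim fun n => (hp n).2.2) zero_le
      exact (hp 0).2.1 (h.distinct _ (hp 0).1 _ hv (measure_symmDiff_eq_zero_iff.1 h0))
    rwa [he, measure_empty] at this
  obtain ⟨n, hn⟩ := (ENNReal.tendsto_nhds_zero.1 hW (ε / 2) hε2).exists
  refine ⟨((n : ℝ≥0∞) + 1)⁻¹, by simp, fun δ hδ hδt hδn => ?_⟩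
  filter_upwards [ENNReal.tendsto_nhds_zero.1
    (h.tendsto_measure_symmDiff_level hκ hδ.ne' hδt) (ε / 2) hε2] with k hk
  have hsub : ({p | ((stepMap T J nxt)^[k] p).1 = v} ∆
        {p | μ ((T^[k] '' (G ∩ itineraryCell T J k p.2)) ∆ D v) ≤ δ} : Set (ℕ × X)) ≤ᵐ[κ]
      ({p | δ < μ ((T^[k] '' (G ∩ itineraryCell T J k p.2)) ∆
        D ((stepMap T J nxt)^[k] p).1)} ∪ (stepMap T J nxt)^[k] ⁻¹' W n : Set (ℕ × X)) := by
    filter_upwards [h.ae_orbit_good hκ] with p hp hp1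
    rcases hp1 with ⟨h1, h2⟩ | ⟨h1, h2⟩
    · left
      have h1' : ((stepMap T J nxt)^[k] p).1 = v := h1
      change δ < _
      rw [h1']
      exact not_le.1 h2
    · by_cases hA : δ < μ ((T^[k] '' (G ∩ itineraryCell T J k p.2)) ∆
        D ((stepMap T J nxt)^[k] p).1)
      · exact Or.inl hA
      · right
        refine ⟨(hp k).1, h2, ?_⟩
        rw [not_lt, symmDiff_comm] at hA
        calc _ ≤ _ := measure_symmDiff_le _ (T^[k] '' (G ∩ itineraryCell T J k p.2)) _
          _ ≤ δ + δ := add_le_add hA h1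
          _ ≤ _ := by rw [← two_mul]; gcongr
  calc _ ≤ _ := (measure_mono_ae hsub).trans (measure_union_le _ _)
    _ ≤ ε / 2 + ε / 2 := by
      refine add_le_add hk ?_
      rwa [(hκ.preserving.iterate k).measure_preimage (hWm n).nullMeasurableSet]
    _ = ε := ENNReal.add_halves ε

theorem measurableSet_iterate_cell (h : IsCleanTower μ T G J s α D j nxt) (v k : ℕ) (δ : ℝ≥0∞) :
    MeasurableSet {x | μ ((T^[k] '' (G ∩ itineraryCell T J k x)) ∆ D v) ≤ δ} :=
  h.measurableSet_itinerary k {c | μ ((T^[k] '' (G ∩ itinerary T J k ⁻¹' {c})) ∆ D v) ≤ δ}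

/-- An invariant measure of the tower map is determined by its projection. -/
theorem eq_of_map_snd_eq [StandardBorelSpace X] [IsProbabilityMeasure μ]
    (h : IsCleanTower μ T G J s α D j nxt) {κ κ' : Measure (ℕ × X)} [IsFiniteMeasure κ]
    [IsFiniteMeasure κ'] (hκ : IsTowerInvariant μ T J α D nxt κ)
    (hκ' : IsTowerInvariant μ T J α D nxt κ') (he : κ.map Prod.snd = κ'.map Prod.snd) :
    κ = κ' := by
  have key : ∀ {κ κ' : Measure (ℕ × X)} [IsFiniteMeasure κ] [IsFiniteMeasure κ'],
      IsTowerInvariant μ T J α D nxt κ → IsTowerInvariant μ T J α D nxt κ' →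
      κ.map Prod.snd = κ'.map Prod.snd → ∀ v A, MeasurableSet A →
      κ ({v} ×ˢ A) ≤ κ' ({v} ×ˢ A) := by
    intro κ κ' _ _ hκ hκ' he v A hA
    by_cases hv : v ∈ α
    swap
    · refine (measure_mono_null ?_ hκ.carried).trans_le zero_le
      rintro p ⟨hp, -⟩ hpl
      exact hv (by rw [← show p.1 = v from hp]; exact hpl.1)
    refine ENNReal.le_of_forall_pos_le_add fun ε hε _ => ?_
    have hε2 : (0 : ℝ≥0∞) < ε / 2 := ENNReal.half_pos (by exact_mod_cast hε.ne')
    obtain ⟨δ₁, hδ₁, h1⟩ := h.eventually_measure_level_symmDiff_le hκ hv hε2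
    obtain ⟨δ₂, hδ₂, h2⟩ := h.eventually_measure_level_symmDiff_le hκ' hv hε2
    set δ := min (min δ₁ δ₂) 1 with hδ
    have hδ0 : 0 < δ := lt_min (lt_min hδ₁ hδ₂) one_pos
    have hδt : δ ≠ ∞ := ne_top_of_le_ne_top ENNReal.one_ne_top (min_le_right _ _)
    obtain ⟨k, hk1, hk2⟩ := ((h1 δ hδ0 hδt ((min_le_left _ _).trans (min_le_left _ _))).and
      (h2 δ hδ0 hδt ((min_le_left _ _).trans (min_le_right _ _)))).exists
    set S := {x | μ ((T^[k] '' (G ∩ itineraryCell T J k x)) ∆ D v) ≤ δ} with hS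
    have hSm : MeasurableSet (S ∩ T^[k] ⁻¹' A) :=
      (h.measurableSet_iterate_cell v k δ).inter (h.measurable.iterate k hA)
    have hm : MeasurableSet ({v} ×ˢ A) := (measurableSet_singleton v).prod hA
    have hpre : (stepMap T J nxt)^[k] ⁻¹' ({v} ×ˢ A) =
        {p | ((stepMap T J nxt)^[k] p).1 = v} ∩ {p | T^[k] p.2 ∈ A} := by
      ext p
      simp only [mem_preimage, mem_prod, mem_singleton_iff, iterate_stepMap_snd, mem_inter_iff,
        mem_ofPred_eq]
    -- By invariance both measures may be read at time `k`. There the event that the level is `v` is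
    -- replaced, at a cost of `ε / 2` for each measure, by the event `S` in the base point, on which
    -- the projections decide.
    rw [← (hκ.preserving.iterate k).measure_preimage hm.nullMeasurableSet,
      ← (hκ'.preserving.iterate k).measure_preimage hm.nullMeasurableSet, hpre]
    have e : κ (Prod.snd ⁻¹' (S ∩ T^[k] ⁻¹' A)) = κ' (Prod.snd ⁻¹' (S ∩ T^[k] ⁻¹' A)) := by
      rw [← Measure.map_apply measurable_snd hSm, he, Measure.map_apply measurable_snd hSm]
    calc _ ≤ κ (Prod.snd ⁻¹' (S ∩ T^[k] ⁻¹' A) ∪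
          {p | ((stepMap T J nxt)^[k] p).1 = v} ∆ {p | p.2 ∈ S}) := by
            refine measure_mono fun p hp => ?_
            by_cases hpS : p.2 ∈ S
            · exact Or.inl ⟨hpS, hp.2⟩
            · exact Or.inr (Or.inl ⟨hp.1, hpS⟩)
      _ ≤ κ (Prod.snd ⁻¹' (S ∩ T^[k] ⁻¹' A)) + ε / 2 :=
            (measure_union_le _ _).trans (by gcongr; exact hk1)
      _ = κ' (Prod.snd ⁻¹' (S ∩ T^[k] ⁻¹' A)) + ε / 2 := by rw [e]
      _ ≤ κ' (({p | ((stepMap T J nxt)^[k] p).1 = v} ∩ {p | T^[k] p.2 ∈ A}) ∪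
          {p | ((stepMap T J nxt)^[k] p).1 = v} ∆ {p | p.2 ∈ S}) + ε / 2 := by
            gcongr
            intro p hp
            by_cases hpv : ((stepMap T J nxt)^[k] p).1 = v
            · exact Or.inl ⟨hpv, hp.2⟩
            · exact Or.inr (Or.inr ⟨hp.1, hpv⟩)
      _ ≤ κ' ({p | ((stepMap T J nxt)^[k] p).1 = v} ∩ {p | T^[k] p.2 ∈ A}) + ε / 2 + ε / 2 := by
            gcongr
            exact (measure_union_le _ _).trans (by gcongr; exact hk2)
      _ = _ := by rw [add_assoc, ENNReal.add_halves]
  exact measure_ext_of_forall_level fun v A hA =>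
    le_antisymm (key hκ hκ' he v A hA) (key hκ' hκ he.symm v A hA)

/-- The points of a level do not all have the same itinerary. -/
theorem not_ae_const_itinerary [StandardBorelSpace X] [IsFiniteMeasure μ]
    (h : IsCleanTower μ T G J s α D j nxt) (hna : ∀ x, μ {x} = 0) {u : ℕ} (hu : u ∈ α)
    (w : ℕ → Fin N) : ¬ ∀ k, ∀ᵐ x ∂μ, x ∈ D u → J (T^[k] x) = w k := by
  intro hw
  have hw' : ∀ᵐ x ∂μ, x ∈ D u → ∀ k, J (T^[k] x) = w k := by
    filter_upwards [ae_all_iff.2 hw] with x hx hxD k using hx k hxD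
  apply h.level_pos u hu
  rw [← Measure.restrict_eq_zero]
  -- With a constant itinerary, a set defined by finitely many letters contains almost all of `D u`
  -- or almost none of it. Since such sets approximate all measurable ones, `μ` on `D u` would take
  -- only two values.
  refine eq_zero_of_forall_measure_zero_or_compl (fun x => ?_) fun A hA => ?_
  · exact le_antisymm ((Measure.restrict_apply_le _ _).trans (hna x).le) zero_le
  by_contra! hne
  obtain ⟨h1, h2⟩ := hne
  rw [Measure.restrict_apply hA] at h1
  rw [Measure.restrict_apply hA.compl] at h2
  obtain ⟨ε, hε, hlt⟩ := exists_between
    (lt_min (pos_iff_ne_zero.2 h1) (pos_iff_ne_zero.2 h2))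
  obtain ⟨k, Q, hQ⟩ := h.generating A hA ε hε
  have hcell : ∀ᵐ x ∂μ, x ∈ D u → itinerary T J k x = fun i : Fin (k + 1) => w i := by
    filter_upwards [hw'] with x hx hxD
    funext i
    exact hx hxD i
  by_cases hc : (fun i : Fin (k + 1) => w i) ∈ Q
  · have : (Aᶜ ∩ D u : Set X) ≤ᵐ[μ] (A ∆ (itinerary T J k ⁻¹' Q) : Set X) := by
      filter_upwards [hcell] with x hx hxA
      refine Or.inr ⟨?_, hxA.1⟩
      rw [mem_preimage, hx hxA.2]
      exact hc
    exact absurd ((measure_mono_ae this).trans hQ) (not_le.2 (hlt.trans_le (min_le_right _ _)))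
  · have : (A ∩ D u : Set X) ≤ᵐ[μ] (A ∆ (itinerary T J k ⁻¹' Q) : Set X) := by
      filter_upwards [hcell] with x hx hxA
      refine Or.inl ⟨hxA.1, ?_⟩
      rw [mem_preimage, hx hxA.2]
      exact hc
    exact absurd ((measure_mono_ae this).trans hQ) (not_le.2 (hlt.trans_le (min_le_left _ _)))

theorem measure_image_level (h : IsCleanTower μ T G J s α D j nxt) {u : ℕ} (hu : u ∈ α) :
    μ (T '' (G ∩ D u)) = ENNReal.ofReal (s (j u)) * μ (D u) := by
  rw [h.scale (j u) _ (h.meas_good.inter (h.meas_level u hu)) (h.good_inter_level_subset hu),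
    measure_congr (h.good_inter_level_ae _)]

/-- Almost no point of the tower has an orbit along which the Jacobian is always one. -/
theorem measure_slope_eq_one [StandardBorelSpace X] [IsProbabilityMeasure μ]
    (h : IsCleanTower μ T G J s α D j nxt) (hna : ∀ x, μ {x} = 0) {κ : Measure (ℕ × X)}
    [IsFiniteMeasure κ] (hκ : IsTowerInvariant μ T J α D nxt κ) :
    κ {p | ∀ k, s (J (T^[k] p.2)) = 1} = 0 := by
  set W : Set (ℕ × X) := {p | ∀ k, s (J (T^[k] p.2)) = 1} with hW
  have hWm : MeasurableSet W := by
    rw [hW, ofPred_forall]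
    exact MeasurableSet.iInter fun k => (h.meas_letter.comp
      ((h.measurable.iterate k).comp measurable_snd)) (Set.toFinite {i | s i = 1}).measurableSet
  set S := stepMap T J nxt with hSdef
  have hWS : W ⊆ S ⁻¹' W := fun p hp k => by
    have := hp (k + 1)
    rwa [Function.iterate_succ_apply] at this
  have hWae : (W : Set (ℕ × X)) =ᵐ[κ] (S ⁻¹' W : Set (ℕ × X)) :=
    ae_eq_of_ae_subset_of_measure_ge hWS.eventuallyLE
      (hκ.preserving.measure_preimage hWm.nullMeasurableSet).le hWm.nullMeasurableSet
      (measure_ne_top _ _)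
  have hgood := h.ae_orbit_good hκ
  have hstep : ∀ p ∈ goodTower μ T G J α D, p ∈ W → μ (D (S p).1) ≤ μ (T '' (G ∩ D p.1)) ∧
      μ (T '' (G ∩ D p.1)) = μ (D p.1) := by
    intro p hp hpW
    constructor
    · rw [show D (S p).1 = D (nxt p.1 (J (T p.2))) from rfl,
        measure_congr (h.next _ hp.1 _ hp.2.2.2).2]
      exact measure_mono inter_subset_right
    · have := hpW 0
      rw [Function.iterate_zero, id, h.letter _ hp.1 _ hp.2.2.1 hp.2.1] at this
      rw [h.measure_image_level hp.1, this, ENNReal.ofReal_one, one_mul]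
  -- On `W` the levels cannot grow in measure along an orbit, since each is part of the image of the
  -- previous one and the Jacobian is one. So `f ∘ S ≤ f`, and invariance of the integral forces
  -- equality: nothing is cut off.
  set f : ℕ × X → ℝ≥0∞ := W.indicator fun p => μ (D p.1) with hf
  have hfm : Measurable f :=
    ((measurable_of_countable fun u : ℕ => μ (D u)).comp measurable_fst).indicator hWm
  have hfle : (fun p => f (S p)) ≤ᵐ[κ] f := by
    filter_upwards [hgood, hWae] with p hp hpW
    by_cases hpW' : p ∈ W
    · have h1 : S p ∈ W := hWS hpW'
      simp only [hf, indicator_of_mem hpW', indicator_of_mem h1]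
      obtain ⟨h2, h3⟩ := hstep p (hp 0) hpW'
      exact h2.trans h3.le
    · have h1 : S p ∉ W := fun hc => hpW' ((Eq.to_iff hpW).2 hc)
      simp only [hf, indicator_of_notMem h1]
      exact zero_le
  have hfint : ∫⁻ p, f (S p) ∂κ = ∫⁻ p, f p ∂κ := hκ.preserving.lintegral_comp hfm
  have hffin : ∫⁻ p, f p ∂κ ≠ ∞ := by
    refine ne_top_of_le_ne_top (measure_ne_top κ univ) ?_
    rw [← lintegral_one]
    refine lintegral_mono fun p => ?_
    exact (indicator_le_self _ _ p).trans prob_le_one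
  have hfeq : (fun p => f (S p)) =ᵐ[κ] f :=
    ae_eq_of_ae_le_of_lintegral_le hfle (by rwa [hfint]) hfm.aemeasurable hfint.ge
  have hfall := ae_forall_iterate hκ.preserving.quasiMeasurePreserving hfeq
  by_contra hne
  obtain ⟨p, hpW, hp, hpf⟩ := ((frequently_ae_mem_iff.2 hne).and_eventually
    (hgood.and hfall)).exists
  have hWk : ∀ k, S^[k] p ∈ W := by
    intro k
    induction k with
    | zero => exact hpW
    | succ k ih => rw [Function.iterate_succ_apply']; exact hWS ih
  -- Because no cutting occurs, almost every point of the starting level follows the whole path of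
  -- levels of `p`, and hence has the same itinerary.
  have hmain : ∀ k, ∀ᵐ y ∂μ, y ∈ D p.1 → T^[k] y ∈ D (S^[k] p).1 := by
    intro k
    induction k with
    | zero => exact Eventually.of_forall fun y hy => hy
    | succ k ih =>
      set q := S^[k] p with hq
      have hqf : f (S q) = f q := hpf k
      have hqg := hp k
      rw [← hSdef, ← hq] at hqg
      obtain ⟨h2, h3⟩ := hstep q hqg (hWk k)
      have hSq : S q ∈ W := hWS (hWk k)
      rw [hf, indicator_of_mem hSq, indicator_of_mem (hWk k : q ∈ W)] at hqf
      have hle : (D (S q).1 : Set X) ≤ᵐ[μ] (T '' (G ∩ D q.1) : Set X) := by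
        refine (h.next _ hqg.1 _ hqg.2.2.2).2.le.trans ?_
        exact inter_subset_right.eventuallyLE
      have heq : (D (S q).1 : Set X) =ᵐ[μ] (T '' (G ∩ D q.1) : Set X) :=
        ae_eq_of_ae_subset_of_measure_ge hle (by rw [h3, hqf])
          (h.meas_level _ (h.next _ hqg.1 _ hqg.2.2.2).1).nullMeasurableSet (measure_ne_top _ _)
      filter_upwards [ih, h.ae_good, (h.quasi.iterate (k + 1)).ae heq] with y hy hyG hye hyD
      rw [Function.iterate_succ_apply' S, ← hq]
      refine (Eq.to_iff hye).2 ?_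
      rw [Function.iterate_succ_apply']
      exact ⟨T^[k] y, ⟨h.good_maps.iterate k hyG, hy hyD⟩, rfl⟩
  refine h.not_ae_const_itinerary hna (hp 0).1 (fun k => j (S^[k] p).1) fun k => ?_
  filter_upwards [hmain k, h.ae_good] with y hy hyG hyD
  exact h.letter _ (hp k).1 _ (hy hyD) (h.good_maps.iterate k hyG)

/-- The Jacobian of the iterates tends to infinity almost everywhere. -/
theorem ae_tendsto_prod_slope [StandardBorelSpace X] [IsProbabilityMeasure μ]
    (h : IsCleanTower μ T G J s α D j nxt) (hna : ∀ x, μ {x} = 0) {κ : Measure (ℕ × X)}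
    [IsFiniteMeasure κ] (hκ : IsTowerInvariant μ T J α D nxt κ) :
    ∀ᵐ p ∂κ, Tendsto (fun k => ∏ i ∈ Finset.range k, s (J (T^[i] p.2))) atTop atTop := by
  have h0 := ae_forall_iterate hκ.preserving.quasiMeasurePreserving
    (measure_eq_zero_iff_ae_notMem.1 (h.measure_slope_eq_one hna hκ))
  filter_upwards [h0] with p hp
  set P : ℕ → ℝ := fun k => ∏ i ∈ Finset.range k, s (J (T^[i] p.2)) with hP
  have hPpos : ∀ k, 0 < P k := fun k =>
    Finset.prod_pos fun i _ => zero_lt_one.trans_le (h.one_le _)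
  have hPs : ∀ k, P (k + 1) = P k * s (J (T^[k] p.2)) := fun k => Finset.prod_range_succ _ _
  have hmono : Monotone P := monotone_nat_of_le_succ fun k => by
    rw [hPs]
    exact le_mul_of_one_le_right (hPpos k).le (h.one_le _)
  rcases tendsto_atTop_of_monotone hmono with ht | ⟨l, hl⟩
  · exact ht
  exfalso
  have hl0 : 0 < l := (hPpos 0).trans_le (hmono.ge_of_tendsto hl 0)
  have hratio : Tendsto (fun k => s (J (T^[k] p.2))) atTop (𝓝 1) := by
    have := (hl.comp (tendsto_add_atTop_nat 1)).div hl hl0.ne'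
    rw [div_self hl0.ne'] at this
    refine this.congr fun k => ?_
    change P (k + 1) / P k = _
    rw [hPs, mul_div_assoc, mul_comm, div_mul_cancel₀ _ (hPpos k).ne']
  -- The Jacobian takes finitely many values, so ratios tending to `1` are eventually equal to `1`.
  -- Some iterate of `p` would then lie in the excluded null set.
  have hnhds : ∀ᶠ k in atTop, s (J (T^[k] p.2)) = 1 := by
    have hfin : (range s \ {1}).Finite := (finite_range s).sdiff
    filter_upwards [hratio.eventually (hfin.isClosed.isOpen_compl.mem_nhds (by simp))] with k hk
    by_contra hne
    exact hk ⟨⟨_, rfl⟩, hne⟩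
  obtain ⟨n, hn⟩ := eventually_atTop.1 hnhds
  refine hp n fun k => ?_
  rw [iterate_stepMap_snd, ← Function.iterate_add_apply]
  exact hn (k + n) (by omega)

end IsCleanTower

end Uniqueness

/-! ### The rugs over a Borel model of the tower -/

section Rugs

open scoped ENNReal symmDiff

theorem lintegral_Icc_div_add {a r c : ℝ} (ha : 0 < a) {f : ℝ → ℝ≥0∞} (hf : Measurable f) :
    ∫⁻ y in Icc 0 r, f (y / a + c) = ENNReal.ofReal a * ∫⁻ y in Icc c (c + r / a), f y := by
  have hm : Measurable fun y : ℝ => y / a + c := (measurable_id.div_const a).add_const c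
  have hmap : (volume : Measure ℝ).map (fun y => y / a + c) = ENNReal.ofReal a • volume := by
    have : (fun y : ℝ => y / a + c) = (fun y => y + c) ∘ fun y => y * a⁻¹ := by
      funext y
      simp [div_eq_mul_inv]
    rw [this, ← Measure.map_map (measurable_add_const c) (measurable_mul_const _),
      Real.map_volume_mul_right (inv_ne_zero ha.ne'), Measure.map_smul, map_add_right_eq_self,
      inv_inv, abs_of_pos ha]
  have hpre : (fun y : ℝ => y / a + c) ⁻¹' Icc c (c + r / a) = Icc 0 r := by
    ext y
    simp only [mem_preimage, mem_Icc, le_add_iff_nonneg_left, add_comm c,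
      add_le_add_iff_right, div_le_div_iff_of_pos_right ha]
    constructor
    · rintro ⟨h1, h2⟩
      refine ⟨?_, h2⟩
      have := mul_nonneg h1 ha.le
      rwa [div_mul_cancel₀ _ ha.ne'] at this
    · exact fun ⟨h1, h2⟩ => ⟨by positivity, h2⟩
  rw [← smul_eq_mul, ← lintegral_smul_measure, ← Measure.restrict_smul, ← hmap,
    setLIntegral_map measurableSet_Icc hf hm, hpre]

theorem iUnion_Ico_eq_Ico {c : ℕ → ℝ} {l : ℝ} (hc : Monotone c)
    (hl : Tendsto c atTop (𝓝 l)) : ⋃ n, Ico (c n) (c (n + 1)) = Ico (c 0) l := by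
  ext y
  simp only [mem_iUnion, mem_Ico]
  constructor
  · rintro ⟨n, h1, h2⟩
    exact ⟨(hc (Nat.zero_le n)).trans h1, h2.trans_le (hc.ge_of_tendsto hl _)⟩
  · rintro ⟨h1, h2⟩
    have hex : ∃ n, y < c n := (hl.eventually (lt_mem_nhds h2)).exists
    classical
    obtain ⟨n, hn⟩ : ∃ n, Nat.find hex = n + 1 := by
      refine Nat.exists_eq_succ_of_ne_zero fun h0 => ?_
      have := Nat.find_spec hex
      rw [h0] at this
      exact absurd h1 (not_le.2 this)
    refine ⟨n, not_lt.1 (Nat.find_min hex (by omega)), ?_⟩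
    have := Nat.find_spec hex
    rwa [hn] at this

variable {X : Type*} [MeasurableSpace X] {N : ℕ}

/-- The union of the rugs. -/
def rugSpace (α : Set ℕ) (D : ℕ → Set X) (ρ : ℕ → ℝ) : Set ((ℕ × X) × ℝ) :=
  {z | z.1 ∈ levels α D ∧ z.2 ∈ Icc 0 (ρ z.1.1)}

open Classical in
/-- The volume on the rugs. -/
def rugVolume (μ : Measure X) (α : Set ℕ) (D : ℕ → Set X) (ρ : ℕ → ℝ) :
    Measure ((ℕ × X) × ℝ) :=
  ((levelMeasure μ D fun u => if u ∈ α then 1 else 0).prod volume).restrict (rugSpace α D ρ)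

open Classical in
/-- The height of the strip of the rug over `D v` that comes from the rug over `D t`. -/
def stripHeight (μ : Measure X) (T : X → X) (J : X → Fin N) (s : Fin N → ℝ) (α : Set ℕ)
    (D : ℕ → Set X) (j : ℕ → Fin N) (nxt : ℕ → Fin N → ℕ) (ρ : ℕ → ℝ) (v t : ℕ) : ℝ :=
  if Step μ T J α D nxt t v then ρ t / s (j t) else 0

/-- The Borel version of the map of the rugs. -/
def rugStep (μ : Measure X) (T : X → X) (J : X → Fin N) (s : Fin N → ℝ) (α : Set ℕ)
    (D : ℕ → Set X) (j : ℕ → Fin N) (nxt : ℕ → Fin N → ℕ) (ρ : ℕ → ℝ)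
    (z : (ℕ × X) × ℝ) : (ℕ × X) × ℝ :=
  (stepMap T J nxt z.1, z.2 / s (j z.1.1) +
    ∑ t ∈ Finset.range z.1.1, stripHeight μ T J s α D j nxt ρ (stepMap T J nxt z.1).1 t)

/-- `ρ` is the density of an invariant probability measure of the tower map. -/
structure IsRugWeight (μ : Measure X) (T : X → X) (J : X → Fin N) (s : Fin N → ℝ) (α : Set ℕ)
    (D : ℕ → Set X) (j : ℕ → Fin N) (nxt : ℕ → Fin N → ℕ) (ρ : ℕ → ℝ) : Prop where
  nonneg : ∀ u, 0 ≤ ρ u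
  eq_zero : ∀ u, u ∉ α → ρ u = 0
  invariant : ∀ v, transfer μ T J s α D j nxt (fun u => ENNReal.ofReal (ρ u)) v =
    ENNReal.ofReal (ρ v)
  total : ∑' u, ENNReal.ofReal (ρ u) * μ (D u) = 1

/-- The points of the rugs at which the map of the rugs is well-behaved. -/
def goodRug (μ : Measure X) (T : X → X) (G : Set X) (J : X → Fin N) (α : Set ℕ) (D : ℕ → Set X)
    (ρ : ℕ → ℝ) : Set ((ℕ × X) × ℝ) :=
  {z | z.1 ∈ goodTower μ T G J α D ∧ 0 ≤ z.2 ∧ z.2 < ρ z.1.1}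

namespace IsCleanTower

variable {μ : Measure X} {T : X → X} {G : Set X} {J : X → Fin N} {s : Fin N → ℝ} {α : Set ℕ}
  {D : ℕ → Set X} {j : ℕ → Fin N} {nxt : ℕ → Fin N → ℕ} {ρ : ℕ → ℝ}

theorem slope_pos (h : IsCleanTower μ T G J s α D j nxt) (i : Fin N) : 0 < s i :=
  zero_lt_one.trans_le (h.one_le i)

theorem stripHeight_nonneg (h : IsCleanTower μ T G J s α D j nxt)
    (hρ : IsRugWeight μ T J s α D j nxt ρ) (v t : ℕ) :
    0 ≤ stripHeight μ T J s α D j nxt ρ v t := by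
  rw [stripHeight]
  split_ifs
  exacts [div_nonneg (hρ.nonneg t) (h.slope_pos _).le, le_rfl]

/-- This is the eigenvector equation for `ρ`, transferred to real numbers: the incoming strips
exactly fill the rug. -/
theorem hasSum_stripHeight (h : IsCleanTower μ T G J s α D j nxt)
    (hρ : IsRugWeight μ T J s α D j nxt ρ) (v : ℕ) :
    HasSum (stripHeight μ T J s α D j nxt ρ v) (ρ v) := by
  have h1 : ∑' t, ENNReal.ofReal (stripHeight μ T J s α D j nxt ρ v t) =
      ENNReal.ofReal (ρ v) := by
    rw [← hρ.invariant v, transfer]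
    refine tsum_congr fun t => ?_
    rw [stripHeight]
    split_ifs
    · rw [ENNReal.ofReal_div_of_pos (h.slope_pos _), div_eq_mul_inv]
    · exact ENNReal.ofReal_zero
  have h2 := ENNReal.hasSum_toReal (f := fun t =>
    ENNReal.ofReal (stripHeight μ T J s α D j nxt ρ v t)) (by rw [h1]; exact ENNReal.ofReal_ne_top)
  rw [← ENNReal.tsum_toReal_eq (fun _ => ENNReal.ofReal_ne_top), h1,
    ENNReal.toReal_ofReal (hρ.nonneg v)] at h2
  refine h2.congr_fun ?_ |> id
  intro t
  rw [ENNReal.toReal_ofReal (h.stripHeight_nonneg hρ v t)]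

theorem measurable_rugStep (h : IsCleanTower μ T G J s α D j nxt) :
    Measurable (rugStep μ T J s α D j nxt ρ) := by
  refine (h.measurable_stepMap.comp measurable_fst).prodMk (Measurable.add ?_ ?_)
  · exact measurable_snd.div ((measurable_of_countable fun u : ℕ => s (j u)).comp
      (measurable_fst.comp measurable_fst))
  · exact (measurable_of_countable fun q : ℕ × ℕ => ∑ t ∈ Finset.range q.1,
      stripHeight μ T J s α D j nxt ρ q.2 t).comp ((measurable_fst.comp measurable_fst).prodMk
        (measurable_fst.comp (h.measurable_stepMap.comp measurable_fst)))

theorem measurableSet_levels (h : IsCleanTower μ T G J s α D j nxt) :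
    MeasurableSet (levels α D) := by
  refine measurableSet_of_forall_level fun u => ?_
  by_cases hu : u ∈ α
  · have : Prod.mk u ⁻¹' levels α D = D u := by
      ext x
      simp [levels, hu]
    rw [this]
    exact h.meas_level u hu
  · have : Prod.mk u ⁻¹' levels α D = ∅ := by
      ext x
      simp [levels, hu]
    rw [this]
    exact MeasurableSet.empty

theorem measurable_weight : Measurable fun z : (ℕ × X) × ℝ => ρ z.1.1 :=
  (measurable_of_countable ρ).comp (measurable_fst.comp measurable_fst)

theorem measurableSet_rugSpace (h : IsCleanTower μ T G J s α D j nxt) :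
    MeasurableSet (rugSpace α D ρ) :=
  (measurable_fst h.measurableSet_levels).inter
    ((measurableSet_le measurable_const measurable_snd).inter
      (measurableSet_le measurable_snd measurable_weight))

theorem lintegral_rugVolume [SFinite μ] (h : IsCleanTower μ T G J s α D j nxt)
    (hρ : IsRugWeight μ T J s α D j nxt ρ) {f : (ℕ × X) × ℝ → ℝ≥0∞} (hf : Measurable f) :
    ∫⁻ z, f z ∂rugVolume μ α D ρ =
      ∑' u, ∫⁻ x in D u, (∫⁻ y in Icc 0 (ρ u), f ((u, x), y)) ∂μ := by
  classical
  have hR : MeasurableSet (rugSpace α D ρ) := h.measurableSet_rugSpace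
  have : SFinite (levelMeasure μ D fun u => if u ∈ α then 1 else 0) := by
    rw [levelMeasure]
    infer_instance
  rw [rugVolume, ← lintegral_indicator hR, lintegral_prod _ (hf.indicator hR).aemeasurable,
    lintegral_levelMeasure ((hf.indicator hR).lintegral_prod_right')]
  refine tsum_congr fun u => ?_
  split_ifs with hu
  · rw [one_mul]
    refine setLIntegral_congr_fun (h.meas_level u hu) fun x hx => ?_
    rw [← lintegral_indicator measurableSet_Icc]
    refine lintegral_congr fun y => ?_
    by_cases hy : y ∈ Icc 0 (ρ u)
    · rw [indicator_of_mem hy, indicator_of_mem]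
      exact ⟨⟨hu, hx⟩, hy⟩
    · rw [indicator_of_notMem hy, indicator_of_notMem]
      exact fun hc => hy hc.2
  · rw [zero_mul, hρ.eq_zero u hu]
    simp

theorem map_fst_rugVolume [SFinite μ] (h : IsCleanTower μ T G J s α D j nxt)
    (hρ : IsRugWeight μ T J s α D j nxt ρ) :
    (rugVolume μ α D ρ).map Prod.fst = levelMeasure μ D fun u => ENNReal.ofReal (ρ u) := by
  refine Measure.ext_of_lintegral _ fun f hf => ?_
  rw [lintegral_map hf measurable_fst, h.lintegral_rugVolume (f := fun z => f z.1) hρ (hf.comp measurable_fst),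
    lintegral_levelMeasure hf]
  refine tsum_congr fun u => ?_
  simp only [lintegral_const, Measure.restrict_apply MeasurableSet.univ, univ_inter,
    Real.volume_Icc, sub_zero]
  rw [lintegral_mul_const _ (f := fun x => f (u, x)) (hf.comp measurable_prodMk_left), mul_comm]

theorem isProbabilityMeasure_levelMeasure (hρ : IsRugWeight μ T J s α D j nxt ρ) :
    IsProbabilityMeasure (levelMeasure μ D fun u => ENNReal.ofReal (ρ u)) := by
  constructor
  rw [levelMeasure_apply MeasurableSet.univ]
  simpa using hρ.total

theorem isProbabilityMeasure_rugVolume [SFinite μ] (h : IsCleanTower μ T G J s α D j nxt)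
    (hρ : IsRugWeight μ T J s α D j nxt ρ) : IsProbabilityMeasure (rugVolume μ α D ρ) := by
  constructor
  rw [← preimage_univ (f := Prod.fst), ← Measure.map_apply measurable_fst MeasurableSet.univ,
    h.map_fst_rugVolume hρ]
  exact (isProbabilityMeasure_levelMeasure hρ).measure_univ

theorem isTowerInvariant_levelMeasure (h : IsCleanTower μ T G J s α D j nxt)
    (hρ : IsRugWeight μ T J s α D j nxt ρ) :
    IsTowerInvariant μ T J α D nxt (levelMeasure μ D fun u => ENNReal.ofReal (ρ u)) where
  preserving := ⟨h.measurable_stepMap, by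
    rw [h.map_levelMeasure fun u hu => by rw [hρ.eq_zero u hu, ENNReal.ofReal_zero]]
    congr 1
    exact funext hρ.invariant⟩
  dominated u := ⟨ENNReal.ofReal (ρ u), ENNReal.ofReal_ne_top, fun A => by
    calc _ ≤ levelMeasure μ D (fun u => ENNReal.ofReal (ρ u)) ({u} ×ˢ toMeasurable μ A) :=
          measure_mono (prod_mono le_rfl (subset_toMeasurable μ A))
      _ = ENNReal.ofReal (ρ u) * μ (toMeasurable μ A ∩ D u) :=
          levelMeasure_level (measurableSet_toMeasurable μ A) u
      _ ≤ ENNReal.ofReal (ρ u) * μ A := by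
          rw [← measure_toMeasurable A]
          gcongr
          exact inter_subset_left⟩
  carried := by
    rw [levelMeasure_apply h.measurableSet_levels.compl, ENNReal.tsum_eq_zero]
    intro u
    by_cases hu : u ∈ α
    · have : Prod.mk u ⁻¹' (levels α D)ᶜ ∩ D u = ∅ := by
        ext x
        simp [levels, hu]
      rw [this, measure_empty, mul_zero]
    · rw [hρ.eq_zero u hu, ENNReal.ofReal_zero, zero_mul]

/-- The Jacobian of the branch and the vertical contraction cancel, so each piece of a rug goes to
its strip with volume unchanged, and the strips tile the target rug. -/
theorem map_rugStep [SFinite μ] (h : IsCleanTower μ T G J s α D j nxt)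
    (hρ : IsRugWeight μ T J s α D j nxt ρ) :
    (rugVolume μ α D ρ).map (rugStep μ T J s α D j nxt ρ) = rugVolume μ α D ρ := by
  classical
  refine Measure.ext_of_lintegral _ fun f hf => ?_
  rw [lintegral_map hf h.measurable_rugStep,
    h.lintegral_rugVolume (f := fun z => f (rugStep μ T J s α D j nxt ρ z)) hρ
      (hf.comp h.measurable_rugStep), h.lintegral_rugVolume hρ hf]
  -- `c v u` is the height at which the strip from the level `u` begins in the rug over `v`; without
  -- an arrow the strip is empty. Half-open strips tile `[0, ρ v)` exactly, at the cost of null sets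
  -- of endpoints.
  set c : ℕ → ℕ → ℝ := fun v u =>
    ∑ t ∈ Finset.range u, stripHeight μ T J s α D j nxt ρ v t with hc
  have hcs : ∀ v u, c v (u + 1) = c v u + stripHeight μ T J s α D j nxt ρ v u := fun v u =>
    Finset.sum_range_succ _ _
  have hcm : ∀ v, Monotone (c v) := fun v => monotone_nat_of_le_succ fun u => by
    rw [hcs]
    exact le_add_of_nonneg_right (h.stripHeight_nonneg hρ v u)
  have hcl : ∀ v, Tendsto (c v) atTop (𝓝 (ρ v)) := fun v =>
    (h.hasSum_stripHeight hρ v).tendsto_sum_nat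
  have hstrip : ∀ u v x, (if Step μ T J α D nxt u v then (ENNReal.ofReal (s (j u)))⁻¹ *
      ∫⁻ y in Icc 0 (ρ u), f ((v, x), y / s (j u) + c v u) else 0) =
      ∫⁻ y in Ico (c v u) (c v (u + 1)), f ((v, x), y) := by
    intro u v x
    rw [hcs, stripHeight]
    split_ifs
    · rw [lintegral_Icc_div_add (f := fun y => f ((v, x), y)) (h.slope_pos _)
        (hf.comp measurable_prodMk_left), ← mul_assoc,
        ENNReal.inv_mul_cancel (h.slope_ne_zero _) ENNReal.ofReal_ne_top, one_mul,
        setLIntegral_congr Ico_ae_eq_Icc]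
    · simp
  have hleft : ∀ u, ∫⁻ x in D u, (∫⁻ y in Icc 0 (ρ u),
      f (rugStep μ T J s α D j nxt ρ ((u, x), y))) ∂μ =
      ∑' v, ∫⁻ x in D v, (∫⁻ y in Ico (c v u) (c v (u + 1)), f ((v, x), y)) ∂μ := by
    intro u
    by_cases hu : u ∈ α
    · have hgm : Measurable fun q : (ℕ × X) × ℝ =>
          f (q.1, q.2 / s (j u) + c q.1.1 u) := by
        refine hf.comp (measurable_fst.prodMk ((measurable_snd.div_const _).add ?_))
        exact (measurable_of_countable fun v : ℕ => c v u).comp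
          (measurable_fst.comp measurable_fst)
      have := h.setLIntegral_stepMap hu (hgm.lintegral_prod_right' (ν := volume.restrict
        (Icc 0 (ρ u))))
      refine this.trans (tsum_congr fun v => ?_)
      rw [← lintegral_const_mul' _ _ (ENNReal.inv_ne_top.2 (h.slope_ne_zero _))]
      simp_rw [← hstrip]
      split_ifs <;> simp
    · have h1 : ∀ v, c v (u + 1) = c v u := fun v => by
        rw [hcs, stripHeight, if_neg fun hst => hu hst.1, add_zero]
      simp [h1, hρ.eq_zero u hu]
  rw [tsum_congr hleft, ENNReal.tsum_comm]
  refine tsum_congr fun v => ?_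
  rw [← lintegral_tsum]
  · refine lintegral_congr fun x => ?_
    have hd : Pairwise (Function.onFun Disjoint fun u => Ico (c v u) (c v (u + 1))) :=
      (hcm v).pairwise_disjoint_on_Ico_succ
    rw [← lintegral_iUnion (fun u => measurableSet_Ico) hd,
      iUnion_Ico_eq_Ico (hcm v) (hcl v), setLIntegral_congr Ico_ae_eq_Icc]
    simp [hc]
  · intro u
    exact ((hf.comp ((measurable_prodMk_left.comp measurable_fst).prodMk
      measurable_snd)).lintegral_prod_right' (ν := volume.restrict _)).aemeasurable

theorem measurePreserving_rugStep [SFinite μ] (h : IsCleanTower μ T G J s α D j nxt)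
    (hρ : IsRugWeight μ T J s α D j nxt ρ) :
    MeasurePreserving (rugStep μ T J s α D j nxt ρ) (rugVolume μ α D ρ) (rugVolume μ α D ρ) :=
  ⟨h.measurable_rugStep, h.map_rugStep hρ⟩

theorem measurableSet_goodRug (h : IsCleanTower μ T G J s α D j nxt) :
    MeasurableSet (goodRug μ T G J α D ρ) :=
  (measurable_fst h.measurableSet_goodTower).inter
    ((measurableSet_le measurable_const measurable_snd).inter
      (measurableSet_lt measurable_snd measurable_weight))

theorem measure_compl_goodRug [SFinite μ] (h : IsCleanTower μ T G J s α D j nxt)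
    (hρ : IsRugWeight μ T J s α D j nxt ρ) :
    rugVolume μ α D ρ (goodRug μ T G J α D ρ)ᶜ = 0 := by
  classical
  have h1 : rugVolume μ α D ρ (Prod.fst ⁻¹' (goodTower μ T G J α D)ᶜ) = 0 := by
    rw [← Measure.map_apply measurable_fst h.measurableSet_goodTower.compl,
      h.map_fst_rugVolume hρ]
    exact h.measure_compl_goodTower (h.isTowerInvariant_levelMeasure hρ)
  have h2 : rugVolume μ α D ρ (rugSpace α D ρ)ᶜ = 0 := by
    rw [rugVolume, Measure.restrict_apply h.measurableSet_rugSpace.compl, compl_inter_self,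
      measure_empty]
  have h3 : rugVolume μ α D ρ {z | z.2 = ρ z.1.1} = 0 := by
    refine le_antisymm ((Measure.restrict_apply_le _ _).trans ?_) zero_le
    rw [le_zero_iff, Measure.measure_prod_null (measurableSet_eq_fun measurable_snd
      measurable_weight)]
    refine Eventually.of_forall fun p => ?_
    change volume {y : ℝ | y = ρ p.1} = 0
    simp
  refine measure_mono_null ?_ (measure_union_null h1 (measure_union_null h2 h3))
  intro z hz
  by_cases hz1 : z.1 ∈ goodTower μ T G J α D
  · right
    by_cases hz2 : z ∈ rugSpace α D ρ
    · right
      exact le_antisymm hz2.2.2 (not_lt.1 fun hlt => hz ⟨hz1, hz2.2.1, hlt⟩)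
    · exact Or.inl hz2
  · exact Or.inl hz1

/-- The height of the image tells in which strip it lies, hence the level of origin. `T` is
injective on the good part of that level, and the height is affine there. The strict bound in
`goodRug` makes the strips disjoint. -/
theorem injOn_rugStep (h : IsCleanTower μ T G J s α D j nxt)
    (hρ : IsRugWeight μ T J s α D j nxt ρ) :
    InjOn (rugStep μ T J s α D j nxt ρ) (goodRug μ T G J α D ρ) := by
  set c : ℕ → ℕ → ℝ := fun v u =>
    ∑ t ∈ Finset.range u, stripHeight μ T J s α D j nxt ρ v t with hc
  have hcs : ∀ v u, c v (u + 1) = c v u + stripHeight μ T J s α D j nxt ρ v u := fun v u =>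
    Finset.sum_range_succ _ _
  have hcm : ∀ v, Monotone (c v) := fun v => monotone_nat_of_le_succ fun u => by
    rw [hcs]
    exact le_add_of_nonneg_right (h.stripHeight_nonneg hρ v u)
  have hmem : ∀ z ∈ goodRug μ T G J α D ρ, (rugStep μ T J s α D j nxt ρ z).2 ∈
      Ico (c (rugStep μ T J s α D j nxt ρ z).1.1 z.1.1)
        (c (rugStep μ T J s α D j nxt ρ z).1.1 (z.1.1 + 1)) := by
    rintro z ⟨hz1, hz2, hz3⟩
    have hst : Step μ T J α D nxt z.1.1 (stepMap T J nxt z.1).1 := ⟨hz1.1, _, hz1.2.2.2, rfl⟩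
    have hs := h.slope_pos (j z.1.1)
    have hsh : stripHeight μ T J s α D j nxt ρ (rugStep μ T J s α D j nxt ρ z).1.1 z.1.1 =
        ρ z.1.1 / s (j z.1.1) := if_pos hst
    rw [hcs, hsh]
    change z.2 / s (j z.1.1) + c (rugStep μ T J s α D j nxt ρ z).1.1 z.1.1 ∈ _
    exact ⟨le_add_of_nonneg_left (div_nonneg hz2 hs.le), (add_comm _ _).trans_lt (by gcongr)⟩
  intro z hz z' hz' he
  have h1 := hmem z hz
  have h2 := hmem z' hz'
  rw [he] at h1
  have hu : z.1.1 = z'.1.1 := by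
    by_contra hne
    exact Set.disjoint_left.1 ((hcm _).pairwise_disjoint_on_Ico_succ hne) h1 h2
  have hT : T z.1.2 = T z'.1.2 := congrArg (fun z => z.1.2) he
  have hx : z.1.2 = z'.1.2 := by
    refine h.inj (j z.1.1) ⟨hz.1.2.1, ?_⟩ ⟨hz'.1.2.1, ?_⟩ hT
    · exact h.letter _ hz.1.1 _ hz.1.2.2.1 hz.1.2.1
    · rw [hu]
      exact h.letter _ hz'.1.1 _ hz'.1.2.2.1 hz'.1.2.1
  have hp : z.1 = z'.1 := Prod.ext hu hx
  have hy : (rugStep μ T J s α D j nxt ρ z).2 = (rugStep μ T J s α D j nxt ρ z').2 := by rw [he]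
  simp only [rugStep, hp, add_left_inj] at hy
  exact Prod.ext hp ((div_left_inj' (h.slope_pos _).ne').1 hy)

end IsCleanTower

end Rugs

/-! ### Generation of the Borel sets of the rugs -/

section Generation

open scoped ENNReal symmDiff

theorem measure_image_iterate_of_bijOn {Ω : Type*} [MeasurableSpace Ω] [StandardBorelSpace Ω]
    {ν : Measure Ω} {F : Ω → Ω} (hF : MeasurePreserving F ν ν) {Y : Set Ω}
    (hY0 : ν Yᶜ = 0) (hbij : BijOn F Y Y) {B : Set Ω} (hB : MeasurableSet B) (hBY : B ⊆ Y)
    (k : ℕ) : MeasurableSet (F^[k] '' B) ∧ ν (F^[k] '' B) = ν B := by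
  have hinj : InjOn F^[k] Y := hbij.injOn.iterate hbij.mapsTo k
  have hm : MeasurableSet (F^[k] '' B) :=
    hB.image_of_measurable_injOn (hF.measurable.iterate k) (hinj.mono hBY)
  refine ⟨hm, ?_⟩
  rw [← (hF.iterate k).measure_preimage hm.nullMeasurableSet]
  refine measure_congr ?_
  filter_upwards [mem_ae_iff.2 hY0] with z hz
  apply propext
  constructor
  · rintro ⟨w, hw, hwz⟩
    rwa [← hinj (hBY hw) hz hwz]
  · exact fun hzB => ⟨z, hzB, rfl⟩

variable {X : Type*} [MeasurableSpace X] {N : ℕ}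

theorem iterate_rugStep_fst (μ : Measure X) (T : X → X) (J : X → Fin N) (s : Fin N → ℝ)
    (α : Set ℕ) (D : ℕ → Set X) (j : ℕ → Fin N) (nxt : ℕ → Fin N → ℕ) (ρ : ℕ → ℝ) (k : ℕ)
    (z : (ℕ × X) × ℝ) :
    ((rugStep μ T J s α D j nxt ρ)^[k] z).1 = (stepMap T J nxt)^[k] z.1 := by
  induction k with
  | zero => rfl
  | succ k ih => rw [Function.iterate_succ_apply', Function.iterate_succ_apply', ← ih]; rfl

theorem eventuallyMeasurableSet_iInter {Ω ι : Type*} [Countable ι] {𝒢 : MeasurableSpace Ω}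
    {l : Filter Ω} [CountableInterFilter l] {S : ι → Set Ω}
    (hS : ∀ i, EventuallyMeasurableSet 𝒢 l (S i)) : EventuallyMeasurableSet 𝒢 l (⋂ i, S i) :=
  @MeasurableSet.iInter _ _ (eventuallyMeasurableSpace 𝒢 l) _ _ hS

theorem eventuallyMeasurableSet_iUnion {Ω ι : Type*} [Countable ι] {𝒢 : MeasurableSpace Ω}
    {l : Filter Ω} [CountableInterFilter l] {S : ι → Set Ω}
    (hS : ∀ i, EventuallyMeasurableSet 𝒢 l (S i)) : EventuallyMeasurableSet 𝒢 l (⋃ i, S i) :=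
  @MeasurableSet.iUnion _ _ (eventuallyMeasurableSpace 𝒢 l) _ _ hS

/-- The `σ`-algebra generated by the images of the sets that depend on the base point only. -/
abbrev fiberAlgebra {Ω : Type*} (μ : Measure X) (F : Ω → Ω) (Y : Set Ω) (φ : Ω → X) :
    MeasurableSpace Ω :=
  MeasurableSpace.generateFrom
    {S | ∃ (k : ℕ) (A : Set X), NullMeasurableSet A μ ∧ S = F^[k] '' (Y ∩ φ ⁻¹' A)}

namespace IsCleanTower

variable {μ : Measure X} {T : X → X} {G : Set X} {J : X → Fin N} {s : Fin N → ℝ} {α : Set ℕ}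
  {D : ℕ → Set X} {j : ℕ → Fin N} {nxt : ℕ → Fin N → ℕ} {ρ : ℕ → ℝ}

theorem rugVolume_inter_fst_le [SFinite μ] (h : IsCleanTower μ T G J s α D j nxt)
    (hρ : IsRugWeight μ T J s α D j nxt ρ) {A : Set (ℕ × X)} (hA : MeasurableSet A)
    (Y : Set ((ℕ × X) × ℝ)) :
    rugVolume μ α D ρ (Y ∩ Prod.fst ⁻¹' A) ≤
      levelMeasure μ D (fun u => ENNReal.ofReal (ρ u)) A := by
  rw [← h.map_fst_rugVolume hρ, Measure.map_apply measurable_fst hA]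
  exact measure_mono inter_subset_right

/-- By bijectivity the set is the image under `F^(n+k)` of the event that the level after `k` steps
is `v`. For large `k` this event is close to one in the base point, and the image under `F^(n+k)`
does not enlarge the error. -/
theorem eventuallyMeasurableSet_image_level [StandardBorelSpace X] [IsProbabilityMeasure μ]
    (h : IsCleanTower μ T G J s α D j nxt) (hρ : IsRugWeight μ T J s α D j nxt ρ)
    {Y : Set ((ℕ × X) × ℝ)} (hY : MeasurableSet Y) (hYg : Y ⊆ goodRug μ T G J α D ρ)
    (hY0 : rugVolume μ α D ρ Yᶜ = 0) (hbij : BijOn (rugStep μ T J s α D j nxt ρ) Y Y)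
    (n v : ℕ) :
    EventuallyMeasurableSet
      (fiberAlgebra μ (rugStep μ T J s α D j nxt ρ) Y fun z : (ℕ × X) × ℝ => z.1.2)
      (ae (rugVolume μ α D ρ))
      ((rugStep μ T J s α D j nxt ρ)^[n] '' (Y ∩ {z | z.1.1 = v})) := by
  set F := rugStep μ T J s α D j nxt ρ with hF
  set φ : (ℕ × X) × ℝ → X := fun z => z.1.2 with hφ
  have hpres := h.measurePreserving_rugStep hρ
  by_cases hv : v ∈ α
  swap
  · have : Y ∩ {z | z.1.1 = v} = ∅ := by
      rw [eq_empty_iff_forall_notMem]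
      rintro z ⟨hz, hzv⟩
      exact hv (hzv ▸ (hYg hz).1.1)
    rw [this, image_empty]
    exact ⟨∅, @MeasurableSet.empty _ (fiberAlgebra μ F Y φ), EventuallyEq.rfl⟩
  refine eventuallyMeasurableSet_of_approx fun ε hε => ?_
  have := isProbabilityMeasure_levelMeasure hρ
  obtain ⟨δ₀, hδ₀, h1⟩ := h.eventually_measure_level_symmDiff_le
    (h.isTowerInvariant_levelMeasure hρ) hv hε
  set δ := min δ₀ 1 with hδ
  obtain ⟨k, hk⟩ := (h1 δ (lt_min hδ₀ one_pos)
    (ne_top_of_le_ne_top ENNReal.one_ne_top (min_le_right _ _)) (min_le_left _ _)).exists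
  set S := {x | μ ((T^[k] '' (G ∩ itineraryCell T J k x)) ∆ D v) ≤ δ} with hS
  have hSm : MeasurableSet S := h.measurableSet_iterate_cell v k δ
  have hlm : MeasurableSet {p : ℕ × X | ((stepMap T J nxt)^[k] p).1 = v} :=
    (measurable_fst.comp (h.measurable_stepMap.iterate k)) (measurableSet_singleton v)
  set E : Set (ℕ × X) := {p | ((stepMap T J nxt)^[k] p).1 = v} ∆ {p | p.2 ∈ S} with hE
  have hEm : MeasurableSet E := hlm.symmDiff (measurable_snd hSm)
  refine ⟨F^[n + k] '' (Y ∩ φ ⁻¹' S), ⟨_, MeasurableSpace.measurableSet_generateFrom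
    ⟨n + k, S, hSm.nullMeasurableSet, rfl⟩, EventuallyEq.rfl⟩, ?_⟩
  have hleft : F^[n] '' (Y ∩ {z | z.1.1 = v}) =
      F^[n + k] '' (Y ∩ {z | ((stepMap T J nxt)^[k] z.1).1 = v}) := by
    rw [Function.iterate_add, image_comp]
    congr 1
    ext z
    constructor
    · rintro ⟨hz, hzv⟩
      obtain ⟨w, hw, rfl⟩ := (hbij.iterate k).surjOn hz
      refine ⟨w, ⟨hw, ?_⟩, rfl⟩
      rwa [mem_ofPred_eq, hF, iterate_rugStep_fst] at hzv
    · rintro ⟨w, ⟨hw, hwv⟩, rfl⟩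
      refine ⟨(hbij.iterate k).mapsTo hw, ?_⟩
      rwa [mem_ofPred_eq, hF, iterate_rugStep_fst]
  have hsub : (F^[n] '' (Y ∩ {z | z.1.1 = v})) ∆ (F^[n + k] '' (Y ∩ φ ⁻¹' S)) ⊆
      F^[n + k] '' (Y ∩ Prod.fst ⁻¹' E) := by
    rw [hleft]
    rintro _ (⟨⟨z, ⟨hz, hz1⟩, rfl⟩, hz2⟩ | ⟨⟨z, ⟨hz, hz1⟩, rfl⟩, hz2⟩)
    · exact ⟨z, ⟨hz, Or.inl ⟨hz1, fun hc => hz2 ⟨z, ⟨hz, hc⟩, rfl⟩⟩⟩, rfl⟩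
    · exact ⟨z, ⟨hz, Or.inr ⟨hz1, fun hc => hz2 ⟨z, ⟨hz, hc⟩, rfl⟩⟩⟩, rfl⟩
  refine (measure_mono hsub).trans ?_
  rw [(measure_image_iterate_of_bijOn hpres hY0 hbij (hY.inter (measurable_fst hEm))
    inter_subset_left (n + k)).2]
  exact (h.rugVolume_inter_fst_le hρ hEm Y).trans hk

/-- Over a common path of levels, the map of the rugs is a contraction in the fibres. -/
theorem iterate_rugStep_snd_sub (h : IsCleanTower μ T G J s α D j nxt) {k : ℕ}
    {z w : (ℕ × X) × ℝ} (hz : ∀ i, ((rugStep μ T J s α D j nxt ρ)^[i] z).1 ∈ goodTower μ T G J α D)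
    (hw : ∀ i ≤ k, ((rugStep μ T J s α D j nxt ρ)^[i] w).1.1 =
      ((rugStep μ T J s α D j nxt ρ)^[i] z).1.1) :
    ((rugStep μ T J s α D j nxt ρ)^[k] w).2 - ((rugStep μ T J s α D j nxt ρ)^[k] z).2 =
      (w.2 - z.2) / ∏ i ∈ Finset.range k, s (J (T^[i] z.1.2)) := by
  induction k with
  | zero => simp
  | succ k ih =>
    have ih' := ih fun i hi => hw i (by omega)
    have h1 := hw k (by omega)
    have h2 := hw (k + 1) le_rfl
    set F := rugStep μ T J s α D j nxt ρ with hF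
    rw [Function.iterate_succ_apply', Function.iterate_succ_apply'] at h2 ⊢
    have hJ : s (J (T^[k] z.1.2)) = s (j (F^[k] z).1.1) := by
      have hg := hz k
      have := h.letter _ hg.1 _ hg.2.2.1 hg.2.1
      rw [← this, hF, iterate_rugStep_fst, iterate_stepMap_snd]
    have e1 : ∀ z', (F z').2 = z'.2 / s (j z'.1.1) + ∑ t ∈ Finset.range z'.1.1,
      stripHeight μ T J s α D j nxt ρ (F z').1.1 t := fun _ => rfl
    rw [e1, e1, h1, h2, Finset.prod_range_succ, hJ, add_sub_add_right_eq_sub, ← sub_div, ih',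
      div_div]

/-- Points with the same levels at the last `k + 1` times differ in height by at most the initial
height of the rug over the accumulated Jacobian. For large `k` this is small, so sets with a
prescribed path of levels and lying below `q` nearly exhaust the set. -/
theorem eventuallyMeasurableSet_height [StandardBorelSpace X] [IsProbabilityMeasure μ]
    (h : IsCleanTower μ T G J s α D j nxt) (hna : ∀ x, μ {x} = 0)
    (hρ : IsRugWeight μ T J s α D j nxt ρ)
    {Y : Set ((ℕ × X) × ℝ)} (hY : MeasurableSet Y) (hYg : Y ⊆ goodRug μ T G J α D ρ)
    (hY0 : rugVolume μ α D ρ Yᶜ = 0) (hbij : BijOn (rugStep μ T J s α D j nxt ρ) Y Y)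
    (q : ℝ) :
    EventuallyMeasurableSet
      (fiberAlgebra μ (rugStep μ T J s α D j nxt ρ) Y fun z : (ℕ × X) × ℝ => z.1.2)
      (ae (rugVolume μ α D ρ)) {z | z.2 < q} := by
  set F := rugStep μ T J s α D j nxt ρ with hF
  set ν := rugVolume μ α D ρ with hν
  have hpres : MeasurePreserving F ν ν := h.measurePreserving_rugStep hρ
  have hνp : IsProbabilityMeasure ν := h.isProbabilityMeasure_rugVolume hρ
  have hκp := isProbabilityMeasure_levelMeasure hρ
  set κ := levelMeasure μ D fun u => ENNReal.ofReal (ρ u) with hκ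
  have hmapsk : ∀ k, MapsTo F^[k] Y Y := fun k => (hbij.iterate k).mapsTo
  let cell : ∀ k, (Fin (k + 1) → ℕ) → Set ((ℕ × X) × ℝ) := fun k p =>
    F^[k] '' {z | z ∈ Y ∧ ∀ i : Fin (k + 1), (F^[i] z).1.1 = p i}
  have hcell : ∀ k p, EventuallyMeasurableSet
      (fiberAlgebra μ F Y fun z : (ℕ × X) × ℝ => z.1.2) (ae ν) (cell k p) := by
    intro k p
    -- Injectivity of the iterates on `Y` glues the conditions: the `k`-th preimage of a point
    -- passes, at time `i`, through its preimage of order `k - i`.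
    have : cell k p = ⋂ i : Fin (k + 1), F^[k - i] '' (Y ∩ {z | z.1.1 = p i}) := by
      ext w
      rw [mem_iInter]
      constructor
      · rintro ⟨z, ⟨hz, hzp⟩, rfl⟩ i
        refine ⟨F^[i] z, ⟨hmapsk i hz, hzp i⟩, ?_⟩
        rw [← Function.iterate_add_apply, Nat.sub_add_cancel (Nat.lt_succ_iff.1 i.2)]
      · intro hw
        obtain ⟨z, ⟨hz, -⟩, rfl⟩ := hw 0
        refine ⟨z, ⟨hz, fun i => ?_⟩, by simp⟩
        obtain ⟨z', ⟨hz', hzp⟩, he⟩ := hw i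
        have hik := Nat.sub_add_cancel (Nat.lt_succ_iff.1 i.2)
        have : F^[k - i] (F^[i] z) = F^[k - i] z' := by
          rw [← Function.iterate_add_apply, hik, he]
          simp
        rw [(hbij.iterate (k - i)).injOn (hmapsk i hz) hz' this]
        exact hzp
    rw [this]
    exact eventuallyMeasurableSet_iInter fun i =>
      h.eventuallyMeasurableSet_image_level hρ hY hYg hY0 hbij (k - i) (p i)
  refine eventuallyMeasurableSet_of_approx fun ε hε => ?_
  have hε2 : 0 < ε / 2 := ENNReal.half_pos hε.ne'
  obtain ⟨η, hη, hη'⟩ : ∃ η : ℝ, 0 < η ∧ ν {z | z.2 < q ∧ q - z.2 ≤ η} ≤ ε / 2 := by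
    let V : ℕ → Set ((ℕ × X) × ℝ) := fun n => {z | z.2 < q ∧ q - z.2 ≤ 1 / ((n : ℝ) + 1)}
    have hVm : ∀ n, MeasurableSet (V n) := fun n =>
      (measurableSet_lt measurable_snd measurable_const).inter
        (measurableSet_le (measurable_const.sub measurable_snd) measurable_const)
    have := tendsto_measure_iInter_atTop (μ := ν) (s := V)
      (fun n => (hVm n).nullMeasurableSet)
      (fun m n hmn z hz => ⟨hz.1, hz.2.trans (Nat.one_div_le_one_div hmn)⟩)
      ⟨0, measure_ne_top _ _⟩
    have he : ⋂ n, V n = ∅ := by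
      rw [eq_empty_iff_forall_notMem]
      intro z hz
      rw [mem_iInter] at hz
      have h1 := (hz 0).1
      have h2 := ge_of_tendsto' tendsto_one_div_add_atTop_nhds_zero_nat fun n => (hz n).2
      linarith
    rw [he, measure_empty] at this
    obtain ⟨n, hn⟩ := (ENNReal.tendsto_nhds_zero.1 this (ε / 2) hε2).exists
    exact ⟨1 / ((n : ℝ) + 1), Nat.one_div_pos_of_nat, hn⟩
  let P : ℕ → X → ℝ := fun k x => ∏ i ∈ Finset.range k, s (J (T^[i] x))
  have hPpos : ∀ k x, 0 < P k x := fun k x => Finset.prod_pos fun i _ => h.slope_pos _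
  have hPm : ∀ k, Measurable (P k) := fun k => Finset.measurable_fun_prod _ fun i _ =>
    (measurable_of_countable s).comp (h.meas_letter.comp (h.measurable.iterate i))
  -- These are the starting points for which `k` steps have not yet contracted the rug to height
  -- `η`. They decrease to a null set because the product of the Jacobians diverges.
  let B : ℕ → Set (ℕ × X) := fun k => {p | η * P k p.2 < ρ p.1}
  have hBm : ∀ k, MeasurableSet (B k) := fun k =>
    measurableSet_lt (measurable_const.mul ((hPm k).comp measurable_snd))
      ((measurable_of_countable ρ).comp measurable_fst)
  obtain ⟨k, hk⟩ : ∃ k, κ (B k) ≤ ε / 2 := by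
    have hanti : Antitone B := antitone_nat_of_succ_le fun k p hp => by
      refine lt_of_le_of_lt (?_ : η * P k p.2 ≤ η * P (k + 1) p.2) hp
      have : P (k + 1) p.2 = P k p.2 * s (J (T^[k] p.2)) := Finset.prod_range_succ _ _
      rw [this]
      exact mul_le_mul_of_nonneg_left
        (le_mul_of_one_le_right (hPpos k _).le (h.one_le _)) hη.le
    have := tendsto_measure_iInter_atTop (μ := κ) (s := B)
      (fun n => (hBm n).nullMeasurableSet) hanti ⟨0, measure_ne_top _ _⟩
    have he : κ (⋂ n, B n) = 0 := by
      rw [measure_eq_zero_iff_ae_notMem]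
      filter_upwards [h.ae_tendsto_prod_slope hna (h.isTowerInvariant_levelMeasure hρ)] with p hp
        hpB
      rw [mem_iInter] at hpB
      obtain ⟨n, hn⟩ := (hp.eventually_ge_atTop (ρ p.1 / η)).exists
      have h1 : η * P n p.2 < ρ p.1 := hpB n
      rw [div_le_iff₀' hη] at hn
      exact absurd h1 (not_lt.2 hn)
    rw [he] at this
    exact (ENNReal.tendsto_nhds_zero.1 this (ε / 2) hε2).exists
  set C : Set ((ℕ × X) × ℝ) := ⋃ p : {p : Fin (k + 1) → ℕ // cell k p ⊆ {z | z.2 < q}},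
    cell k p with hC
  refine ⟨C, eventuallyMeasurableSet_iUnion fun p => hcell k p, ?_⟩
  have hCE : C ⊆ {z | z.2 < q} := iUnion_subset fun p => p.2
  have hsub : ({z | z.2 < q} ∆ C : Set ((ℕ × X) × ℝ)) ⊆
      {z | z.2 < q ∧ q - z.2 ≤ η} ∪ (Yᶜ ∪ F^[k] '' (Y ∩ Prod.fst ⁻¹' B k)) := by
    rintro z (⟨hzq, hzC⟩ | ⟨hzC, hzq⟩)
    swap
    · exact absurd (hCE hzC) hzq
    by_cases hzη : q - z.2 ≤ η
    · exact Or.inl ⟨hzq, hzη⟩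
    right
    by_cases hzY : z ∈ Y
    swap
    · exact Or.inl hzY
    right
    obtain ⟨w, hw, rfl⟩ := (hbij.iterate k).surjOn hzY
    refine ⟨w, ⟨hw, ?_⟩, rfl⟩
    let p : Fin (k + 1) → ℕ := fun i => (F^[i] w).1.1
    have hwp : F^[k] w ∈ cell k p := ⟨w, ⟨hw, fun i => rfl⟩, rfl⟩
    have hnot : ¬ cell k p ⊆ {z | z.2 < q} := fun hc => hzC (mem_iUnion.2 ⟨⟨p, hc⟩, hwp⟩)
    obtain ⟨_, ⟨w', ⟨hw', hwp'⟩, rfl⟩, hq'⟩ := Set.not_subset.1 hnot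
    rw [mem_ofPred_eq, not_lt] at hq'
    have hdiff := h.iterate_rugStep_snd_sub (ρ := ρ) (k := k) (z := w) (w := w')
      (fun i => (hYg (hmapsk i hw)).1) (fun i hi => hwp' ⟨i, Nat.lt_succ_iff.2 hi⟩)
    have h0 : w'.1.1 = w.1.1 := hwp' 0
    have h1 : w'.2 - w.2 < ρ w.1.1 := by
      have e1 := (hYg hw').2.2
      have e2 := (hYg hw).2.1
      rw [h0] at e1
      linarith
    have h2 : η < (w'.2 - w.2) / P k w.1.2 := by
      refine lt_of_lt_of_le (not_le.1 hzη) ?_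
      rw [← hdiff]
      linarith
    rw [lt_div_iff₀ (hPpos k _)] at h2
    exact h2.trans h1
  calc _ ≤ _ := measure_mono hsub
    _ ≤ ν {z | z.2 < q ∧ q - z.2 ≤ η} + (ν Yᶜ + ν (F^[k] '' (Y ∩ Prod.fst ⁻¹' B k))) :=
      (measure_union_le _ _).trans (by gcongr; exact measure_union_le _ _)
    _ ≤ ε / 2 + (0 + ε / 2) := by
      refine add_le_add hη' (add_le_add hY0.le ?_)
      rw [(measure_image_iterate_of_bijOn hpres hY0 hbij (hY.inter (measurable_fst (hBm k)))
        inter_subset_left k).2]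
      exact (h.rugVolume_inter_fst_le hρ (hBm k) Y).trans hk
    _ = ε := by rw [zero_add, ENNReal.add_halves]

/-- The images of the sets that depend on the base point only generate all Borel sets. -/
theorem eventuallyMeasurableSet_fiberAlgebra [StandardBorelSpace X] [IsProbabilityMeasure μ]
    (h : IsCleanTower μ T G J s α D j nxt) (hna : ∀ x, μ {x} = 0)
    (hρ : IsRugWeight μ T J s α D j nxt ρ)
    {Y : Set ((ℕ × X) × ℝ)} (hY : MeasurableSet Y) (hYg : Y ⊆ goodRug μ T G J α D ρ)
    (hY0 : rugVolume μ α D ρ Yᶜ = 0) (hbij : BijOn (rugStep μ T J s α D j nxt ρ) Y Y)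
    {C : Set ((ℕ × X) × ℝ)} (hC : MeasurableSet C) :
    EventuallyMeasurableSet
      (fiberAlgebra μ (rugStep μ T J s α D j nxt ρ) Y fun z : (ℕ × X) × ℝ => z.1.2)
      (ae (rugVolume μ α D ρ)) C := by
  set F := rugStep μ T J s α D j nxt ρ with hF
  set ν := rugVolume μ α D ρ with hν
  set 𝓔 := eventuallyMeasurableSpace
    (fiberAlgebra μ F Y fun z : (ℕ × X) × ℝ => z.1.2) (ae ν) with h𝓔
  have hcongr : ∀ S : Set ((ℕ × X) × ℝ), MeasurableSet[𝓔] (Y ∩ S) → MeasurableSet[𝓔] S := by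
    rintro S ⟨t, ht, hts⟩
    refine ⟨t, ht, EventuallyEq.trans ?_ hts⟩
    filter_upwards [mem_ae_iff.2 hY0] with z hz
    apply propext
    exact ⟨fun hzS => ⟨hz, hzS⟩, fun hzS => hzS.2⟩
  have hlev : @Measurable _ _ 𝓔 _ fun z : (ℕ × X) × ℝ => z.1.1 := by
    refine @measurable_to_countable' _ _ _ _ 𝓔 _ fun v => hcongr _ ?_
    have := h.eventuallyMeasurableSet_image_level hρ hY hYg hY0 hbij 0 v
    rwa [Function.iterate_zero, image_id] at this
  have hpt : @Measurable _ _ 𝓔 _ fun z : (ℕ × X) × ℝ => z.1.2 := fun A hA => by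
    refine hcongr _ ⟨_, MeasurableSpace.measurableSet_generateFrom
      ⟨0, A, hA.nullMeasurableSet, ?_⟩, EventuallyEq.rfl⟩
    rw [Function.iterate_zero, image_id]
  have hht : @Measurable _ _ 𝓔 _ fun z : (ℕ × X) × ℝ => z.2 :=
    @measurable_of_Iio _ _ _ _ _ 𝓔 _ _ _ _ fun q =>
      h.eventuallyMeasurableSet_height hna hρ hY hYg hY0 hbij q
  -- Level, base point and height are all measurable for the completed generated algebra, hence so
  -- is the identity.
  have hid :=
    @Measurable.prodMk _ 𝓔 _ _ _ _ _ _ (@Measurable.prodMk _ 𝓔 _ _ _ _ _ _ hlev hpt) hht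
  exact hid hC

end IsCleanTower

end Generation

/-! ### The Borel model of a piecewise invertible system -/

section Model

open scoped ENNReal symmDiff

variable {n N : ℕ} {X : Set (EuclideanSpace ℝ (Fin n))}

/-- The interior of a piece, without the other pieces. -/
def core (Z : Fin N → Set X) (i : Fin N) : Set X := intr (Z i) ∩ ⋂ l ∈ {l | l ≠ i}, (Z l)ᶜ

/-- The union of the cores. -/
def coreUnion (Z : Fin N → Set X) : Set X := ⋃ i, core Z i

/-- The index of the core that contains a point. -/
def coreLetter [Nonempty (Fin N)] (Z : Fin N → Set X) (x : X) : Fin N :=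
  Classical.epsilon fun i => x ∈ core Z i

open Classical in
/-- A Borel modification of `T`. -/
def borelMap (T : X → X) (Z : Fin N → Set X) : X → X := (coreUnion Z).piecewise T id

/-- The points whose orbits stay in the cores. -/
def goodSet (T : X → X) (Z : Fin N → Set X) : Set X :=
  {x | ∀ k, (borelMap T Z)^[k] x ∈ coreUnion Z}

/-- The index of the piece that contains a level. -/
def levelLetter [Nonempty (Fin N)] (Z : Fin N → Set X) (D : ℕ → Set X) (u : ℕ) : Fin N :=
  Classical.epsilon fun i => D u ⊆ Z i

/-- The level `Z i ∩ T (D u)`. -/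
def nextLevel (μ : Measure X) (T : X → X) (Z : Fin N → Set X) (α : Set ℕ) (D : ℕ → Set X)
    (u : ℕ) (i : Fin N) : ℕ :=
  sInf {v | ArrowVia μ T Z α D i u v}

theorem intr_subset (A : Set X) : intr A ⊆ A := by
  intro x hx
  obtain ⟨y, hy, hyx⟩ := interior_subset hx
  rwa [← Subtype.ext hyx]

theorem isOpen_intr (A : Set X) : IsOpen (intr A) :=
  isOpen_interior.preimage continuous_subtype_val

theorem diff_intr_subset_bdry (A : Set X) : A \ intr A ⊆ bdry A := by
  rintro x ⟨hxA, hx⟩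
  exact ⟨subset_closure ⟨x, hxA, rfl⟩, hx⟩

theorem core_subset_intr (Z : Fin N → Set X) (i : Fin N) : core Z i ⊆ intr (Z i) :=
  inter_subset_left

theorem core_subset (Z : Fin N → Set X) (i : Fin N) : core Z i ⊆ Z i :=
  (core_subset_intr Z i).trans (intr_subset _)

theorem eq_of_mem_core {Z : Fin N → Set X} {i l : Fin N} {x : X} (hx : x ∈ core Z i)
    (hl : x ∈ Z l) : l = i := by
  by_contra hne
  exact mem_iInter₂.1 hx.2 l hne hl

theorem coreLetter_eq [Nonempty (Fin N)] {Z : Fin N → Set X} {i : Fin N} {x : X}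
    (hx : x ∈ core Z i) : coreLetter Z x = i :=
  eq_of_mem_core hx (core_subset Z _ (Classical.epsilon_spec (p := fun i => x ∈ core Z i) ⟨i, hx⟩))

theorem mem_core_coreLetter [Nonempty (Fin N)] {Z : Fin N → Set X} {x : X}
    (hx : x ∈ coreUnion Z) : x ∈ core Z (coreLetter Z x) := by
  obtain ⟨i, hi⟩ := mem_iUnion.1 hx
  rwa [coreLetter_eq hi]

theorem mem_iff_coreLetter [Nonempty (Fin N)] {Z : Fin N → Set X} {x : X}
    (hx : x ∈ coreUnion Z) (i : Fin N) : x ∈ Z i ↔ coreLetter Z x = i := by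
  constructor
  · exact fun hi => (eq_of_mem_core (mem_core_coreLetter hx) hi).symm
  · rintro rfl
    exact core_subset Z _ (mem_core_coreLetter hx)

theorem borelMap_eq {T : X → X} {Z : Fin N → Set X} {x : X} (hx : x ∈ coreUnion Z) :
    borelMap T Z x = T x := by
  classical
  exact piecewise_eq_of_mem _ _ _ hx

theorem goodSet_subset (T : X → X) (Z : Fin N → Set X) : goodSet T Z ⊆ coreUnion Z :=
  fun _ hx => hx 0

theorem mapsTo_goodSet (T : X → X) (Z : Fin N → Set X) :
    MapsTo (borelMap T Z) (goodSet T Z) (goodSet T Z) :=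
  fun _ hx k => hx (k + 1)

theorem borelMap_eq_of_good {T : X → X} {Z : Fin N → Set X} {x : X} (hx : x ∈ goodSet T Z) :
    borelMap T Z x = T x :=
  borelMap_eq (goodSet_subset T Z hx)

theorem image_borelMap {T : X → X} {Z : Fin N → Set X} {A : Set X} (hA : A ⊆ goodSet T Z) :
    borelMap T Z '' A = T '' A :=
  image_congr fun _ hx => borelMap_eq_of_good (hA hx)

theorem iterate_borelMap_eq {T : X → X} {Z : Fin N → Set X} {x : X} (hx : x ∈ goodSet T Z)
    (k : ℕ) : (borelMap T Z)^[k] x = T^[k] x := by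
  induction k with
  | zero => rfl
  | succ k ih =>
    rw [Function.iterate_succ_apply', Function.iterate_succ_apply', ← ih]
    exact borelMap_eq (hx k)

theorem levelSubset [Nonempty (Fin N)] {μ : Measure X} {T : X → X} {Z : Fin N → Set X}
    {α : Set ℕ} {D : ℕ → Set X} (hD : IsLevels μ T Z α D) {u : ℕ} (hu : u ∈ α) :
    D u ⊆ Z (levelLetter Z D u) := by
  obtain ⟨k, w, -, hw, -⟩ := hD.image u hu
  exact Classical.epsilon_spec (p := fun i => D u ⊆ Z i) ⟨_, hw⟩

theorem itinerary_preimage_mono {Y : Type*} (T : Y → Y) (J : Y → Fin N) {k k' : ℕ} (hk : k ≤ k')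
    (Q : Set (Fin (k + 1) → Fin N)) :
    ∃ Q', itinerary T J k ⁻¹' Q = itinerary T J k' ⁻¹' Q' :=
  ⟨{c | (fun i : Fin (k + 1) => c (Fin.castLE (by omega) i)) ∈ Q}, rfl⟩

theorem isSetAlgebra_itinerary {Y : Type*} (T : Y → Y) (J : Y → Fin N) :
    IsSetAlgebra {E : Set Y | ∃ k Q, E = itinerary T J k ⁻¹' Q} where
  empty_mem := ⟨0, ∅, rfl⟩
  compl_mem := by
    rintro _ ⟨k, Q, rfl⟩
    exact ⟨k, Qᶜ, rfl⟩
  union_mem := by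
    rintro _ _ ⟨k, Q, rfl⟩ ⟨k', Q', rfl⟩
    obtain ⟨R, hR⟩ := itinerary_preimage_mono T J (le_max_left k k') Q
    obtain ⟨R', hR'⟩ := itinerary_preimage_mono T J (le_max_right k k') Q'
    exact ⟨max k k', R ∪ R', by rw [hR, hR']; rfl⟩

/-- The standing assumptions on the system. -/
structure IsSystem (μ : Measure X) (T : X → X) (Z : Fin N → Set X) (s : Fin N → ℝ) (α : Set ℕ)
    (D : ℕ → Set X) : Prop where
  partition : IsPartition μ Z
  c1 : C1 T Z
  c2 : C2 μ T
  c3 : C3 μ T Z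
  c4 : C4 μ T Z s
  c6 : C6 μ T Z
  levels : IsLevels μ T Z α D

namespace IsSystem

variable {μ : Measure X} {T : X → X} {Z : Fin N → Set X} {s : Fin N → ℝ} {α : Set ℕ}
  {D : ℕ → Set X}

theorem nonempty [IsProbabilityMeasure μ]
    (h : IsSystem μ T Z s α D) : Nonempty (Fin N) := by
  by_contra hN
  rw [not_nonempty_iff] at hN
  have := h.partition.cover
  simp at this

theorem isOpen_core (h : IsSystem μ T Z s α D) (i : Fin N) : IsOpen (core Z i) :=
  (isOpen_intr _).inter
    ((Set.toFinite _).isOpen_biInter fun l _ => (h.partition.closed l).isOpen_compl)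

theorem isOpen_coreUnion (h : IsSystem μ T Z s α D) : IsOpen (coreUnion Z) :=
  isOpen_iUnion h.isOpen_core

theorem measure_compl_coreUnion [IsProbabilityMeasure μ] (h : IsSystem μ T Z s α D) :
    μ (coreUnion Z)ᶜ = 0 := by
  have h1 : μ (⋃ i, Z i)ᶜ = 0 := by
    rw [prob_compl_eq_zero_iff (MeasurableSet.iUnion fun i => (h.partition.closed i).measurableSet)]
    exact h.partition.cover
  -- This is the term `k = 0` of the union in `c6`; later times are handled by nonsingularity.
  have h2 : μ (⋃ i, bdry (Z i)) = 0 := by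
    refine measure_mono_null ?_ h.c6
    refine subset_trans ?_ (subset_iUnion _ 0)
    simp
  have h3 : μ (⋃ q : {q : Fin N × Fin N // q.1 ≠ q.2}, Z q.1.1 ∩ Z q.1.2) = 0 :=
    measure_iUnion_null fun q => h.partition.overlap _ _ q.2
  refine measure_mono_null ?_ (measure_union_null h1 (measure_union_null h2 h3))
  intro x hx
  by_cases hx1 : x ∈ ⋃ i, Z i
  swap
  · exact Or.inl hx1
  right
  obtain ⟨i, hi⟩ := mem_iUnion.1 hx1
  by_cases hx2 : x ∈ intr (Z i)
  swap
  · exact Or.inl (mem_iUnion.2 ⟨i, diff_intr_subset_bdry _ ⟨hi, hx2⟩⟩)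
  right
  by_contra hx3
  refine hx (mem_iUnion.2 ⟨i, hx2, mem_iInter₂.2 fun l hl hxl => hx3 ?_⟩)
  exact mem_iUnion.2 ⟨⟨(l, i), hl⟩, hxl, hi⟩

theorem continuousOn_intr (h : IsSystem μ T Z s α D) (i : Fin N) :
    ContinuousOn T (intr (Z i)) ∧ InjOn T (intr (Z i)) := by
  obtain ⟨g, ⟨hg, hgi, hgT⟩, -⟩ := h.c1 i
  constructor
  · rw [continuousOn_iff_continuous_domRestrict]
    have : (intr (Z i)).domRestrict T =
        fun x : intr (Z i) => (g ⟨x.1, intr_subset _ x.2⟩ : X) := by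
      funext x
      exact (hgT ⟨x.1, intr_subset _ x.2⟩ x.2).symm
    rw [this]
    exact continuous_subtype_val.comp (hg.comp (continuous_subtype_val.subtype_mk _))
  · intro x hx y hy hxy
    have : g ⟨x, intr_subset _ hx⟩ = g ⟨y, intr_subset _ hy⟩ := by
      refine Subtype.ext ?_
      rw [hgT ⟨x, intr_subset _ hx⟩ hx, hgT ⟨y, intr_subset _ hy⟩ hy]
      exact hxy
    exact congrArg Subtype.val (hgi this)

theorem measurable_borelMap (h : IsSystem μ T Z s α D) : Measurable (borelMap T Z) := by
  classical
  refine ContinuousOn.measurable_piecewise ?_ continuousOn_id h.isOpen_coreUnion.measurableSet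
  intro x hx
  obtain ⟨i, hi⟩ := mem_iUnion.1 hx
  exact (((h.continuousOn_intr i).1.mono (core_subset_intr Z i)).continuousAt
    ((h.isOpen_core i).mem_nhds hi)).continuousWithinAt

theorem measurable_coreLetter [Nonempty (Fin N)] (h : IsSystem μ T Z s α D) :
    Measurable (coreLetter Z) := by
  have hrest : Measurable fun x : coreUnion Z => coreLetter Z (x : X) := by
    refine measurable_to_countable' fun i => ?_
    have : (fun x : coreUnion Z => coreLetter Z (x : X)) ⁻¹' {i} = Subtype.val ⁻¹' core Z i := by
      ext x
      constructor
      · rintro rfl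
        exact mem_core_coreLetter x.2
      · exact fun hx => coreLetter_eq hx
    rw [this]
    exact measurable_subtype_coe (h.isOpen_core i).measurableSet
  have hrest' : Measurable fun x : ((coreUnion Z)ᶜ : Set X) => coreLetter Z (x : X) := by
    have : (fun x : ((coreUnion Z)ᶜ : Set X) => coreLetter Z (x : X)) =
        fun _ => Classical.epsilon fun _ : Fin N => False := by
      funext x
      refine congrArg Classical.epsilon (funext fun i => propext ?_)
      exact ⟨fun hi => x.2 (mem_iUnion.2 ⟨i, hi⟩), False.elim⟩
    rw [this]
    exact measurable_const
  exact measurable_of_restrict_of_restrict_compl h.isOpen_coreUnion.measurableSet hrest hrest'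

theorem null_preimage (h : IsSystem μ T Z s α D) {A : Set X} (hA : μ A = 0) : μ (T ⁻¹' A) = 0 :=
  (h.c2 A (NullMeasurableSet.of_null hA)).2.2 hA

theorem null_preimage_iterate (h : IsSystem μ T Z s α D) {A : Set X} (hA : μ A = 0) (k : ℕ) :
    μ (T^[k] ⁻¹' A) = 0 := by
  induction k with
  | zero => exact hA
  | succ k ih =>
    rw [Function.iterate_succ, preimage_comp]
    exact h.null_preimage ih

theorem null_image (h : IsSystem μ T Z s α D) {A : Set X} {i : Fin N} (hAi : A ⊆ Z i)
    (hA : μ A = 0) : μ (T '' A) = 0 := by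
  rw [(h.c4 i).2 A (NullMeasurableSet.of_null hA) hAi, hA, mul_zero]

theorem image_ae_le (h : IsSystem μ T Z s α D) {A B : Set X} {i : Fin N} (hAi : A ⊆ Z i)
    (hAB : A ≤ᵐ[μ] B) : (T '' A : Set X) ≤ᵐ[μ] (T '' B : Set X) := by
  rw [ae_le_set] at hAB ⊢
  refine measure_mono_null ?_ (h.null_image (sdiff_subset.trans hAi) hAB)
  rintro _ ⟨⟨x, hx, rfl⟩, hy⟩
  exact ⟨x, ⟨hx, fun hxB => hy ⟨x, hxB, rfl⟩⟩, rfl⟩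

theorem image_ae_eq (h : IsSystem μ T Z s α D) {A B : Set X} {i : Fin N} (hAi : A ⊆ Z i)
    (hBi : B ⊆ Z i) (hAB : A =ᵐ[μ] B) : (T '' A : Set X) =ᵐ[μ] (T '' B : Set X) :=
  (h.image_ae_le hAi hAB.le).antisymm (h.image_ae_le hBi hAB.symm.le)

theorem quasi [IsProbabilityMeasure μ] (h : IsSystem μ T Z s α D) :
    Measure.QuasiMeasurePreserving (borelMap T Z) μ μ := by
  refine ⟨h.measurable_borelMap, Measure.AbsolutelyContinuous.mk fun A hA hA0 => ?_⟩
  rw [Measure.map_apply h.measurable_borelMap hA]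
  refine measure_mono_null ?_ (measure_union_null h.measure_compl_coreUnion (h.null_preimage hA0))
  intro x hx
  by_cases hxU : x ∈ coreUnion Z
  · right
    rwa [mem_preimage, borelMap_eq hxU] at hx
  · exact Or.inl hxU

theorem measurableSet_goodSet (h : IsSystem μ T Z s α D) : MeasurableSet (goodSet T Z) := by
  rw [goodSet, ofPred_forall]
  exact MeasurableSet.iInter fun k =>
    (h.measurable_borelMap.iterate k) h.isOpen_coreUnion.measurableSet

theorem measure_compl_goodSet [IsProbabilityMeasure μ] (h : IsSystem μ T Z s α D) :
    μ (goodSet T Z)ᶜ = 0 := by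
  rw [goodSet, ofPred_forall, compl_iInter, measure_iUnion_null_iff]
  exact fun k => (h.quasi.iterate k).preimage_null h.measure_compl_coreUnion

theorem level_ne_zero (h : IsSystem μ T Z s α D) {u : ℕ} (hu : u ∈ α) : μ (D u) ≠ 0 := by
  obtain ⟨k, w, hw, -, he⟩ := h.levels.image u hu
  intro h0
  rw [measure_congr he] at h0
  refine hw.ne' (measure_mono_null ?_ (h.null_preimage_iterate h0 k))
  exact fun x hx => ⟨x, hx, rfl⟩

/-- The letter `i` is appended to a word defining `D u`: the image of the longer cylinder is `Z i ∩
T (D u)` modulo `μ`. That cylinder has positive measure, because images of null subsets of a piece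
are null. -/
theorem exists_arrowVia (h : IsSystem μ T Z s α D) {u : ℕ} (hu : u ∈ α) {i : Fin N}
    (hi : μ (Z i ∩ T '' D u) ≠ 0) : ∃ v, ArrowVia μ T Z α D i u v := by
  obtain ⟨k, w, -, hw, he⟩ := h.levels.image u hu
  set w' : ℕ → Fin N := Function.update w (k + 1) i with hw'
  have hcyl : ∀ x, x ∈ cyl T Z (k + 1) w' ↔ x ∈ cyl T Z k w ∧ T^[k + 1] x ∈ Z i := by
    intro x
    constructor
    · intro hx
      refine ⟨fun l hl => ?_, ?_⟩
      · have := hx l (by omega)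
        rwa [hw', Function.update_of_ne (by omega)] at this
      · have := hx (k + 1) le_rfl
        rwa [hw', Function.update_self] at this
    · rintro ⟨hx, hxi⟩ l hl
      rcases Nat.lt_or_eq_of_le hl with hl | rfl
      · rw [hw', Function.update_of_ne (by omega)]
        exact hx l (by omega)
      · rwa [hw', Function.update_self]
  have himg : T^[k + 1] '' cyl T Z (k + 1) w' = Z i ∩ T '' (T^[k] '' cyl T Z k w) := by
    ext y
    constructor
    · rintro ⟨x, hx, rfl⟩
      rw [hcyl] at hx
      exact ⟨hx.2, T^[k] x, ⟨x, hx.1, rfl⟩, (Function.iterate_succ_apply' T k x).symm⟩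
    · rintro ⟨hy, _, ⟨x, hx, rfl⟩, rfl⟩
      rw [← Function.iterate_succ_apply' T k x] at hy ⊢
      exact ⟨x, (hcyl x).2 ⟨hx, hy⟩, rfl⟩
  have hae : (Z i ∩ T '' D u : Set X) =ᵐ[μ] (T^[k + 1] '' cyl T Z (k + 1) w' : Set X) := by
    rw [himg]
    refine EventuallyEq.rfl.inter (h.image_ae_eq hw ?_ he)
    rintro _ ⟨x, hx, rfl⟩
    exact hx k le_rfl
  have hpos : 0 < μ (cyl T Z (k + 1) w') := by
    rw [pos_iff_ne_zero]
    intro h0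
    have hnull : ∀ l ≤ k + 1, μ (T^[l] '' cyl T Z (k + 1) w') = 0 := by
      intro l
      induction l with
      | zero => simpa using h0
      | succ l ih =>
        intro hl
        rw [Function.iterate_succ', image_comp]
        refine h.null_image (i := w' l) ?_ (ih (by omega))
        rintro _ ⟨x, hx, rfl⟩
        exact hx l (by omega)
    rw [measure_congr hae] at hi
    exact hi (hnull (k + 1) le_rfl)
  obtain ⟨v, hv, hve⟩ := h.levels.exhaust (k + 1) w' hpos
  exact ⟨v, hu, hv, hve.trans hae.symm⟩

theorem arrowVia_unique (h : IsSystem μ T Z s α D) {u v v' : ℕ} {i : Fin N}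
    (hv : ArrowVia μ T Z α D i u v) (hv' : ArrowVia μ T Z α D i u v') : v = v' :=
  h.levels.distinct _ hv.2.1 _ hv'.2.1 (hv.2.2.trans hv'.2.2.symm)

theorem nextLevel_eq (h : IsSystem μ T Z s α D) {u v : ℕ} {i : Fin N}
    (hv : ArrowVia μ T Z α D i u v) : nextLevel μ T Z α D u i = v := by
  have : {v | ArrowVia μ T Z α D i u v} = {v} := by
    ext v'
    exact ⟨fun hv' => h.arrowVia_unique hv' hv, fun hv' => by rw [hv']; exact hv⟩
  rw [nextLevel, this, csInf_singleton]

theorem ae_good [IsProbabilityMeasure μ] (h : IsSystem μ T Z s α D) :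
    ∀ᵐ x ∂μ, x ∈ goodSet T Z :=
  mem_ae_iff.2 h.measure_compl_goodSet

variable [Nonempty (Fin N)]

/-- Null sets inside a level pass forward by the Jacobian and backward by nonsingularity of `T`. -/
theorem measure_branch_ne_zero_iff [IsProbabilityMeasure μ] (h : IsSystem μ T Z s α D) {u : ℕ}
    (hu : u ∈ α) (i : Fin N) :
    μ (D u ∩ borelMap T Z ⁻¹' (coreLetter Z ⁻¹' {i})) ≠ 0 ↔ μ (Z i ∩ T '' D u) ≠ 0 := by
  rw [not_iff_not]
  have hae : (D u ∩ borelMap T Z ⁻¹' (coreLetter Z ⁻¹' {i}) : Set X) =ᵐ[μ]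
      (D u ∩ T ⁻¹' Z i : Set X) := by
    filter_upwards [h.ae_good] with x hx
    apply propext
    refine and_congr_right fun _ => ?_
    rw [mem_preimage, mem_preimage, mem_singleton_iff, borelMap_eq_of_good hx]
    refine (mem_iff_coreLetter ?_ i).symm
    rw [← borelMap_eq_of_good hx]
    exact hx 1
  rw [measure_congr hae]
  constructor
  · intro h0
    have : Z i ∩ T '' D u = T '' (D u ∩ T ⁻¹' Z i) := by
      rw [image_inter_preimage, inter_comm]
    rw [this]
    exact h.null_image (inter_subset_left.trans (levelSubset h.levels hu)) h0
  · intro h0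
    refine measure_mono_null ?_ (h.null_preimage h0)
    exact fun x hx => ⟨hx.2, x, hx.1, rfl⟩

theorem step_iff_arrow [IsProbabilityMeasure μ] (h : IsSystem μ T Z s α D) (t v : ℕ) :
    Step μ (borelMap T Z) (coreLetter Z) α D (nextLevel μ T Z α D) t v ↔
      Arrow μ T Z α D t v := by
  constructor
  · rintro ⟨ht, i, hi, rfl⟩
    rw [h.measure_branch_ne_zero_iff ht] at hi
    obtain ⟨v, hv⟩ := h.exists_arrowVia ht hi
    rw [h.nextLevel_eq hv]
    exact ⟨i, hv⟩
  · rintro ⟨i, hv⟩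
    refine ⟨hv.1, i, ?_, h.nextLevel_eq hv⟩
    rw [h.measure_branch_ne_zero_iff hv.1, ← measure_congr hv.2.2]
    exact h.level_ne_zero hv.2.1

/-- Cylinders agree modulo `μ` with sets defined by finitely many letters of the itinerary. The
latter form an algebra, which is dense in measure in the `σ`-algebra it generates. -/
theorem generating [IsProbabilityMeasure μ] (h : IsSystem μ T Z s α D) {A : Set X}
    (hA : MeasurableSet A) {ε : ℝ≥0∞} (hε : 0 < ε) :
    ∃ k Q, μ (A ∆ (itinerary (borelMap T Z) (coreLetter Z) k ⁻¹' Q)) ≤ ε := by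
  set 𝒜 : Set (Set X) :=
    {E | ∃ k Q, E = itinerary (borelMap T Z) (coreLetter Z) k ⁻¹' Q} with h𝒜
  have hle : MeasurableSpace.generateFrom 𝒜 ≤ Subtype.instMeasurableSpace := by
    refine MeasurableSpace.generateFrom_le ?_
    rintro _ ⟨k, Q, rfl⟩
    have : Measurable (itinerary (borelMap T Z) (coreLetter Z) k) :=
      measurable_pi_lambda _ fun i =>
        h.measurable_coreLetter.comp (h.measurable_borelMap.iterate i)
    exact this Q.toFinite.measurableSet
  have hcyl : MeasurableSpace.generateFrom {S | ∃ k w, S = cyl T Z k w ∧ 0 < μ S} ≤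
      eventuallyMeasurableSpace (MeasurableSpace.generateFrom 𝒜) (ae μ) := by
    refine MeasurableSpace.generateFrom_le ?_
    rintro _ ⟨k, w, rfl, -⟩
    refine ⟨itinerary (borelMap T Z) (coreLetter Z) k ⁻¹' {c | ∀ i, c i = w i},
      MeasurableSpace.measurableSet_generateFrom ⟨k, _, rfl⟩, ?_⟩
    filter_upwards [h.ae_good] with x hx
    apply propext
    change (∀ i ≤ k, T^[i] x ∈ Z (w i)) ↔
      ∀ i : Fin (k + 1), coreLetter Z ((borelMap T Z)^[i] x) = w i
    have hi : ∀ i, T^[i] x ∈ Z (w i) ↔ coreLetter Z ((borelMap T Z)^[i] x) = w i := fun i => by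
      rw [← iterate_borelMap_eq hx, mem_iff_coreLetter (hx i)]
    exact ⟨fun H i => (hi i).1 (H i (Nat.lt_succ_iff.1 i.2)),
      fun H i hik => (hi i).2 (H ⟨i, Nat.lt_succ_iff.2 hik⟩)⟩
  obtain ⟨A', hA', hAA'⟩ := h.c3 A hA.nullMeasurableSet
  obtain ⟨B, hB, hA'B⟩ := hcyl _ hA'
  obtain ⟨r, hr0, hrε⟩ := ENNReal.lt_iff_exists_nnreal_btwn.1 hε
  have : IsFiniteMeasure (μ.trim hle) := isFiniteMeasure_trim hle
  have hdense := @Measure.MeasureDense.of_generateFrom_isSetAlgebra_finite _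
    (MeasurableSpace.generateFrom 𝒜) (μ.trim hle) 𝒜 this (isSetAlgebra_itinerary _ _) rfl
  obtain ⟨E, ⟨k, Q, rfl⟩, hE⟩ := @Measure.MeasureDense.approx _
    (MeasurableSpace.generateFrom 𝒜) _ _ hdense B hB
    (@measure_ne_top _ (MeasurableSpace.generateFrom 𝒜) (μ.trim hle) this B) r
    (by exact_mod_cast hr0)
  refine ⟨k, Q, ?_⟩
  rw [trim_measurableSet_eq hle (@MeasurableSet.symmDiff _ (MeasurableSpace.generateFrom 𝒜) _ _ hB
    (MeasurableSpace.measurableSet_generateFrom ⟨k, Q, rfl⟩)), ENNReal.ofReal_coe_nnreal] at hE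
  have he : (A ∆ (itinerary (borelMap T Z) (coreLetter Z) k ⁻¹' Q) : Set X) =ᵐ[μ]
      (B ∆ (itinerary (borelMap T Z) (coreLetter Z) k ⁻¹' Q) : Set X) :=
    (hAA'.trans hA'B).symmDiff EventuallyEq.rfl
  rw [measure_congr he]
  exact (hE.trans hrε).le

theorem isCleanTower [IsProbabilityMeasure μ] (h : IsSystem μ T Z s α D) :
    IsCleanTower μ (borelMap T Z) (goodSet T Z) (coreLetter Z) s α D (levelLetter Z D)
      (nextLevel μ T Z α D) where
  quasi := h.quasi
  meas_good := h.measurableSet_goodSet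
  good_full := h.measure_compl_goodSet
  good_maps := mapsTo_goodSet T Z
  meas_letter := h.measurable_coreLetter
  inj i := by
    rintro x ⟨hx, hxi⟩ y ⟨hy, hyi⟩ hxy
    rw [borelMap_eq_of_good hx, borelMap_eq_of_good hy] at hxy
    have hxi' : coreLetter Z x = i := hxi
    have hyi' : coreLetter Z y = i := hyi
    have hx' := mem_core_coreLetter (goodSet_subset T Z hx)
    have hy' := mem_core_coreLetter (goodSet_subset T Z hy)
    rw [hxi'] at hx'
    rw [hyi'] at hy'
    exact (h.continuousOn_intr i).2 (core_subset_intr Z i hx') (core_subset_intr Z i hy') hxy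
  one_le i := (h.c4 i).1
  scale i A hA hAi := by
    rw [image_borelMap fun x hx => (hAi hx).1]
    refine (h.c4 i).2 A hA.nullMeasurableSet fun x hx => ?_
    rw [mem_iff_coreLetter (goodSet_subset T Z (hAi hx).1)]
    exact (hAi hx).2
  meas_level := h.levels.measurable
  level_pos _ hu := h.level_ne_zero hu
  letter u hu x hxD hx := by
    rw [← mem_iff_coreLetter (goodSet_subset T Z hx)]
    exact levelSubset h.levels hu hxD
  next u hu i hi := by
    rw [h.measure_branch_ne_zero_iff hu] at hi
    obtain ⟨v, hv⟩ := h.exists_arrowVia hu hi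
    rw [h.nextLevel_eq hv]
    refine ⟨hv.2.1, hv.2.2.trans (EventuallyEq.inter ?_ ?_)⟩
    · filter_upwards [h.ae_good] with x hx
      exact propext (mem_iff_coreLetter (goodSet_subset T Z hx) i)
    · rw [image_borelMap inter_subset_left]
      refine h.image_ae_eq (levelSubset h.levels hu)
        (inter_subset_right.trans (levelSubset h.levels hu)) ?_
      filter_upwards [h.ae_good] with x hx
      exact propext ⟨fun hxD => ⟨hx, hxD⟩, fun hxD => hxD.2⟩
  distinct := h.levels.distinct
  generating A hA ε hε := h.generating hA hε

/-- A level has positive measure while distinct pieces overlap in null sets, so exactly one index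
contributes to the sum. -/
theorem levelSlope_eq (h : IsSystem μ T Z s α D) {u : ℕ} (hu : u ∈ α) :
    levelSlope Z s D u = s (levelLetter Z D u) := by
  classical
  have hiff : ∀ i, D u ⊆ Z i ↔ i = levelLetter Z D u := by
    intro i
    constructor
    · intro hi
      by_contra hne
      exact h.level_ne_zero hu (measure_mono_null (subset_inter hi (levelSubset h.levels hu))
        (h.partition.overlap _ _ hne))
    · rintro rfl
      exact levelSubset h.levels hu
  simp only [levelSlope, hiff]
  simp

theorem towerMap_eq (p : ℕ × X) (hp : p.2 ∈ goodSet T Z) :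
    towerMap μ T Z α D p =
      stepMap (borelMap T Z) (coreLetter Z) (nextLevel μ T Z α D) p := by
  have hT : T p.2 ∈ coreUnion Z := by
    rw [← borelMap_eq_of_good hp]
    exact hp 1
  rw [towerMap, stepMap, borelMap_eq_of_good hp, nextLevel]
  congr 2
  ext v
  constructor
  · rintro ⟨i, hi, hv⟩
    rw [mem_iff_coreLetter hT] at hi
    rwa [hi]
  · exact fun hv => ⟨_, (mem_iff_coreLetter hT _).2 rfl, hv⟩

end IsSystem

end Model

/-! ### The limit of the Cesàro means -/

section Limit

open scoped ENNReal symmDiff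

theorem integral_level {X : Type*} [MeasurableSpace X] {μ : Measure X} {κ : Measure (ℕ × X)}
    {u : ℕ} {B : Set X} {c : ℝ≥0∞}
    (hκ : ∀ A, MeasurableSet A → κ ({u} ×ˢ A) = c * μ (A ∩ B)) {g : X → ℝ} (hg : Measurable g) :
    ∫ p, (if p.1 = u then 1 else 0) * g p.2 ∂κ = c.toReal * ∫ x in B, g x ∂μ := by
  have hm : MeasurableSet {p : ℕ × X | p.1 = u} := measurable_fst (measurableSet_singleton u)
  have h1 : (fun p : ℕ × X => (if p.1 = u then (1 : ℝ) else 0) * g p.2) =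
      {p : ℕ × X | p.1 = u}.indicator fun p => g p.2 := by
    funext p
    by_cases hp : p.1 = u <;> simp [hp]
  have h2 : (κ.restrict {p : ℕ × X | p.1 = u}).map Prod.snd = c • μ.restrict B := by
    ext A hA
    rw [Measure.map_apply measurable_snd hA, Measure.restrict_apply (measurable_snd hA),
      Measure.smul_apply, Measure.restrict_apply hA, smul_eq_mul, ← hκ A hA]
    congr 1
    ext p
    simp [and_comm]
  rw [h1, integral_indicator hm, ← integral_map measurable_snd.aemeasurable
    hg.stronglyMeasurable.aestronglyMeasurable, h2, integral_smul_measure, smul_eq_mul]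

variable {n N : ℕ} {X : Set (EuclideanSpace ℝ (Fin n))}

open Classical in
theorem muBar_eq_levelMeasure (μ : Measure X) (α : Set ℕ) (D : ℕ → Set X) :
    muBar μ α D = levelMeasure μ D fun u => if u ∈ α then 1 else 0 := by
  ext A hA
  rw [muBar, Measure.sum_apply _ hA, levelMeasure_apply hA]
  have h1 : ∀ u : α, ((μ.restrict (D u)).map fun x => ((u : ℕ), x)) A =
      μ (Prod.mk (u : ℕ) ⁻¹' A ∩ D u) := fun u => by
    rw [Measure.map_apply measurable_prodMk_left hA,
      Measure.restrict_apply (measurable_prodMk_left hA)]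
  rw [tsum_congr h1, tsum_subtype α fun u => μ (Prod.mk u ⁻¹' A ∩ D u)]
  refine tsum_congr fun u => ?_
  by_cases hu : u ∈ α <;> simp [hu]

/-- The density of the base of the tower. -/
def baseDensity (N : ℕ) (u : ℕ) : ℝ≥0∞ := if u < N then 1 else 0

/-- The densities of the Cesàro means. -/
def cesaroDensity (L : (ℕ → ℝ≥0∞) → ℕ → ℝ≥0∞) (N m : ℕ) (u : ℕ) : ℝ≥0∞ :=
  (m : ℝ≥0∞)⁻¹ * ∑ k ∈ Finset.range m, L^[k] (baseDensity N) u

namespace IsSystem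

variable {μ : Measure X} {T : X → X} {Z : Fin N → Set X} {s : Fin N → ℝ} {α : Set ℕ}
  {D : ℕ → Set X}

/-- The transfer operator of the Borel model. -/
abbrev op [Nonempty (Fin N)] (μ : Measure X) (T : X → X) (Z : Fin N → Set X) (s : Fin N → ℝ)
    (α : Set ℕ) (D : ℕ → Set X) : (ℕ → ℝ≥0∞) → ℕ → ℝ≥0∞ :=
  transfer μ (borelMap T Z) (coreLetter Z) s α D (levelLetter Z D) (nextLevel μ T Z α D)

/-- The Borel version of the tower map. -/
abbrev step [Nonempty (Fin N)] (μ : Measure X) (T : X → X) (Z : Fin N → Set X)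
    (α : Set ℕ) (D : ℕ → Set X) : ℕ × X → ℕ × X :=
  stepMap (borelMap T Z) (coreLetter Z) (nextLevel μ T Z α D)

variable {μhat : Measure (ℕ × X)}

theorem rho_eq_zero (hl : LiftsTo μ T Z α D μhat) {u : ℕ} (hu : u ∉ α) :
    rho μ α D μhat u = 0 := by
  have : μhat ({u} ×ˢ D u) = 0 := by
    refine measure_mono_null ?_ hl.carried
    rintro p ⟨hp, -⟩ hpt
    exact hu (by rw [← show p.1 = u from hp]; exact hpt.1)
  rw [rho, this, ENNReal.toReal_zero, zero_div]

theorem rho_nonneg (u : ℕ) : 0 ≤ rho μ α D μhat u :=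
  div_nonneg ENNReal.toReal_nonneg ENNReal.toReal_nonneg

theorem ae_levelMeasure_good [IsProbabilityMeasure μ] (h : IsSystem μ T Z s α D) (r : ℕ → ℝ≥0∞) :
    ∀ᵐ p ∂levelMeasure μ D r, p.2 ∈ goodSet T Z := by
  rw [ae_iff]
  have hm : MeasurableSet {p : ℕ × X | ¬ p.2 ∈ goodSet T Z} :=
    measurable_snd h.measurableSet_goodSet.compl
  rw [levelMeasure_apply hm, ENNReal.tsum_eq_zero]
  intro u
  have : μ (Prod.mk u ⁻¹' {p : ℕ × X | ¬ p.2 ∈ goodSet T Z} ∩ D u) = 0 :=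
    measure_mono_null inter_subset_left h.measure_compl_goodSet
  rw [this, mul_zero]

theorem mem_of_lt (h : IsSystem μ T Z s α D) {u : ℕ} (hu : u < N) : u ∈ α :=
  (h.levels.base ⟨u, hu⟩).1

theorem baseDensity_eq_zero (h : IsSystem μ T Z s α D) {u : ℕ} (hu : u ∉ α) :
    baseDensity N u = 0 :=
  if_neg fun hlt => hu (h.mem_of_lt hlt)

variable [Nonempty (Fin N)]

theorem iterate_towerMap_eq (k : ℕ) (p : ℕ × X) (hp : p.2 ∈ goodSet T Z) :
    (towerMap μ T Z α D)^[k] p = (step μ T Z α D)^[k] p := by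
  induction k with
  | zero => rfl
  | succ k ih =>
    rw [Function.iterate_succ_apply', Function.iterate_succ_apply', ih]
    refine towerMap_eq _ ?_
    rw [iterate_stepMap_snd]
    exact (mapsTo_goodSet T Z).iterate k hp

variable [IsProbabilityMeasure μ]

theorem restrict_towerBase (h : IsSystem μ T Z s α D) :
    (muBar μ α D).restrict (towerBase N α D) = levelMeasure μ D (baseDensity N) := by
  classical
  have hbm : MeasurableSet (towerBase N α D) :=
    h.isCleanTower.measurableSet_levels.inter (measurableSet_lt measurable_fst measurable_const)
  ext A hA
  rw [Measure.restrict_apply hA, muBar_eq_levelMeasure, levelMeasure_apply (hA.inter hbm),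
    levelMeasure_apply hA]
  refine tsum_congr fun u => ?_
  rw [baseDensity]
  by_cases hu : u < N
  · rw [if_pos (h.mem_of_lt hu), if_pos hu]
    congr 2
    ext x
    have hua := h.mem_of_lt hu
    constructor
    · exact fun hx => ⟨hx.1.1, hx.2⟩
    · exact fun hx => ⟨⟨hx.1, ⟨hua, hx.2⟩, hu⟩, hx.2⟩
  · have : Prod.mk u ⁻¹' (A ∩ towerBase N α D) ∩ D u = ∅ := by
      rw [eq_empty_iff_forall_notMem]
      exact fun x hx => hu hx.1.2.2
    rw [this, measure_empty, mul_zero, if_neg hu, zero_mul]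

theorem map_iterate_towerBase (h : IsSystem μ T Z s α D) (k : ℕ) :
    ((muBar μ α D).restrict (towerBase N α D)).map (towerMap μ T Z α D)^[k] =
      levelMeasure μ D ((op μ T Z s α D)^[k] (baseDensity N)) := by
  rw [h.restrict_towerBase, ← h.isCleanTower.map_iterate_levelMeasure
    (fun u hu => h.baseDensity_eq_zero hu)]
  refine Measure.map_congr ?_
  filter_upwards [h.ae_levelMeasure_good (baseDensity N)] with p hp
  exact iterate_towerMap_eq k p hp

theorem cesaro_level (h : IsSystem μ T Z s α D) (m u : ℕ) {A : Set X} (hA : MeasurableSet A) :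
    cesaro μ T Z α D m ({u} ×ˢ A) = cesaroDensity (op μ T Z s α D) N m u * μ (A ∩ D u) := by
  rw [cesaro, Measure.smul_apply, Measure.finsetSum_apply, cesaroDensity, smul_eq_mul, mul_assoc,
    Finset.sum_mul]
  congr 1
  refine Finset.sum_congr rfl fun k _ => ?_
  rw [h.map_iterate_towerBase, levelMeasure_level hA]

/-- The iterates preserve the total mass of the base, which is at most `N`. This keeps densities
finite and controls the boundary term of the Cesàro means. -/
theorem iterate_op_mul_le (h : IsSystem μ T Z s α D) (k u : ℕ) :
    (op μ T Z s α D)^[k] (baseDensity N) u * μ (D u) ≤ N := by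
  calc _ ≤ levelMeasure μ D ((op μ T Z s α D)^[k] (baseDensity N)) univ := by
        rw [levelMeasure_apply MeasurableSet.univ]
        simp only [preimage_univ, univ_inter]
        exact ENNReal.le_tsum (f := fun u =>
          (op μ T Z s α D)^[k] (baseDensity N) u * μ (D u)) u
    _ = levelMeasure μ D (baseDensity N) univ := by
        rw [← h.isCleanTower.map_iterate_levelMeasure (fun u hu => h.baseDensity_eq_zero hu),
          Measure.map_apply (h.isCleanTower.measurable_stepMap.iterate k) MeasurableSet.univ,
          preimage_univ]
    _ = ∑' u, baseDensity N u * μ (D u) := by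
        rw [levelMeasure_apply MeasurableSet.univ]
        simp
    _ = ∑ u ∈ Finset.range N, baseDensity N u * μ (D u) := by
        refine tsum_eq_sum fun u hu => ?_
        rw [baseDensity, if_neg (by simpa using hu), zero_mul]
    _ ≤ ∑ u ∈ Finset.range N, 1 := by
        refine Finset.sum_le_sum fun u hu => ?_
        rw [baseDensity, if_pos (by simpa using hu), one_mul]
        exact prob_le_one
    _ = N := by simp

theorem cesaroDensity_mul_le (h : IsSystem μ T Z s α D) (m u : ℕ) :
    cesaroDensity (op μ T Z s α D) N m u * μ (D u) ≤ N := by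
  rw [cesaroDensity, mul_assoc, Finset.sum_mul]
  calc _ ≤ (m : ℝ≥0∞)⁻¹ * ∑ k ∈ Finset.range m, (N : ℝ≥0∞) := by
        gcongr with k
        exact h.iterate_op_mul_le k u
    _ = ((m : ℝ≥0∞)⁻¹ * m) * N := by simp [mul_assoc]
    _ ≤ 1 * N := by
        gcongr
        exact ENNReal.inv_mul_le_one _
    _ = N := one_mul _

theorem cesaroDensity_eq_zero (h : IsSystem μ T Z s α D) (m : ℕ) {u : ℕ} (hu : u ∉ α) :
    cesaroDensity (op μ T Z s α D) N m u = 0 := by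
  rw [cesaroDensity, Finset.sum_eq_zero, mul_zero]
  exact fun k _ => h.isCleanTower.iterate_transfer_eq_zero
    (fun u hu => h.baseDensity_eq_zero hu) k hu

theorem cesaroDensity_ne_top (h : IsSystem μ T Z s α D) (m u : ℕ) :
    cesaroDensity (op μ T Z s α D) N m u ≠ ∞ := by
  by_cases hu : u ∈ α
  · intro htop
    have := h.cesaroDensity_mul_le m u
    rw [htop, ENNReal.top_mul (h.level_ne_zero hu)] at this
    exact absurd this (by simp)
  · rw [h.cesaroDensity_eq_zero m hu]
    exact ENNReal.zero_ne_top

/-- Applying the operator to a Cesàro mean shifts the sum by one. The lost initial term only helps,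
and the new last term divided by `m` is the stated error. -/
theorem op_cesaroDensity_le (h : IsSystem μ T Z s α D) (m : ℕ) {v : ℕ} (hv : v ∈ α) :
    op μ T Z s α D (cesaroDensity (op μ T Z s α D) N m) v ≤
      cesaroDensity (op μ T Z s α D) N m v + (m : ℝ≥0∞)⁻¹ * (N * (μ (D v))⁻¹) := by
  classical
  have hlin : op μ T Z s α D (cesaroDensity (op μ T Z s α D) N m) v =
      (m : ℝ≥0∞)⁻¹ * ∑ k ∈ Finset.range m, (op μ T Z s α D)^[k + 1] (baseDensity N) v := by
    simp only [op, transfer, Function.iterate_succ_apply']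
    rw [← Summable.tsum_finsetSum fun i _ => ENNReal.summable, ← ENNReal.tsum_mul_left]
    refine tsum_congr fun t => ?_
    split_ifs
    · rw [cesaroDensity, mul_assoc, Finset.sum_mul]
    · simp
  rw [hlin, cesaroDensity, ← mul_add]
  gcongr
  calc ∑ k ∈ Finset.range m, (op μ T Z s α D)^[k + 1] (baseDensity N) v
      ≤ ∑ k ∈ Finset.range (m + 1), (op μ T Z s α D)^[k] (baseDensity N) v := by
        rw [Finset.sum_range_succ']
        exact le_self_add
    _ = ∑ k ∈ Finset.range m, (op μ T Z s α D)^[k] (baseDensity N) v +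
        (op μ T Z s α D)^[m] (baseDensity N) v := Finset.sum_range_succ _ _
    _ ≤ _ := by
        gcongr
        rw [← div_eq_mul_inv, ENNReal.le_div_iff_mul_le (Or.inl (h.level_ne_zero hv))
          (Or.inl (measure_ne_top _ _))]
        exact h.iterate_op_mul_le m v

theorem tendsto_integral_level [CompactSpace X] (h : IsSystem μ T Z s α D)
    (hl : LiftsTo μ T Z α D μhat) (u : ℕ) {g : X → ℝ} (hg : Continuous g) :
    Tendsto (fun m => (cesaroDensity (op μ T Z s α D) N m u).toReal * ∫ x in D u, g x ∂μ) atTop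
      (𝓝 (∫ p, (if p.1 = u then 1 else 0) * g p.2 ∂μhat)) := by
  have hc : Continuous fun p : ℕ × X => (if p.1 = u then (1 : ℝ) else 0) * g p.2 :=
    ((continuous_of_discreteTopology (f := fun v : ℕ => if v = u then (1 : ℝ) else 0)).comp
      continuous_fst).mul (hg.comp continuous_snd)
  have hs : HasCompactSupport fun p : ℕ × X => (if p.1 = u then (1 : ℝ) else 0) * g p.2 := by
    refine HasCompactSupport.intro (isCompact_singleton.prod isCompact_univ :
      IsCompact (({u} : Set ℕ) ×ˢ (univ : Set X))) fun p hp => ?_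
    have : p.1 ≠ u := fun hpu => hp ⟨hpu, mem_univ _⟩
    simp [this]
  refine (hl.vague _ hc hs).congr fun m => ?_
  exact integral_level (fun A hA => h.cesaro_level m u hA) hg.measurable

theorem tendsto_cesaroDensity [CompactSpace X] (h : IsSystem μ T Z s α D)
    (hl : LiftsTo μ T Z α D μhat) (u : ℕ) :
    Tendsto (fun m => (cesaroDensity (op μ T Z s α D) N m u).toReal) atTop
      (𝓝 (rho μ α D μhat u)) := by
  classical
  by_cases hu : u ∈ α
  swap
  · rw [rho_eq_zero hl hu]
    simp [h.cesaroDensity_eq_zero _ hu]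
  have := hl.prob
  have hDpos : 0 < μ.real (D u) := ENNReal.toReal_pos (h.level_ne_zero hu) (measure_ne_top _ _)
  have h1 := h.tendsto_integral_level hl u (continuous_const (y := (1 : ℝ)))
  have h2 : ∫ p, (if p.1 = u then 1 else 0) * (1 : ℝ) ∂μhat = (μhat ({u} ×ˢ D u)).toReal := by
    have e1 : (fun p : ℕ × X => (if p.1 = u then 1 else 0) * (1 : ℝ)) =
        {p : ℕ × X | p.1 = u}.indicator 1 := by
      funext p
      by_cases hp : p.1 = u <;> simp [hp]
    have hm : MeasurableSet {p : ℕ × X | p.1 = u} := measurable_fst (measurableSet_singleton u)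
    rw [e1, integral_indicator_one hm, Measure.real]
    congr 1
    refine measure_congr ?_
    filter_upwards [mem_ae_iff.2 hl.carried] with p hp
    apply propext
    exact ⟨fun hpu => ⟨hpu, by rw [← show p.1 = u from hpu]; exact hp.2⟩, fun hpu => hpu.1⟩
  have h3 : muBar μ α D ({u} ×ˢ D u) = μ (D u) := by
    rw [muBar_eq_levelMeasure, levelMeasure_level (h.levels.measurable u hu), if_pos hu, one_mul,
      inter_self]
  rw [h2] at h1
  simp only [integral_const, MeasurableSet.univ, measureReal_restrict_apply, univ_inter, smul_eq_mul,
    mul_one] at h1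
  have h4 := h1.div_const (μ.real (D u))
  rw [rho, h3]
  refine h4.congr fun m => ?_
  exact mul_div_cancel_right₀ _ hDpos.ne'

/-- On a fixed level every Cesàro mean is a multiple of `μ`, and the multiples converge by
`tendsto_cesaroDensity`. Integrals of continuous functions identify the limit. -/
theorem lift_level [CompactSpace X] (h : IsSystem μ T Z s α D) (hl : LiftsTo μ T Z α D μhat)
    (u : ℕ) {A : Set X} (hA : MeasurableSet A) :
    μhat ({u} ×ˢ A) = ENNReal.ofReal (rho μ α D μhat u) * μ (A ∩ D u) := by
  have := hl.prob
  have hm : MeasurableSet {p : ℕ × X | p.1 = u} := measurable_fst (measurableSet_singleton u)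
  have key : (μhat.restrict {p : ℕ × X | p.1 = u}).map Prod.snd =
      ENNReal.ofReal (rho μ α D μhat u) • μ.restrict (D u) := by
    have : IsFiniteMeasure (ENNReal.ofReal (rho μ α D μhat u) • μ.restrict (D u)) :=
      Measure.smul_finite _ ENNReal.ofReal_ne_top
    refine ext_of_forall_integral_eq_of_IsFiniteMeasure fun g => ?_
    rw [integral_smul_measure, ENNReal.toReal_ofReal (rho_nonneg u), smul_eq_mul,
      integral_map measurable_snd.aemeasurable g.continuous.aestronglyMeasurable,
      ← integral_indicator hm]
    have e1 : {p : ℕ × X | p.1 = u}.indicator (fun p => g p.2) =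
        fun p : ℕ × X => (if p.1 = u then (1 : ℝ) else 0) * g p.2 := by
      funext p
      by_cases hp : p.1 = u <;> simp [hp]
    rw [e1]
    exact tendsto_nhds_unique (h.tendsto_integral_level hl u g.continuous)
      ((h.tendsto_cesaroDensity hl u).mul_const _)
  have := congrArg (fun κ => κ A) key
  simp only [Measure.smul_apply, smul_eq_mul] at this
  rw [Measure.map_apply measurable_snd hA, Measure.restrict_apply (measurable_snd hA),
    Measure.restrict_apply hA] at this
  rw [← this]
  congr 1
  ext p
  simp [and_comm]

theorem eq_levelMeasure [CompactSpace X] (h : IsSystem μ T Z s α D)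
    (hl : LiftsTo μ T Z α D μhat) :
    μhat = levelMeasure μ D fun u => ENNReal.ofReal (rho μ α D μhat u) :=
  measure_ext_of_forall_level fun u A hA => by
    rw [h.lift_level hl u hA, levelMeasure_level hA]

theorem lift_unique [CompactSpace X] (h : IsSystem μ T Z s α D) (hl : LiftsTo μ T Z α D μhat)
    {κ : Measure (ℕ × X)} (hκ : LiftsTo μ T Z α D κ) : κ = μhat := by
  rw [h.eq_levelMeasure hl, h.eq_levelMeasure hκ]
  congr 1
  funext u
  rw [tendsto_nhds_unique (h.tendsto_cesaroDensity hl u) (h.tendsto_cesaroDensity hκ u)]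

/-- Fatou: a level may have infinitely many incoming arrows, so the limit is taken in finite partial
sums, and only an inequality survives. -/
theorem op_rho_le [CompactSpace X] (h : IsSystem μ T Z s α D) (hl : LiftsTo μ T Z α D μhat)
    (v : ℕ) :
    op μ T Z s α D (fun u => ENNReal.ofReal (rho μ α D μhat u)) v ≤
      ENNReal.ofReal (rho μ α D μhat v) := by
  classical
  by_cases hv : v ∈ α
  swap
  · rw [op, h.isCleanTower.transfer_eq_zero hv]
    exact zero_le
  have hlim : ∀ u, Tendsto (fun m => cesaroDensity (op μ T Z s α D) N m u) atTop
      (𝓝 (ENNReal.ofReal (rho μ α D μhat u))) := fun u =>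
    (ENNReal.tendsto_ofReal (h.tendsto_cesaroDensity hl u)).congr fun m =>
      ENNReal.ofReal_toReal (h.cesaroDensity_ne_top m u)
  have hbound : Tendsto (fun m : ℕ => cesaroDensity (op μ T Z s α D) N m v +
      (m : ℝ≥0∞)⁻¹ * (N * (μ (D v))⁻¹)) atTop (𝓝 (ENNReal.ofReal (rho μ α D μhat v) + 0)) := by
    refine (hlim v).add ?_
    have htop : (N * (μ (D v))⁻¹ : ℝ≥0∞) ≠ ∞ :=
      ENNReal.mul_ne_top (ENNReal.natCast_ne_top N) (ENNReal.inv_ne_top.2 (h.level_ne_zero hv))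
    simpa using ENNReal.Tendsto.mul_const ENNReal.tendsto_inv_nat_nhds_zero (Or.inr htop)
  rw [add_zero] at hbound
  simp only [op, transfer]
  rw [ENNReal.tsum_eq_iSup_sum]
  refine iSup_le fun F => ?_
  have hF : Tendsto (fun m => ∑ t ∈ F, if Step μ (borelMap T Z) (coreLetter Z) α D
      (nextLevel μ T Z α D) t v then cesaroDensity (op μ T Z s α D) N m t *
        (ENNReal.ofReal (s (levelLetter Z D t)))⁻¹ else 0) atTop
      (𝓝 (∑ t ∈ F, if Step μ (borelMap T Z) (coreLetter Z) α D (nextLevel μ T Z α D) t v then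
        ENNReal.ofReal (rho μ α D μhat t) *
          (ENNReal.ofReal (s (levelLetter Z D t)))⁻¹ else 0)) := by
    refine tendsto_finsetSum _ fun t _ => ?_
    split_ifs
    · exact ENNReal.Tendsto.mul_const (hlim t)
        (Or.inr (ENNReal.inv_ne_top.2 (h.isCleanTower.slope_ne_zero _)))
    · exact tendsto_const_nhds
  refine le_of_tendsto_of_tendsto' hF hbound fun m => ?_
  refine le_trans ?_ (h.op_cesaroDensity_le m hv)
  exact ENNReal.sum_le_tsum F

theorem isRugWeight [CompactSpace X] (h : IsSystem μ T Z s α D) (hl : LiftsTo μ T Z α D μhat) :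
    IsRugWeight μ (borelMap T Z) (coreLetter Z) s α D (levelLetter Z D) (nextLevel μ T Z α D)
      (rho μ α D μhat) where
  nonneg := rho_nonneg
  eq_zero _ hu := rho_eq_zero hl hu
  total := by
    have := hl.prob.measure_univ
    rw [h.eq_levelMeasure hl, levelMeasure_apply MeasurableSet.univ] at this
    simpa using this
  invariant v := by
    have := hl.prob
    by_cases hv : v ∈ α
    swap
    · rw [h.isCleanTower.transfer_eq_zero hv, rho_eq_zero hl hv, ENNReal.ofReal_zero]
    set ρ' : ℕ → ℝ≥0∞ := fun u => ENNReal.ofReal (rho μ α D μhat u) with hρ'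
    have hμ : μhat = levelMeasure μ D ρ' := h.eq_levelMeasure hl
    have hmap : μhat.map (step μ T Z α D) = levelMeasure μ D (op μ T Z s α D ρ') := by
      rw [hμ]
      refine h.isCleanTower.map_levelMeasure fun u hu => ?_
      simp only [hρ', rho_eq_zero hl hu, ENNReal.ofReal_zero]
    have hle : levelMeasure μ D (op μ T Z s α D ρ') ≤ μhat := by
      rw [hμ]
      refine Measure.le_iff.2 fun A hA => ?_
      rw [levelMeasure_apply hA, levelMeasure_apply hA]
      exact ENNReal.tsum_le_tsum fun u => by gcongr; exact h.op_rho_le hl u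
    -- The left side is the image of `μ̂` and has the same finite mass, so domination by `μ̂` forces
    -- equality. Dividing by the positive measure of a level gives the equation for the densities.
    have heq : levelMeasure μ D (op μ T Z s α D ρ') = μhat := by
      have := isFiniteMeasure_of_le μhat hle
      refine Measure.eq_of_le_of_measure_univ_eq hle ?_
      rw [← hmap, Measure.map_apply h.isCleanTower.measurable_stepMap MeasurableSet.univ,
        preimage_univ]
    have h1 := congrArg (fun κ => κ ({v} ×ˢ D v)) (heq.trans hμ)
    simp only [levelMeasure_level (h.levels.measurable v hv), inter_self] at h1
    exact (ENNReal.mul_left_inj (h.level_ne_zero hv) (measure_ne_top _ _)).1 h1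

end IsSystem

end Limit

/-! ### The natural extension -/

section Extension

open scoped ENNReal symmDiff

theorem nullMeasurableSet_image_iterate_of_bijOn {Ω : Type*} [MeasurableSpace Ω]
    [StandardBorelSpace Ω] {ν : Measure Ω} {F : Ω → Ω} (hF : MeasurePreserving F ν ν) {Y : Set Ω}
    (hY : MeasurableSet Y) (hY0 : ν Yᶜ = 0) (hbij : BijOn F Y Y) {B : Set Ω}
    (hB : NullMeasurableSet B ν) (hBY : B ⊆ Y) (k : ℕ) : NullMeasurableSet (F^[k] '' B) ν := by
  obtain ⟨t, htB, ht, hte⟩ := hB.exists_measurable_subset_ae_eq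
  have h0 : ν (B \ t) = 0 := ae_le_set.1 hte.symm.le
  have hm : MeasurableSet (toMeasurable ν (B \ t) ∩ Y) :=
    (measurableSet_toMeasurable _ _).inter hY
  have h1 : ν (F^[k] '' (B \ t)) = 0 := by
    refine measure_mono_null
      (image_mono (subset_inter (subset_toMeasurable ν _) (sdiff_subset.trans hBY))) ?_
    rw [(measure_image_iterate_of_bijOn hF hY0 hbij hm inter_subset_right k).2]
    exact measure_mono_null inter_subset_left ((measure_toMeasurable _).trans h0)
  rw [← union_sdiff_cancel htB, image_union]
  exact (measure_image_iterate_of_bijOn hF hY0 hbij ht (htB.trans hBY) k).1.nullMeasurableSet.union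
    (NullMeasurableSet.of_null h1)

theorem map_snd_levelMeasure_absolutelyContinuous {X : Type*} [MeasurableSpace X] (μ : Measure X)
    (D : ℕ → Set X) (r : ℕ → ℝ≥0∞) : (levelMeasure μ D r).map Prod.snd ≪ μ := by
  refine Measure.AbsolutelyContinuous.mk fun A hA h0 => ?_
  rw [Measure.map_apply measurable_snd hA, levelMeasure_apply (measurable_snd hA),
    ENNReal.tsum_eq_zero]
  intro u
  have : μ (Prod.mk u ⁻¹' (Prod.snd ⁻¹' A) ∩ D u) = 0 := measure_mono_null inter_subset_left h0
  rw [this, mul_zero]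

theorem IsTowerInvariant.measurePreserving_base {X : Type*} [MeasurableSpace X] {N : ℕ}
    {μ : Measure X} {T : X → X} {J : X → Fin N} {α : Set ℕ} {D : ℕ → Set X}
    {nxt : ℕ → Fin N → ℕ} {κ : Measure (ℕ × X)} (hκ : IsTowerInvariant μ T J α D nxt κ)
    (hT : Measurable T) : MeasurePreserving T (κ.map Prod.snd) (κ.map Prod.snd) := by
  refine ⟨hT, ?_⟩
  rw [Measure.map_map hT measurable_snd]
  nth_rewrite 2 [← hκ.preserving.map_eq]
  rw [Measure.map_map measurable_snd hκ.preserving.measurable]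
  rfl

variable {n N : ℕ} {X : Set (EuclideanSpace ℝ (Fin n))}

/-- The maps `F'` and `T'` need only agree with the Borel model on the good sets, so the statement
applies to the original maps although they need not be Borel. -/
theorem IsCleanTower.isNaturalExtension [CompactSpace X] {μ : Measure X} [IsProbabilityMeasure μ]
    {T : X → X} {G : Set X} {J : X → Fin N} {s : Fin N → ℝ} {α : Set ℕ} {D : ℕ → Set X}
    {j : ℕ → Fin N} {nxt : ℕ → Fin N → ℕ} {ρ : ℕ → ℝ} (h : IsCleanTower μ T G J s α D j nxt)
    (hna : ∀ x, μ {x} = 0) (hρ : IsRugWeight μ T J s α D j nxt ρ)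
    {F' : (ℕ × X) × ℝ → (ℕ × X) × ℝ} {T' : X → X}
    (hF' : EqOn F' (rugStep μ T J s α D j nxt ρ) (goodRug μ T G J α D ρ)) (hT' : EqOn T' T G) :
    IsNaturalExtension (rugSpace α D ρ) (rugVolume μ α D ρ) F'
      ((levelMeasure μ D fun u => ENNReal.ofReal (ρ u)).map Prod.snd) (lebesgueAlgebra μ) T'
      (fun z : (ℕ × X) × ℝ => z.1.2) := by
  set F := rugStep μ T J s α D j nxt ρ with hF
  set ν := rugVolume μ α D ρ with hν
  set κ := levelMeasure μ D fun u => ENNReal.ofReal (ρ u) with hκ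
  set m := κ.map Prod.snd with hm
  set φ : (ℕ × X) × ℝ → X := fun z => z.1.2 with hφ
  have hνp : IsProbabilityMeasure ν := h.isProbabilityMeasure_rugVolume hρ
  have hκp : IsProbabilityMeasure κ := isProbabilityMeasure_levelMeasure hρ
  have hmp : IsProbabilityMeasure m := Measure.isProbabilityMeasure_map measurable_snd.aemeasurable
  have hpres : MeasurePreserving F ν ν := h.measurePreserving_rugStep hρ
  have hφm : Measurable φ := measurable_snd.comp measurable_fst
  have hφp : MeasurePreserving φ ν m := by
    refine ⟨hφm, ?_⟩
    rw [hm, hκ, ← h.map_fst_rugVolume hρ, Measure.map_map measurable_snd measurable_fst]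
    rfl
  have hac : m ≪ μ := map_snd_levelMeasure_absolutelyContinuous _ _ _
  have hTp : MeasurePreserving T m m :=
    (h.isTowerInvariant_levelMeasure hρ).measurePreserving_base h.measurable
  have hφq : Measure.QuasiMeasurePreserving φ ν μ :=
    hφp.quasiMeasurePreserving.mono_right hac
  have hTae : T' =ᵐ[m] T := by
    filter_upwards [hac.ae_le h.ae_good] with x hx using hT' hx
  obtain ⟨Y, hYg, hY, hY0, hbij⟩ := exists_bijOn_of_injOn hpres h.measurableSet_goodRug
    (h.measure_compl_goodRug hρ) (h.injOn_rugStep hρ)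
  have hYae : ∀ᵐ z ∂ν, z ∈ Y := mem_ae_iff.2 hY0
  have hY1 : ν Y = 1 := (prob_compl_eq_zero_iff hY).1 hY0
  have hFY : EqOn F' F Y := hF'.mono hYg
  have hFae : F' =ᵐ[ν] F := hYae.mono fun z hz => hFY hz
  have hit : ∀ k, EqOn F'^[k] F^[k] Y := by
    intro k
    induction k with
    | zero => exact fun _ _ => rfl
    | succ k ih =>
      intro z hz
      rw [Function.iterate_succ_apply, Function.iterate_succ_apply, hFY hz, ih (hbij.mapsTo hz)]
  have hbij' : BijOn F' Y Y := hbij.congr hFY.symm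
  have hφT : ∀ z ∈ Y, φ (F' z) = T' (φ z) := by
    intro z hz
    rw [hFY hz, hT' (hYg hz).1.2.1]
    rfl
  have hinter : ∀ A, (Y ∩ φ ⁻¹' A : Set ((ℕ × X) × ℝ)) =ᵐ[ν] (φ ⁻¹' A : Set _) := fun A => by
    filter_upwards [hYae] with z hz
    apply propext
    exact ⟨fun hzA => hzA.2, fun hzA => ⟨hz, hzA⟩⟩
  -- The factor map need not be injective, so images of Borel sets are in general only analytic.
  -- They lie in the completion because analytic sets are universally measurable.
  have himg : ∀ C, MeasurableSet C → NullMeasurableSet (φ '' C) μ := fun C hC =>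
    nullMeasurableSet_of_analyticSet (hC.analyticSet_image hφm)
  have himgs : ∀ k A, F'^[k] '' (Y ∩ φ ⁻¹' A) = F^[k] '' (Y ∩ φ ⁻¹' A) := fun k A =>
    image_congr fun z hz => hit k hz.1
  have hYsub : Y ⊆ rugSpace α D ρ := by
    intro z hz
    have hzg := hYg hz
    exact ⟨⟨hzg.1.1, hzg.1.2.2.1⟩, hzg.2.1, hzg.2.2.le⟩
  refine ⟨hνp, hmp, ⟨hpres.measurable.aemeasurable.congr hFae.symm, ?_⟩, fun A hA => ?_,
    φ '' Y, Y, himg Y hY, hY, hYsub, ?_, hY1, ?_, hbij'.mapsTo, ⟨hbij', fun C hC => ?_,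
    fun C hC hCY => ?_⟩, ⟨rfl, fun A hA => ?_, fun C hC _ => himg C hC⟩, fun A hA => ?_, hφT,
    fun k A hA => ?_, fun C hC => ?_⟩
  · rw [Measure.map_congr hFae, hpres.map_eq]
  · rw [← hTp.measure_preimage (NullMeasurableSet.mono_ac hA hac)]
    refine measure_congr ?_
    filter_upwards [hTae] with x hx
    apply propext
    change T' x ∈ A ↔ T x ∈ A
    rw [hx]
  · refine le_antisymm prob_le_one ?_
    rw [← hφp.measure_preimage ((himg Y hY).mono_ac hac), ← hY1]
    exact measure_mono (subset_preimage_image φ Y)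
  · rintro _ ⟨z, hz, rfl⟩
    exact ⟨F' z, hbij'.mapsTo hz, hφT z hz⟩
  · have : Y ∩ F' ⁻¹' C = Y ∩ F ⁻¹' C := by
      ext z
      refine and_congr_right fun hz => ?_
      rw [mem_preimage, mem_preimage, hFY hz]
    rw [this]
    exact hY.inter (hpres.measurable hC)
  · rw [image_congr fun z hz => hFY (hCY hz)]
    exact hC.image_of_measurable_injOn hpres.measurable (hbij.injOn.mono hCY)
  · exact hY.nullMeasurableSet.inter (NullMeasurableSet.preimage hA hφq)
  · rw [measure_congr (hinter A), hφp.measure_preimage (NullMeasurableSet.mono_ac hA hac)]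
  · rw [himgs]
    exact nullMeasurableSet_image_iterate_of_bijOn hpres hY hY0 hbij
      (hY.nullMeasurableSet.inter (NullMeasurableSet.preimage hA hφq)) inter_subset_left k
  · obtain ⟨C', hC', hCC'⟩ := h.eventuallyMeasurableSet_fiberAlgebra hna hρ hY hYg hY0 hbij hC
    refine ⟨C', ?_, hCC'⟩
    have : {S : Set ((ℕ × X) × ℝ) | ∃ (k : ℕ) (A : Set X), MeasurableSet[lebesgueAlgebra μ] A ∧
        S = F'^[k] '' (Y ∩ φ ⁻¹' A)} =
        {S | ∃ (k : ℕ) (A : Set X), NullMeasurableSet A μ ∧ S = F^[k] '' (Y ∩ φ ⁻¹' A)} := by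
      ext S
      simp only [mem_ofPred_eq, himgs]
      rfl
    rw [this]
    exact hC'

/-! ### Return to the original maps, and the case of an invariant measure. -/

namespace IsSystem

variable {μ : Measure X} {T : X → X} {Z : Fin N → Set X} {s : Fin N → ℝ} {α : Set ℕ}
  {D : ℕ → Set X} {μhat : Measure (ℕ × X)} [IsProbabilityMeasure μ]

theorem measurePreserving_borelMap (h : IsSystem μ T Z s α D) (hi : IsInvariant μ T) :
    MeasurePreserving (borelMap T Z) μ μ := by
  refine ⟨h.measurable_borelMap, ?_⟩
  ext A hA
  rw [Measure.map_apply h.measurable_borelMap hA, ← hi A hA.nullMeasurableSet]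
  refine measure_congr ?_
  filter_upwards [h.ae_good] with x hx
  apply propext
  change borelMap T Z x ∈ A ↔ T x ∈ A
  rw [borelMap_eq_of_good hx]

theorem ergodic_borelMap (h : IsSystem μ T Z s α D) (hi : IsInvariant μ T) (c5 : C5 μ T) :
    Ergodic (borelMap T Z) μ := by
  refine ⟨h.measurePreserving_borelMap hi, ⟨fun {A} hA hinv => ?_⟩⟩
  -- The hypothesis `c5` needs strict invariance under `T`, whereas `A` is invariant under the Borel
  -- modification. The set of points whose `T`-orbit ever enters the good part of `A` is strictly
  -- invariant, and it equals `A` modulo `μ`.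
  set B : Set X := {x | ∃ k, T^[k] x ∈ A ∩ goodSet T Z} with hB
  have hstep : ∀ x, borelMap T Z x ∈ A ↔ x ∈ A := fun x => by
    conv_rhs => rw [← hinv]
    rfl
  have hiter : ∀ k x, (borelMap T Z)^[k] x ∈ A ↔ x ∈ A := by
    intro k
    induction k with
    | zero => exact fun x => Iff.rfl
    | succ k ih => exact fun x => (ih _).trans (hstep x)
  have hTB : T ⁻¹' B = B := by
    ext x
    constructor
    · rintro ⟨k, hk⟩
      exact ⟨k + 1, hk⟩
    · rintro ⟨k, hk⟩
      cases k with
      | zero =>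
        have hx : x ∈ A ∩ goodSet T Z := hk
        refine ⟨0, ?_⟩
        change T x ∈ A ∩ goodSet T Z
        rw [← borelMap_eq_of_good hx.2]
        exact ⟨(hstep x).2 hx.1, mapsTo_goodSet T Z hx.2⟩
      | succ k => exact ⟨k, hk⟩
  have hBA : B =ᵐ[μ] A := by
    filter_upwards [h.ae_good] with x hx
    apply propext
    constructor
    · rintro ⟨k, hk, -⟩
      rwa [← iterate_borelMap_eq hx, hiter] at hk
    · exact fun hxA => ⟨0, hxA, hx⟩
  rw [eventuallyConst_set']
  rcases c5 B (hA.nullMeasurableSet.congr hBA.symm) hTB with h0 | h1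
  · left
    rw [measure_congr hBA] at h0
    exact ae_eq_empty.2 h0
  · right
    rw [measure_congr hBA] at h1
    exact ae_eq_univ.2 ((prob_compl_eq_zero_iff hA).2 h1)

variable [Nonempty (Fin N)]

theorem rugMap_eq (h : IsSystem μ T Z s α D) :
    EqOn (rugMap μ T Z s α D μhat)
      (rugStep μ (borelMap T Z) (coreLetter Z) s α D (levelLetter Z D) (nextLevel μ T Z α D)
        (rho μ α D μhat))
      (goodRug μ (borelMap T Z) (goodSet T Z) (coreLetter Z) α D (rho μ α D μhat)) := by
  classical
  intro z hz
  have h1 := towerMap_eq (μ := μ) (α := α) (D := D) z.1 hz.1.2.1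
  have h2 : ∀ v, ∑ t ∈ (Finset.range z.1.1).filter (fun t => Arrow μ T Z α D t v),
      rho μ α D μhat t / levelSlope Z s D t =
      ∑ t ∈ Finset.range z.1.1, stripHeight μ (borelMap T Z) (coreLetter Z) s α D
        (levelLetter Z D) (nextLevel μ T Z α D) (rho μ α D μhat) v t := by
    intro v
    rw [Finset.sum_filter]
    refine Finset.sum_congr rfl fun t _ => ?_
    rw [stripHeight]
    by_cases ht : Arrow μ T Z α D t v
    · have htα : t ∈ α := by
        obtain ⟨i, hi⟩ := ht
        exact hi.1
      rw [if_pos ht, if_pos ((h.step_iff_arrow t v).2 ht), h.levelSlope_eq htα]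
    · rw [if_neg ht, if_neg fun hs => ht ((h.step_iff_arrow t v).1 hs)]
  refine Prod.ext h1 ?_
  change z.2 / levelSlope Z s D z.1.1 + _ = _
  rw [h.levelSlope_eq hz.1.1, rugStep, ← h1]
  convert congrArg (z.2 / s (levelLetter Z D z.1.1) + ·) (h2 (towerMap μ T Z α D z.1).1) using 3

theorem rugMeasure_eq (μ : Measure X) (α : Set ℕ) (D : ℕ → Set X) (μhat : Measure (ℕ × X)) :
    rugMeasure μ α D μhat = rugVolume μ α D (rho μ α D μhat) := by
  rw [rugMeasure, muBar_eq_levelMeasure]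
  rfl

theorem isNaturalExtension [CompactSpace X] (h : IsSystem μ T Z s α D) (hna : ∀ x, μ {x} = 0)
    (hl : LiftsTo μ T Z α D μhat) :
    IsNaturalExtension (rugs μ α D μhat) (rugMeasure μ α D μhat) (rugMap μ T Z s α D μhat)
      (μhat.map Prod.snd) (lebesgueAlgebra μ) T (fun z : (ℕ × X) × ℝ => z.1.2) := by
  have := h.isCleanTower.isNaturalExtension hna (h.isRugWeight hl) h.rugMap_eq
    (fun x hx => (borelMap_eq_of_good hx).symm : EqOn T (borelMap T Z) (goodSet T Z))
  rwa [← h.eq_levelMeasure hl, ← rugMeasure_eq] at this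

theorem towerMap_ae_eq {κ : Measure (ℕ × X)} (h : IsSystem μ T Z s α D)
    (hac : κ.map Prod.snd ≪ μ) : towerMap μ T Z α D =ᵐ[κ] step μ T Z α D := by
  filter_upwards [ae_of_ae_map measurable_snd.aemeasurable (hac.ae_le h.ae_good)] with p hp
    using towerMap_eq p hp

theorem measure_preimage_towerMap {κ : Measure (ℕ × X)} (h : IsSystem μ T Z s α D)
    (hac : κ.map Prod.snd ≪ μ) (A : Set (ℕ × X)) :
    κ (towerMap μ T Z α D ⁻¹' A) = κ (step μ T Z α D ⁻¹' A) := by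
  refine measure_congr ?_
  filter_upwards [h.towerMap_ae_eq hac] with p hp
  apply propext
  change towerMap μ T Z α D p ∈ A ↔ step μ T Z α D p ∈ A
  rw [hp]

/-- Domination on each level is automatic with constant `1`, since the measure projects to `μ`. No
assumption on densities is needed for uniqueness. -/
theorem isTowerInvariant {κ : Measure (ℕ × X)} (h : IsSystem μ T Z s α D)
    (hκ : IsInvariantLift μ T Z α D κ) :
    IsTowerInvariant μ (borelMap T Z) (coreLetter Z) α D (nextLevel μ T Z α D) κ where
  preserving := by
    have hm := h.isCleanTower.measurable_stepMap
    refine ⟨hm, ?_⟩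
    ext A hA
    rw [Measure.map_apply hm hA, ← hκ.invariant A hA]
    exact (h.measure_preimage_towerMap hκ.proj.absolutelyContinuous A).symm
  dominated u := by
    refine ⟨1, ENNReal.one_ne_top, fun A => ?_⟩
    calc κ ({u} ×ˢ A) ≤ κ (Prod.snd ⁻¹' toMeasurable μ A) :=
          measure_mono fun p hp => subset_toMeasurable μ A hp.2
      _ = 1 * μ A := by
          rw [← Measure.map_apply measurable_snd (measurableSet_toMeasurable _ _), hκ.proj,
            measure_toMeasurable, one_mul]
  carried := hκ.carried

theorem invariantLift_unique [CompactSpace X] {κ κ' : Measure (ℕ × X)}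
    (h : IsSystem μ T Z s α D) (hκ : IsInvariantLift μ T Z α D κ)
    (hκ' : IsInvariantLift μ T Z α D κ') : κ = κ' := by
  have := hκ.prob
  have := hκ'.prob
  exact h.isCleanTower.eq_of_map_snd_eq (h.isTowerInvariant hκ) (h.isTowerInvariant hκ')
    (hκ.proj.trans hκ'.proj.symm)

/-- The projection is an invariant probability measure absolutely continuous with respect to the
ergodic measure `μ`, hence equal to it. -/
theorem isInvariantLift [CompactSpace X] (h : IsSystem μ T Z s α D) (hi : IsInvariant μ T)
    (c5 : C5 μ T) (hl : LiftsTo μ T Z α D μhat) : IsInvariantLift μ T Z α D μhat := by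
  have := hl.prob
  have hac : μhat.map Prod.snd ≪ μ := by
    rw [h.eq_levelMeasure hl]
    exact map_snd_levelMeasure_absolutelyContinuous _ _ _
  have hinv := h.isCleanTower.isTowerInvariant_levelMeasure (h.isRugWeight hl)
  rw [← h.eq_levelMeasure hl] at hinv
  have : IsProbabilityMeasure (μhat.map Prod.snd) :=
    Measure.isProbabilityMeasure_map measurable_snd.aemeasurable
  refine ⟨hl.prob, hl.carried, fun A hA => ?_,
    (h.ergodic_borelMap hi c5).eq_of_absolutelyContinuous
      (hinv.measurePreserving_base h.measurable_borelMap) hac⟩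
  rw [h.measure_preimage_towerMap hac]
  exact hinv.preserving.measure_preimage hA.nullMeasurableSet

end IsSystem

end Extension

end HofbauerTower

end

theorem mainTheorem1 {n N : ℕ} (X : Set (EuclideanSpace ℝ (Fin n))) (hX : IsCompact X)
    (μ : Measure X) [IsProbabilityMeasure μ] (hna : ∀ x : X, μ {x} = 0)
    (T : X → X) (Z : Fin N → Set X) (s : Fin N → ℝ)
    (hZ : HofbauerTower.IsPartition μ Z)
    (c1 : HofbauerTower.C1 T Z) (c2 : HofbauerTower.C2 μ T) (c3 : HofbauerTower.C3 μ T Z)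
    (c4 : HofbauerTower.C4 μ T Z s) (c5 : HofbauerTower.C5 μ T) (c6 : HofbauerTower.C6 μ T Z)
    (α : Set ℕ) (D : ℕ → Set X) (hD : HofbauerTower.IsLevels μ T Z α D)
    (μhat : Measure (ℕ × X)) (hlift : HofbauerTower.LiftsTo μ T Z α D μhat) :
    HofbauerTower.IsNaturalExtension
      (HofbauerTower.rugs μ α D μhat) (HofbauerTower.rugMeasure μ α D μhat)
      (HofbauerTower.rugMap μ T Z s α D μhat)
      (μhat.map Prod.snd) (HofbauerTower.lebesgueAlgebra μ) T
      (fun z : (ℕ × X) × ℝ => z.1.2) ∧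
    (HofbauerTower.IsInvariant μ T →
      μhat.map Prod.snd = μ ∧
      HofbauerTower.IsInvariantLift μ T Z α D μhat ∧
      (∀ κ : Measure (ℕ × X), HofbauerTower.IsInvariantLift μ T Z α D κ → κ = μhat) ∧
      (∀ κ : Measure (ℕ × X), HofbauerTower.LiftsTo μ T Z α D κ → κ = μhat)) := by
  have := isCompact_iff_compactSpace.1 hX
  have h : HofbauerTower.IsSystem μ T Z s α D := ⟨hZ, c1, c2, c3, c4, c6, hD⟩
  have := h.nonempty
  refine ⟨h.isNaturalExtension hna hlift, fun hi => ?_⟩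
  have hinv := h.isInvariantLift hi c5 hlift
  exact ⟨hinv.proj, hinv, fun κ hκ => h.invariantLift_unique hκ hinv,
    fun κ hκ => h.lift_unique hlift hκ⟩
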